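/- Let $K$ be a totally real number field with ring of integers $\mathcal O_K$, and let $\mathcal A=\left(\frac{a,b}{K}\right)$ be a totally definite quaternion algebra over $K$, with standard involution $\mathbf q\mapsto\overline{\mathbf q}$, reduced norm $\mathrm{nrd}(\mathbf q)=\mathbf q\overline{\mathbf q}$ and reduced trace $\mathrm{trd}(\mathbf q)=\mathbf q+\overline{\mathbf q}$; totally definite means that $\mathrm{nrd}(\mathbf q)$ is totally positive for every $\mathbf q\neq0$. An order is a subring of $\mathcal A$ that is an $\mathcal O_K$-lattice in $\mathcal A$. For an order $\mathcal G$ put $\mathcal G^1=\{\mathbf u\in\mathcal G: \mathrm{nrd}(\mathbf u)=1\}$ and, for $\alpha\in\mathcal O_K$, $r_{\mathcal G}(\alpha)=\#\{\mathbf q\in\mathcal G:\mathrm{nrd}(\mathbf q)=\alpha\}$. The class number of $\mathcal G$ is the number of classes of lattices $L\subset\mathcal A$ with right order $\{\mathbf x\in\mathcal A: L\mathbf x\subseteq L\}$ equal to $\mathcal G$, where $L$ and $L'$ are in the same class if $L=\mathbf xL'$ for some $\mathbf x\in\mathcal A^\times$. The reduced discriminant $\mathrm{discrd}\,\mathcal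 H$ of an order $\mathcal H$ is the ideal of $\mathcal O_K$ generated by all $\mathrm{trd}((\mathbf x_1\mathbf x_2-\mathbf x_2\mathbf x_1)\overline{\mathbf x_3})$ with $\mathbf x_1,\mathbf x_2,\mathbf x_3\in\mathcal H$, and the index $[\mathcal H:\mathcal G]_{\mathcal O_K}$ is the fractional ideal generated by the determinants of all $K$-linear maps $\delta:\mathcal A\to\mathcal A$ with $\delta(\mathcal H)\subseteq\mathcal G$. **Theorem.** Let $\mathcal H$ be a maximal order in $\mathcal A$, let $\mathfrak D=\mathrm{discrd}\,\mathcal H$, let $\mathfrak p\mid\mathfrak D$ be a nonzero prime ideal of $\mathcal O_K$, and let $q=\mathrm N(\mathfrak p)=\#(\mathcal O_K/\mathfrak p)$. Let $\mathcal G\subset\mathcal H$ be an order of class number $1$ such that * $[\mathcal H:\mathcal G]_{\mathcal O_K}=\mathfrak p^2$ (that is, $\mathcal G$ is of the kind $\mathfrak p^2$); * $\mathcal G$ is perceptive in $\mathcal H$: for every $\mathbf q\in\mathcal H$ there is $\mathbf u\in\mathcal H^1$ with $\mathbf u\mathbf q\in\mathcal G$; * the set of orders between $\mathcal G$ and $\mathcal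 H$ is linearly ordered by inclusion and contains an order $\mathcal M$ with $\mathcal G\subsetneq\mathcal M\subsetneq\mathcal H$. Let $\alpha\in\mathcal O_K$ be totally positive, and let $e\ge0$ be such that $\alpha\in\mathfrak p^e$ and $\alpha\notin\mathfrak p^{e+1}$. Then $\mathcal G^1$ and $\{\mathbf q\in\mathcal G:\mathrm{nrd}(\mathbf q)=\alpha\}$ are finite, and $$r_{\mathcal G}(\alpha)=\#\mathcal G^1\cdot\sigma_{\mathfrak D}(\alpha)\cdot\begin{cases}1,&e=0,\\ q,&e=1,\\ q^2+q,&e\ge2,\end{cases} \qquad \sigma_{\mathfrak D}(\alpha)=\sum_{\delta\mathcal O_K}\mathrm N(\delta\mathcal O_K),$$ where the sum runs over all principal ideals $\delta\mathcal O_K$ that divide $\alpha\mathcal O_K$ and are divisible by no prime ideal dividing $\mathfrak D$. -/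

import Mathlib

open scoped Quaternion NumberField

noncomputable section

set_option linter.unusedSectionVars false

namespace QuatOrders

variable {K : Type*} [Field K] [NumberField K] {a b : K}

/-- The reduced norm `q * q̄`, an element of the base field. -/
def nrd (q : ℍ[K,a,b]) : K := (q * star q).re

/-- The reduced trace `q + q̄`, an element of the base field. -/
def trd (q : ℍ[K,a,b]) : K := (q + star q).re

/-- `q * q̄` is the scalar `nrd q`. -/
theorem mul_star_eq_nrd (q : ℍ[K,a,b]) : q * star q = algebraMap K ℍ[K,a,b] (nrd q) := by
  ext <;> simp [nrd] <;> ring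

/-- `q + q̄` is the scalar `trd q`. -/
theorem add_star_eq_trd (q : ℍ[K,a,b]) : q + star q = algebraMap K ℍ[K,a,b] (trd q) := by
  ext <;> simp [trd]

/-- The coordinate formula of the reduced norm. -/
theorem nrd_eq (q : ℍ[K,a,b]) :
    nrd q = q.re ^ 2 - a * q.imI ^ 2 - b * q.imJ ^ 2 + a * b * q.imK ^ 2 := by
  simp [nrd]; ring

/-- An element of a totally real field is totally positive if it is positive under every real
embedding. -/
def TotallyPositive (x : K) : Prop := ∀ σ : K →+* ℝ, 0 < σ x

variable (a b) in
/-- The quaternion algebra `(a, b / K)` is (totally) definite: its reduced norm is a totally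
positive definite quadratic form over `K`. -/
def IsDefinite : Prop := ∀ q : ℍ[K,a,b], q ≠ 0 → TotallyPositive (nrd q)

/-- An order: a subring of the quaternion algebra that is also an `𝓞 K`-lattice (finitely generated
over `𝓞 K` and spanning over `K`). -/
def IsOrder (G : Subalgebra (𝓞 K) ℍ[K,a,b]) : Prop :=
  Submodule.IsLattice K (Subalgebra.toSubmodule G)

/-- A maximal order: an inclusion-maximal one. -/
def IsMaximalOrder (H : Subalgebra (𝓞 K) ℍ[K,a,b]) : Prop := Maximal IsOrder H

/-- `G¹`, the set of elements of reduced norm `1`. -/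
def normOne (G : Subalgebra (𝓞 K) ℍ[K,a,b]) : Set ℍ[K,a,b] := {u | u ∈ G ∧ nrd u = 1}

/-- The set of elements of `G` of reduced norm `α`. -/
def normFiber (G : Subalgebra (𝓞 K) ℍ[K,a,b]) (α : 𝓞 K) : Set ℍ[K,a,b] :=
  {q | q ∈ G ∧ nrd q = (α : K)}

/-- The right order `{x | L x ⊆ L}` of a submodule `L`. -/
def rightOrder (L : Submodule (𝓞 K) ℍ[K,a,b]) : Subalgebra (𝓞 K) ℍ[K,a,b] where
  carrier := {x | ∀ y ∈ L, y * x ∈ L}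
  mul_mem' {x x'} hx hx' y hy := by
    rw [← mul_assoc]; exact hx' _ (hx y hy)
  add_mem' {x x'} hx hx' y hy := by
    rw [mul_add]; exact L.add_mem (hx y hy) (hx' y hy)
  algebraMap_mem' r y hy := by
    rw [← Algebra.commutes, ← Algebra.smul_def]; exact L.smul_mem r hy

/-- The lattices whose right order is `G`. -/
def RightLattice (G : Subalgebra (𝓞 K) ℍ[K,a,b]) : Type _ :=
  {L : Submodule (𝓞 K) ℍ[K,a,b] // Submodule.IsLattice K L ∧ rightOrder L = G}

/-- Right equivalence of lattices: `L = x M` for an invertible element `x` of the algebra. -/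
def rightEquiv (G : Subalgebra (𝓞 K) ℍ[K,a,b]) : Setoid (RightLattice G) where
  r L M := ∃ x : ℍ[K,a,b]ˣ, (L.1 : Set ℍ[K,a,b]) = (fun m => (x : ℍ[K,a,b]) * m) '' M.1
  iseqv :=
    { refl := fun L => ⟨1, by simp⟩
      symm := by
        rintro L M ⟨x, hx⟩
        exact ⟨x⁻¹, by rw [hx, Set.image_image]; simp⟩
      trans := by
        rintro L M N ⟨x, hx⟩ ⟨y, hy⟩
        exact ⟨x * y, by rw [hx, hy, Set.image_image]; simp [mul_assoc]⟩ }

/-- The (right) class number of `G`: the cardinality of its class set. -/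
def classNumber (G : Subalgebra (𝓞 K) ℍ[K,a,b]) : ℕ := Nat.card (Quotient (rightEquiv G))

/-- The index `[L : M]` over `𝓞 K`: the `𝓞 K`-submodule of `K` generated by the determinants of all
the `K`-linear endomorphisms that map `L` into `M`. -/
def latticeIndex (L M : Submodule (𝓞 K) ℍ[K,a,b]) : Submodule (𝓞 K) K :=
  Submodule.span (𝓞 K)
    {d | ∃ δ : ℍ[K,a,b] →ₗ[K] ℍ[K,a,b], (∀ x ∈ L, δ x ∈ M) ∧ d = LinearMap.det δ}

/-- `[H : G]` equals the integral ideal `I`, seen inside `K`. -/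
def HasIndex (H G : Subalgebra (𝓞 K) ℍ[K,a,b]) (I : Ideal (𝓞 K)) : Prop :=
  latticeIndex (Subalgebra.toSubmodule H) (Subalgebra.toSubmodule G) =
    IsLocalization.coeSubmodule K I

/-- The reduced discriminant of an order: the ideal generated by all the (integral) values
`trd ((x₁ x₂ - x₂ x₁) x̄₃)` with `x₁, x₂, x₃` in the order. -/
def discrd (H : Subalgebra (𝓞 K) ℍ[K,a,b]) : Ideal (𝓞 K) :=
  Ideal.span {d | ∃ x₁ ∈ H, ∃ x₂ ∈ H, ∃ x₃ ∈ H,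
    (d : K) = trd ((x₁ * x₂ - x₂ * x₁) * star x₃)}

/-- `G` is perceptive in `H`: every orbit `H¹ q` with `q ∈ H` meets `G`. -/
def IsPerceptive (G H : Subalgebra (𝓞 K) ℍ[K,a,b]) : Prop :=
  ∀ q ∈ H, ∃ u ∈ normOne H, u * q ∈ G

/-- The poset of the orders between `G` and `H` is linear. -/
def HasLinearPosetOfOrders (G H : Subalgebra (𝓞 K) ℍ[K,a,b]) : Prop :=
  IsChain (· ≤ ·) {M : Subalgebra (𝓞 K) ℍ[K,a,b] | IsOrder M ∧ G ≤ M ∧ M ≤ H}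

/-- The principal ideals that divide `α` and are divisible by no prime ideal that divides `D`. -/
def coprimeDivisors (D : Ideal (𝓞 K)) (α : 𝓞 K) : Set (Ideal (𝓞 K)) :=
  {I | (∃ δ : 𝓞 K, I = Ideal.span {δ}) ∧ I ∣ Ideal.span {α} ∧
    ∀ P : Ideal (𝓞 K), P.IsPrime → P ∣ D → ¬ P ∣ I}

/-- The sum below is a finite one for nonzero `α`. -/
theorem finite_coprimeDivisors (D : Ideal (𝓞 K)) {α : 𝓞 K} (hα : α ≠ 0) :
    (coprimeDivisors D α).Finite := by
  have h : Ideal.span {α} ≠ (0 : Ideal (𝓞 K)) := by simpa using hα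
  have hfin : Finite {I // I ∣ Ideal.span {α}} :=
    @Finite.of_fintype _ (UniqueFactorizationMonoid.fintypeSubtypeDvd (Ideal.span {α}) h)
  have hs : {I : Ideal (𝓞 K) | I ∣ Ideal.span {α}}.Finite := hfin
  exact hs.subset fun I hI => hI.2.1

/-- `σ_D(α)`: the sum of the absolute norms of the divisors of `α` that are coprime to `D`. -/
def sigmaCoprime (D : Ideal (𝓞 K)) (α : 𝓞 K) : ℕ :=
  ∑ᶠ I ∈ coprimeDivisors D α, Ideal.absNorm I

end QuatOrders

end

noncomputable section

set_option linter.unusedSectionVars false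

/-! ### Rings with a standard involution, over a commutative base -/

namespace QuatOrders

/-! Write `R` for the maximal order, `S` for the suborder of index `𝔭²`, `N = N(𝔭)`, `J` for the
radical of the norm form of `R` modulo `𝔭 = (ϖ)`, and `r_R`, `r_S` for the representation numbers.
The count splits into the representation numbers of `R` and the share of `S` in them.

For `R`: class number one of `S` makes the left ideals of `R` above each prime other than `𝔭`
principal (`principalAt_of_classNumber`). Taking norms of generators gives every nonzero ideal of
the base a totally positive generator (`hasPosGenerator_of_classNumber`), and then totally positive
units are squares (`exists_sq_of_totallyPositive`), so generators can be rescaled to have prescribed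
totally positive norm. At a prime `π ∤ 𝔇` the ring `R/πR` is a ring of 2 by 2 matrices with `N(π) +
1` proper nonzero left ideals; counting incidences yields `r_R(πβ) + N(π) r_R(β/π) = (N(π) + 1)
r_R(β)`, where `r_R(β/π)` is zero if `π ∤ β`. At `π ∣ 𝔇` a single left ideal contains all elements
of norm divisible by `π`, and `r_R(πβ) = r_R(β)`. The divisor sum obeys the same recursions, so
`r_R(α) = #R¹ σ(α)` (`card_fiber_eq`).

For `S`: count the pairs `(x, u)` with `nm x = α`, `nm u = 1` and `u x ∈ S` in two ways.
Perceptivity permits moving `x` into `S` without changing the number of such `u`; for `x ∈ S` these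
`u` are the norm-one elements of `S`, of `S + J` or of `R`, according as `α` has valuation 0, 1 or
at least 2 at `ϖ`. The orders of these groups are in the ratio `1 : N : N² + N`, by a second orbit
count on residue classes modulo `ϖ` (`card_units_mul`). This is `card_fiber`.

The local structure at `𝔭` is found without completion: perceptivity and the index force `R/J` to be
a field with `N²` elements and `ϖR ⊆ S` (`mem_radical_of_nm`, `index_facts`, `ext_le`). Since `𝔭`
divides the index, the general principality argument fails at `𝔭`; there `J` is shown to be
principal by means of the lattice `πS + ϖJ`, for `π ∈ J` with norm of valuation 1, because its right
order is exactly `S` (`exists_radical_eq_span`). -/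

/-- A ring with a standard involution, whose norm and trace take values in the base ring `O`. -/
structure QuadraticData (O R : Type*) [CommRing O] [Ring R] [Algebra O R] where
  conj : R → R
  tr : R → O
  nm : R → O
  conj_add : ∀ x y, conj (x + y) = conj x + conj y
  conj_mul : ∀ x y, conj (x * y) = conj y * conj x
  conj_conj : ∀ x, conj (conj x) = x
  conj_algebraMap : ∀ r, conj (algebraMap O R r) = algebraMap O R r
  add_conj : ∀ x, x + conj x = algebraMap O R (tr x)
  mul_conj : ∀ x, x * conj x = algebraMap O R (nm x)
  tr_mul_comm : ∀ x y, tr (x * y) = tr (y * x)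
  injective : Function.Injective (algebraMap O R)
  cancel : ∀ (r : O) (x : R), r ≠ 0 → algebraMap O R r * x = 0 → x = 0
  saturated : ∀ (r s : O) (x : R), r ≠ 0 → algebraMap O R r * x = algebraMap O R s →
    ∃ c, x = algebraMap O R c

namespace QuadraticData

section Basic

variable {O R : Type*} [CommRing O] [Ring R] [Algebra O R] (Q : QuadraticData O R)

theorem conj_eq (x : R) : Q.conj x = algebraMap O R (Q.tr x) - x :=
  eq_sub_of_add_eq' (Q.add_conj x)

theorem conj_mul_self (x : R) : Q.conj x * x = algebraMap O R (Q.nm x) := by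
  rw [← Q.mul_conj, Q.conj_eq, sub_mul, mul_sub, Algebra.commutes]

theorem mul_self (x : R) :
    x * x = algebraMap O R (Q.tr x) * x - algebraMap O R (Q.nm x) := by
  rw [← Q.conj_mul_self, Q.conj_eq]; noncomm_ring

theorem conj_zero : Q.conj 0 = 0 := by
  simpa using Q.conj_algebraMap 0

theorem conj_neg (x : R) : Q.conj (-x) = -Q.conj x := by
  rw [eq_neg_iff_add_eq_zero, ← Q.conj_add, neg_add_cancel, Q.conj_zero]

theorem conj_sub (x y : R) : Q.conj (x - y) = Q.conj x - Q.conj y := by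
  rw [sub_eq_add_neg, Q.conj_add, Q.conj_neg, sub_eq_add_neg]

theorem tr_add (x y : R) : Q.tr (x + y) = Q.tr x + Q.tr y := Q.injective <| by
  rw [map_add, ← Q.add_conj, ← Q.add_conj, ← Q.add_conj, Q.conj_add]; abel

theorem tr_smul (r : O) (x : R) : Q.tr (algebraMap O R r * x) = r * Q.tr x := Q.injective <| by
  rw [map_mul, ← Q.add_conj, ← Q.add_conj, Q.conj_mul, Q.conj_algebraMap, mul_add,
    Algebra.commutes r (Q.conj x)]

theorem tr_zero : Q.tr 0 = 0 := by simpa using Q.tr_smul 0 0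

theorem tr_algebraMap (r : O) : Q.tr (algebraMap O R r) = 2 * r := Q.injective <| by
  rw [← Q.add_conj, Q.conj_algebraMap, map_mul, map_ofNat, two_mul]

theorem tr_neg (x : R) : Q.tr (-x) = -Q.tr x := by
  rw [eq_neg_iff_add_eq_zero, ← Q.tr_add, neg_add_cancel, Q.tr_zero]

theorem tr_sub (x y : R) : Q.tr (x - y) = Q.tr x - Q.tr y := by
  rw [sub_eq_add_neg, Q.tr_add, Q.tr_neg, sub_eq_add_neg]

theorem tr_conj (x : R) : Q.tr (Q.conj x) = Q.tr x := Q.injective <| by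
  rw [← Q.add_conj, ← Q.add_conj, Q.conj_conj, add_comm]

theorem nm_conj (x : R) : Q.nm (Q.conj x) = Q.nm x := Q.injective <| by
  rw [← Q.mul_conj, ← Q.conj_mul_self, Q.conj_conj]

theorem nm_algebraMap (r : O) : Q.nm (algebraMap O R r) = r ^ 2 := Q.injective <| by
  rw [← Q.mul_conj, Q.conj_algebraMap, map_pow, sq]

theorem nm_zero : Q.nm 0 = 0 := by simpa using Q.nm_algebraMap 0

theorem nm_one : Q.nm 1 = 1 := by simpa using Q.nm_algebraMap 1

theorem nm_mul (x y : R) : Q.nm (x * y) = Q.nm x * Q.nm y := Q.injective <| by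
  rw [← Q.mul_conj, Q.conj_mul, mul_assoc, ← mul_assoc y, Q.mul_conj y, Algebra.commutes,
    ← mul_assoc, Q.mul_conj, map_mul]

theorem nm_smul (r : O) (x : R) : Q.nm (algebraMap O R r * x) = r ^ 2 * Q.nm x := by
  rw [Q.nm_mul, Q.nm_algebraMap]

theorem nm_neg (x : R) : Q.nm (-x) = Q.nm x := by
  simpa using Q.nm_smul (-1) x

theorem nm_add (x y : R) : Q.nm (x + y) = Q.nm x + Q.nm y + Q.tr (x * Q.conj y) :=
  Q.injective <| by
    rw [map_add, map_add, ← Q.mul_conj, ← Q.mul_conj, ← Q.mul_conj, ← Q.add_conj, Q.conj_mul,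
      Q.conj_conj, Q.conj_add]
    noncomm_ring

theorem nm_sub (x y : R) : Q.nm (x - y) = Q.nm x + Q.nm y - Q.tr (x * Q.conj y) := by
  rw [sub_eq_add_neg, Q.nm_add, Q.nm_neg, Q.conj_neg, mul_neg, Q.tr_neg, sub_eq_add_neg]

theorem nm_add_algebraMap (x : R) (r : O) :
    Q.nm (x + algebraMap O R r) = Q.nm x + r ^ 2 + r * Q.tr x := by
  rw [Q.nm_add, Q.conj_algebraMap, ← Algebra.commutes, Q.tr_smul, Q.nm_algebraMap]

/-- Elements whose norm is not a zero divisor can be cancelled on the right. -/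
theorem mul_right_cancel_of_nm {x y z : R} (hz : Q.nm z ≠ 0) (h : x * z = y * z) : x = y := by
  have h1 : algebraMap O R (Q.nm z) * (x - y) = 0 := by
    rw [Algebra.commutes, ← Q.mul_conj, ← mul_assoc, sub_mul, h, sub_self, zero_mul]
  exact sub_eq_zero.1 (Q.cancel _ _ hz h1)

theorem mul_left_cancel_of_nm {x y z : R} (hz : Q.nm z ≠ 0) (h : z * x = z * y) : x = y := by
  have h1 : algebraMap O R (Q.nm z) * (x - y) = 0 := by
    rw [← Q.conj_mul_self, mul_assoc, mul_sub, h, sub_self, mul_zero]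
  exact sub_eq_zero.1 (Q.cancel _ _ hz h1)

/-- The reduced discriminant is contained in `q`. -/
def DiscLE (q : Ideal O) : Prop := ∀ x y w, Q.tr ((x * y - y * x) * w) ∈ q

end Basic

section Extension

variable {O : Type*} (R : Type*) [CommRing O] [Ring R] [Algebra O R]

/-- The ideal of `R` generated by an ideal of the central ring `O`. -/
def ext (q : Ideal O) : Ideal R := q.map (algebraMap O R)

theorem algebraMap_mem_ext {q : Ideal O} {r : O} (h : r ∈ q) : algebraMap O R r ∈ ext R q :=
  Ideal.mem_map_of_mem _ h

variable {R} in
theorem algebraMap_mul_mem_ext {q : Ideal O} {r : O} (h : r ∈ q) (x : R) :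
    algebraMap O R r * x ∈ ext R q := by
  rw [Algebra.commutes]
  exact Ideal.mul_mem_left _ _ (algebraMap_mem_ext R h)

variable {R} in
theorem ext_le_iff {q : Ideal O} {I : Ideal R} :
    ext R q ≤ I ↔ ∀ r ∈ q, algebraMap O R r ∈ I := by
  rw [ext, Ideal.map_le_iff_le_comap]; rfl

variable {R} in
-- The generators are central, so each element is a sum of products `r * x` with `r ∈ q`. The inner
-- induction carries all left multiples along, since `P` itself need not be stable under
-- multiplication.
theorem ext_induction {q : Ideal O} {P : R → Prop} (h0 : P 0)
    (hadd : ∀ x y, x ∈ ext R q → y ∈ ext R q → P x → P y → P (x + y))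
    (hmul : ∀ r ∈ q, ∀ x, P (algebraMap O R r * x)) {x : R} (hx : x ∈ ext R q) : P x := by
  refine (Submodule.span_induction (p := fun x _ => x ∈ ext R q ∧ ∀ z, P (z * x)) ?_ ?_ ?_ ?_
    hx).2 1 |> (by simpa using ·)
  · rintro _ ⟨r, hr, rfl⟩
    refine ⟨algebraMap_mem_ext R hr, fun z => ?_⟩
    rw [← Algebra.commutes]; exact hmul r hr z
  · exact ⟨zero_mem _, fun z => by simpa using h0⟩
  · rintro x y - - ⟨hx, hx'⟩ ⟨hy, hy'⟩
    refine ⟨add_mem hx hy, fun z => ?_⟩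
    rw [mul_add]
    exact hadd _ _ (Ideal.mul_mem_left _ _ hx) (Ideal.mul_mem_left _ _ hy) (hx' z) (hy' z)
  · rintro a x - ⟨hx, hx'⟩
    refine ⟨Ideal.mul_mem_left _ _ hx, fun z => ?_⟩
    rw [smul_eq_mul, ← mul_assoc]; exact hx' _

instance ext_isTwoSided (q : Ideal O) : (ext R q).IsTwoSided where
  mul_mem_of_left {a} b ha := by
    refine ext_induction (P := fun a => a * b ∈ ext R q) (by simp) ?_ ?_ ha
    · intro x y _ _ hx hy
      rw [add_mul]; exact add_mem hx hy
    · intro r hr x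
      rw [mul_assoc]; exact algebraMap_mul_mem_ext hr _

variable {R} (Q : QuadraticData O R)

theorem tr_mem_of_mem_ext {q : Ideal O} {x : R} (hx : x ∈ ext R q) : Q.tr x ∈ q := by
  refine ext_induction (P := fun x => Q.tr x ∈ q) (by simp [Q.tr_zero]) ?_ ?_ hx
  · intro x y _ _ hx hy
    rw [Q.tr_add]; exact add_mem hx hy
  · intro r hr x
    rw [Q.tr_smul]; exact q.mul_mem_right _ hr

theorem conj_mem_ext {q : Ideal O} {x : R} (hx : x ∈ ext R q) : Q.conj x ∈ ext R q := by
  rw [Q.conj_eq]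
  exact sub_mem (algebraMap_mem_ext R (Q.tr_mem_of_mem_ext hx)) hx

theorem tr_mul_conj_mem_sq {q : Ideal O} {x y : R} (hx : x ∈ ext R q) (hy : y ∈ ext R q) :
    Q.tr (x * Q.conj y) ∈ q ^ 2 := by
  refine ext_induction (P := fun x => Q.tr (x * Q.conj y) ∈ q ^ 2) (by simp [Q.tr_zero]) ?_ ?_ hx
  · intro x y _ _ hx hy
    rw [add_mul, Q.tr_add]; exact add_mem hx hy
  · intro r hr x
    rw [mul_assoc, Q.tr_smul, sq]
    exact Ideal.mul_mem_mul hr (Q.tr_mem_of_mem_ext (Ideal.mul_mem_left _ _ (Q.conj_mem_ext hy)))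

theorem nm_mem_sq_of_mem_ext {q : Ideal O} {x : R} (hx : x ∈ ext R q) : Q.nm x ∈ q ^ 2 := by
  refine ext_induction (P := fun x => Q.nm x ∈ q ^ 2) (by simp [Q.nm_zero]) ?_ ?_ hx
  · intro x y hx' hy' hx hy
    rw [Q.nm_add]; exact add_mem (add_mem hx hy) (Q.tr_mul_conj_mem_sq hx' hy')
  · intro r hr x
    rw [Q.nm_smul]; exact Ideal.mul_mem_right _ _ (Ideal.pow_mem_pow hr 2)

include Q in
-- Taking norms of the scalar `r` gives `r ^ 2 ∈ q ^ 2`.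
theorem algebraMap_mem_ext_iff {q : Ideal O} [hq : q.IsPrime] {r : O} :
    algebraMap O R r ∈ ext R q ↔ r ∈ q := by
  refine ⟨fun h => ?_, algebraMap_mem_ext R⟩
  have := Q.nm_mem_sq_of_mem_ext h
  rw [Q.nm_algebraMap] at this
  exact hq.mem_of_pow_mem 2 (Ideal.pow_le_self two_ne_zero this)

end Extension

/-! ### The radical of the norm form modulo a prime -/

section Radical

variable {O R : Type*} [CommRing O] [Ring R] [Algebra O R] (Q : QuadraticData O R) (q : Ideal O)

/-- The radical of the norm form modulo `q`. -/
def radical : Ideal R where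
  carrier := {x | Q.nm x ∈ q ∧ ∀ y, Q.tr (x * y) ∈ q}
  zero_mem' := by simp [Q.nm_zero, Q.tr_zero]
  add_mem' := by
    rintro x y ⟨hx, hx'⟩ ⟨hy, hy'⟩
    refine ⟨?_, fun z => ?_⟩
    · rw [Q.nm_add]; exact add_mem (add_mem hx hy) (hx' _)
    · rw [add_mul, Q.tr_add]; exact add_mem (hx' z) (hy' z)
  smul_mem' := by
    rintro z x ⟨hx, hx'⟩
    refine ⟨?_, fun y => ?_⟩
    · rw [smul_eq_mul, Q.nm_mul]; exact q.mul_mem_left _ hx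
    · rw [smul_eq_mul, mul_assoc, Q.tr_mul_comm, mul_assoc]; exact hx' _

instance radical_isTwoSided : (Q.radical q).IsTwoSided where
  mul_mem_of_left {a} b ha := by
    refine ⟨?_, fun y => ?_⟩
    · rw [Q.nm_mul]; exact q.mul_mem_right _ ha.1
    · rw [mul_assoc]; exact ha.2 _

variable {q}

theorem tr_mem_of_mem_radical {x : R} (hx : x ∈ Q.radical q) : Q.tr x ∈ q := by
  simpa using hx.2 1

theorem conj_mem_radical {x : R} (hx : x ∈ Q.radical q) : Q.conj x ∈ Q.radical q := by
  refine ⟨by rw [Q.nm_conj]; exact hx.1, fun y => ?_⟩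
  rw [← Q.tr_conj, Q.conj_mul, Q.conj_conj, Q.tr_mul_comm]
  exact hx.2 _

theorem ext_le_radical : ext R q ≤ Q.radical q := fun x hx =>
  ⟨Ideal.pow_le_self two_ne_zero (Q.nm_mem_sq_of_mem_ext hx),
    fun y => Q.tr_mem_of_mem_ext (Ideal.mul_mem_right _ _ hx)⟩

theorem algebraMap_mem_radical {r : O} (hr : r ∈ q) : algebraMap O R r ∈ Q.radical q :=
  Q.ext_le_radical (algebraMap_mem_ext R hr)

theorem mul_self_mem_of_mem_radical {x : R} (hx : x ∈ Q.radical q) : x * x ∈ ext R q := by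
  rw [Q.mul_self]
  exact sub_mem (algebraMap_mul_mem_ext (Q.tr_mem_of_mem_radical hx) _)
    (algebraMap_mem_ext R hx.1)

variable {Q} (hD : Q.DiscLE q)
include hD

/-- The trace condition is the hypothesis itself. The norm condition reduces to it by the identity
`nm (xy - yx) = tr ((xy - yx) x ȳ)`. -/
theorem DiscLE.commutator_mem (x y : R) : x * y - y * x ∈ Q.radical q := by
  refine ⟨?_, hD x y⟩
  rw [Q.nm_sub, Q.nm_mul, Q.nm_mul, Q.conj_mul]
  -- Substitute `x̄ = tr x - x`. The last bracket has trace zero, because the trace is cyclic and `ȳ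
  -- y` is a scalar.
  have e1 : x * y * (Q.conj x * Q.conj y) =
      algebraMap O R (Q.tr x * Q.nm y) * x - algebraMap O R (Q.nm y) * (x * x)
      - (x * y - y * x) * (x * Q.conj y)
      + (algebraMap O R (Q.nm y) * (x * x) - y * (x * x) * Q.conj y) := by
    rw [map_mul, mul_assoc (algebraMap O R (Q.tr x)), ← Q.mul_conj y]
    rw [Q.conj_eq x]
    have : x * y * ((algebraMap O R (Q.tr x) - x) * Q.conj y) =
      x * (algebraMap O R (Q.tr x) * y) * Q.conj y - x * y * x * Q.conj y := by
      rw [Algebra.commutes]; noncomm_ring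
    rw [this, ← mul_assoc x (algebraMap O R (Q.tr x)), ← Algebra.commutes (Q.tr x) x]
    have h2 : algebraMap O R (Q.tr x) * (y * Q.conj y * x) =
        algebraMap O R (Q.tr x) * x * y * Q.conj y := by
      rw [Q.mul_conj, Algebra.commutes (Q.nm y) x, ← Q.mul_conj]; noncomm_ring
    rw [h2]
    noncomm_ring
  have e2 : Q.tr (algebraMap O R (Q.nm y) * (x * x) - y * (x * x) * Q.conj y) = 0 := by
    rw [Q.tr_sub, Q.tr_smul, mul_assoc, Q.tr_mul_comm y, mul_assoc, Q.conj_mul_self,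
      ← Algebra.commutes, Q.tr_smul, sub_self]
  have e3 : Q.tr (x * x) = Q.tr x * Q.tr x - 2 * Q.nm x := by
    rw [Q.mul_self, Q.tr_sub, Q.tr_smul, Q.tr_algebraMap]
  rw [e1, Q.tr_add, e2, Q.tr_sub, Q.tr_sub, Q.tr_smul, Q.tr_smul, e3]
  have := hD x y (x * Q.conj y)
  convert this using 1
  ring

/-- The commutative quotient by the radical is reduced: `z² ≡ 0` puts `nm z` into `q`, whence `tr z
* z ≡ 0`, and the trace of this is `(tr z)²`. Modulo commutators `(z y)² ≡ z² y²`, so the same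
applies to every `z * y`. -/
theorem DiscLE.mem_of_mul_self_mem [hq : q.IsPrime] {z : R} (hz : z * z ∈ Q.radical q) :
    z ∈ Q.radical q := by
  have key : ∀ z : R, z * z ∈ Q.radical q → Q.nm z ∈ q ∧ Q.tr z ∈ q := by
    intro z hz
    have hn : Q.nm z ∈ q := by
      have := hz.1
      rw [Q.nm_mul] at this
      exact (hq.mem_or_mem this).elim id id
    have ht : algebraMap O R (Q.tr z) * z ∈ Q.radical q := by
      have := add_mem hz (Q.algebraMap_mem_radical hn)
      rwa [Q.mul_self, sub_add_cancel] at this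
    have := Q.tr_mem_of_mem_radical ht
    rw [Q.tr_smul] at this
    exact ⟨hn, (hq.mem_or_mem this).elim id id⟩
  refine ⟨(key z hz).1, fun y => (key (z * y) ?_).2⟩
  have h1 := Ideal.mul_mem_right (y * y) _ hz
  have h2 := Ideal.mul_mem_left _ z (Ideal.mul_mem_right y _ (hD.commutator_mem y z))
  convert add_mem h1 h2 using 1
  noncomm_ring

end Radical

end QuadraticData
end QuatOrders

/-! ### The quotient by the radical has at most `N(q)²` elements -/

namespace QuatOrders
namespace QuadraticData

section Commutative

variable {O R : Type*} [CommRing O] [Ring R] [Algebra O R] {Q : QuadraticData O R} {q : Ideal O}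

theorem exists_surjection_of_span {J : Ideal R} (hJ : ext R q ≤ J) (g h : R)
    (H : ∀ z, ∃ a b : O, z - (algebraMap O R a * g + algebraMap O R b * h) ∈ J) :
    ∃ f : (O ⧸ q) × (O ⧸ q) → R ⧸ J, Function.Surjective f := by
  have out (a : O) : ∃ c ∈ q, (Ideal.Quotient.mk q a).out = a + c := by
    refine ⟨(Ideal.Quotient.mk q a).out - a, ?_, by ring⟩
    rw [← Ideal.Quotient.eq]
    exact Quotient.out_eq' _
  refine ⟨fun p => Submodule.Quotient.mk
    (algebraMap O R p.1.out * g + algebraMap O R p.2.out * h), fun z => ?_⟩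
  obtain ⟨z, rfl⟩ := Submodule.Quotient.mk_surjective _ z
  obtain ⟨a, b, hab⟩ := H z
  obtain ⟨c, hc, hc'⟩ := out a
  obtain ⟨d, hd, hd'⟩ := out b
  refine ⟨(Ideal.Quotient.mk q a, Ideal.Quotient.mk q b), ?_⟩
  rw [Submodule.Quotient.eq]
  simp only [hc', hd', map_add]
  have h1 := hJ (algebraMap_mul_mem_ext hc g)
  have h2 := hJ (algebraMap_mul_mem_ext hd h)
  convert sub_mem (add_mem h1 h2) hab using 1
  noncomm_ring

theorem card_quotient_le_sq [Finite (O ⧸ q)] {J : Ideal R} (hJ : ext R q ≤ J) (g h : R)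
    (H : ∀ z, ∃ a b : O, z - (algebraMap O R a * g + algebraMap O R b * h) ∈ J) :
    Nat.card (R ⧸ J) ≤ Nat.card (O ⧸ q) ^ 2 := by
  obtain ⟨f, hf⟩ := exists_surjection_of_span hJ g h H
  refine (Nat.card_le_card_of_surjective f hf).trans ?_
  rw [Nat.card_prod, sq]

variable (Q q) in
/-- A lift of a primitive idempotent of the quotient by the radical. -/
structure IsIdem (e : R) : Prop where
  mul_self : e * e - e ∈ Q.radical q
  nm_mem : Q.nm e ∈ q
  tr_sub_one : Q.tr e - 1 ∈ q

theorem IsIdem.one_sub {e : R} (he : Q.IsIdem q e) : Q.IsIdem q (1 - e) where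
  mul_self := by
    convert he.mul_self using 1
    noncomm_ring
  nm_mem := by
    have h := Q.nm_add_algebraMap (-e) 1
    rw [map_one, neg_add_eq_sub, Q.nm_neg, Q.tr_neg] at h
    rw [h]
    convert sub_mem he.nm_mem he.tr_sub_one using 1
    ring
  tr_sub_one := by
    have h := Q.tr_algebraMap 1
    rw [map_one] at h
    rw [Q.tr_sub, h]
    convert neg_mem he.tr_sub_one using 1
    ring

/-- All elements of `e R` have norm in `q`, so each satisfies `w² ≡ tr(w) w`. Polarizing between `e
z` and `e` shows that `e R` is spanned by `e` modulo the radical. -/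
theorem IsIdem.mul_sub_mem (hD : Q.DiscLE q) {e : R} (he : Q.IsIdem q e) (z : R) :
    e * z - algebraMap O R (Q.tr (e * z)) * e ∈ Q.radical q := by
  have h1 : e * (e * z) - e * z ∈ Q.radical q := by
    rw [← mul_assoc, ← sub_mul]; exact Ideal.mul_mem_right _ _ he.mul_self
  have h2 : e * z * e - e * (e * z) ∈ Q.radical q := hD.commutator_mem _ _
  have h3 : Q.nm (e * z) ∈ q := by rw [Q.nm_mul]; exact q.mul_mem_right _ he.nm_mem
  have h4 : Q.nm (e * z + e) ∈ q := by
    rw [show e * z + e = e * (z + 1) by noncomm_ring, Q.nm_mul]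
    exact q.mul_mem_right _ he.nm_mem
  have h5 : (e * z + e) * (e * z + e) - algebraMap O R (Q.tr (e * z + e)) * (e * z + e) ∈
      Q.radical q := by
    rw [Q.mul_self (e * z + e), sub_sub_cancel_left]
    exact neg_mem (Q.algebraMap_mem_radical h4)
  have h6 : e * z * (e * z) - algebraMap O R (Q.tr (e * z)) * (e * z) ∈ Q.radical q := by
    rw [Q.mul_self (e * z), sub_sub_cancel_left]
    exact neg_mem (Q.algebraMap_mem_radical h3)
  have h7 : algebraMap O R (Q.tr e - 1) * (e * z + e) ∈ Q.radical q :=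
    Ideal.mul_mem_right _ _ (Q.algebraMap_mem_radical he.tr_sub_one)
  rw [map_sub, map_one] at h7
  rw [Q.tr_add, map_add] at h5
  have h8 := sub_mem h5 h6
  have h9 := sub_mem (sub_mem (sub_mem (add_mem h8 h7) h2) (add_mem h1 h1)) he.mul_self
  convert h9 using 1
  noncomm_ring

theorem IsIdem.span (hD : Q.DiscLE q) {e : R} (he : Q.IsIdem q e) (z : R) :
    ∃ a b : O, z - (algebraMap O R a * e + algebraMap O R b * (1 - e)) ∈ Q.radical q := by
  refine ⟨Q.tr (e * z), Q.tr ((1 - e) * z), ?_⟩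
  have := add_mem (he.mul_sub_mem hD z) (he.one_sub.mul_sub_mem hD z)
  convert this using 1
  noncomm_ring

/-- If the trace of `x` were in `q`, then `x² ≡ 0`, against reducedness. Hence the trace is
invertible modulo `q`, and dividing `x` by it gives the idempotent. -/
theorem DiscLE.exists_isIdem [hq : q.IsMaximal] (hD : Q.DiscLE q) {x : R}
    (hx : x ∉ Q.radical q) (hn : Q.nm x ∈ q) : ∃ s, Q.IsIdem q (algebraMap O R s * x) := by
  have ht : Q.tr x ∉ q := fun ht => hx <| hD.mem_of_mul_self_mem <| by
    rw [Q.mul_self]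
    exact sub_mem (Ideal.mul_mem_right _ _ (Q.algebraMap_mem_radical ht))
      (Q.algebraMap_mem_radical hn)
  obtain ⟨s, i, hi, hs⟩ := hq.exists_inv ht
  have hs' : s * Q.tr x - 1 ∈ q := by
    rw [← hs]; convert neg_mem hi using 1; ring
  refine ⟨s, ?_, ?_, ?_⟩
  · have h1 : algebraMap O R (s * Q.tr x - 1) * (algebraMap O R s * x) ∈ Q.radical q :=
      Ideal.mul_mem_right _ _ (Q.algebraMap_mem_radical hs')
    have h2 : algebraMap O R (Q.nm (algebraMap O R s * x)) ∈ Q.radical q := by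
      apply Q.algebraMap_mem_radical
      rw [Q.nm_smul]; exact q.mul_mem_left _ hn
    convert sub_mem h1 h2 using 1
    rw [Q.mul_self, Q.tr_smul, map_sub, map_one]
    noncomm_ring
  · rw [Q.nm_smul]; exact q.mul_mem_left _ hn
  · rwa [Q.tr_smul]

variable (Q) in
-- With an anisotropic norm form modulo `q` the quotient is a finite domain, hence a field by
-- Wedderburn. Lift a generator `g` of its cyclic group of units: as `g` is quadratic over `O`, all
-- its powers lie in `O + O g`.
theorem exists_generator [hq : q.IsPrime] [Finite (R ⧸ Q.radical q)]
    (hdom : ∀ x, Q.nm x ∈ q → x ∈ Q.radical q) :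
    ∃ g, ∀ z, ∃ a b : O,
      z - (algebraMap O R a * 1 + algebraMap O R b * g) ∈ Q.radical q := by
  set J := Q.radical q
  have h1 : (1 : R) ∉ J := fun h => hq.ne_top <| (Ideal.eq_top_iff_one _).2 <| by
    simpa [Q.nm_one] using h.1
  have : Nontrivial (R ⧸ J) := Submodule.Quotient.nontrivial_iff.2 fun h => h1 (h ▸ trivial)
  have : NoZeroDivisors (R ⧸ J) := ⟨fun {a b} hab => by
    obtain ⟨a, rfl⟩ := Ideal.Quotient.mk_surjective a
    obtain ⟨b, rfl⟩ := Ideal.Quotient.mk_surjective b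
    rw [← map_mul, Ideal.Quotient.eq_zero_iff_mem] at hab
    rw [Ideal.Quotient.eq_zero_iff_mem, Ideal.Quotient.eq_zero_iff_mem]
    have := hab.1
    rw [Q.nm_mul] at this
    exact (hq.mem_or_mem this).imp (hdom _) (hdom _)⟩
  have : IsDomain (R ⧸ J) := NoZeroDivisors.to_isDomain _
  let _ : Field (R ⧸ J) := (Finite.isDomain_to_isField (R ⧸ J)).toField
  obtain ⟨u, hu⟩ := IsCyclic.exists_monoid_generator (α := (R ⧸ J)ˣ)
  obtain ⟨g, hg⟩ := Ideal.Quotient.mk_surjective (I := J) (u : R ⧸ J)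
  refine ⟨g, fun z => ?_⟩
  by_cases hz : z ∈ J
  · exact ⟨0, 0, by simpa using hz⟩
  have hpow : ∀ k : ℕ, ∃ a b : O, g ^ k = algebraMap O R a * 1 + algebraMap O R b * g := by
    intro k
    induction k with
    | zero => exact ⟨1, 0, by simp⟩
    | succ k ih =>
      obtain ⟨a, b, h⟩ := ih
      refine ⟨-(b * Q.nm g), a + b * Q.tr g, ?_⟩
      rw [pow_succ, h, add_mul, mul_assoc _ g g, Q.mul_self]
      simp only [map_neg, map_add, map_mul]
      noncomm_ring
  have hz' : Ideal.Quotient.mk J z ≠ 0 := fun h => hz (Ideal.Quotient.eq_zero_iff_mem.1 h)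
  obtain ⟨k, hk⟩ := hu (Units.mk0 _ hz')
  obtain ⟨a, b, h⟩ := hpow k
  refine ⟨a, b, ?_⟩
  rw [← h, ← Ideal.Quotient.eq, map_pow, hg]
  have := congrArg Units.val hk
  simpa using this.symm

/-- In the anisotropic case the quotient is spanned by `1, g`, otherwise by complementary
idempotents `e, 1 - e`. -/
theorem DiscLE.card_le [hq : q.IsMaximal] [Finite (O ⧸ q)] [Finite (R ⧸ Q.radical q)]
    (hD : Q.DiscLE q) : Nat.card (R ⧸ Q.radical q) ≤ Nat.card (O ⧸ q) ^ 2 := by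
  by_cases hdom : ∀ x, Q.nm x ∈ q → x ∈ Q.radical q
  · obtain ⟨g, hg⟩ := Q.exists_generator hdom
    exact card_quotient_le_sq Q.ext_le_radical _ _ hg
  · push Not at hdom
    obtain ⟨x, hn, hx⟩ := hdom
    obtain ⟨s, hs⟩ := hD.exists_isIdem hx hn
    exact card_quotient_le_sq Q.ext_le_radical _ _ (hs.span hD)

end Commutative
end QuadraticData
end QuatOrders

/-! ### Left ideals above a prime in a definite order -/

namespace QuatOrders

/-- Quadratic data with anisotropic norm form and the index formula for principal left ideals. -/
structure DefiniteData (O R : Type*) [CommRing O] [IsDedekindDomain O] [Module.Free ℤ O]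
    [Ring R] [Algebra O R] extends QuadraticData O R where
  eq_zero_of_nm : ∀ x, nm x = 0 → x = 0
  card_quot : ∀ y, nm y ≠ 0 →
    Nat.card (R ⧸ Ideal.span {y}) = Ideal.absNorm (Ideal.span {nm y}) ^ 2

/-- Every left ideal that contains `q` is principal. -/
def PrincipalAt {O : Type*} (R : Type*) [CommRing O] [Ring R] [Algebra O R] (q : Ideal O) : Prop :=
  ∀ I : Ideal R, QuadraticData.ext R q ≤ I → ∃ y, I = Ideal.span {y}

theorem eq_of_le_of_card_eq {R : Type*} [Ring R] {I J : Ideal R} (h : I ≤ J)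
    (hc : Nat.card (R ⧸ J) = Nat.card (R ⧸ I)) (h0 : Nat.card (R ⧸ I) ≠ 0) : I = J := by
  have h1 := Submodule.card_quotient_mul_card_quotient J I h
  rw [hc] at h1
  have h2 : Nat.card (Submodule.map I.mkQ J) = 1 := by
    exact Nat.eq_of_mul_eq_mul_right (Nat.pos_of_ne_zero h0) (by rw [h1, one_mul])
  have h3 : Submodule.map I.mkQ J = ⊥ := (Submodule.eq_bot_iff _).2 fun x hx => by
    have := (Nat.card_eq_one_iff_unique.1 h2).1
    exact congrArg Subtype.val (Subsingleton.elim (⟨x, hx⟩ : Submodule.map I.mkQ J) 0)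
  refine le_antisymm h ?_
  intro x hx
  have : I.mkQ x = 0 := (Submodule.mem_bot R).1 (h3 ▸ Submodule.mem_map_of_mem hx)
  simpa using this

namespace DefiniteData
open QuadraticData

variable {O R : Type*} [CommRing O] [IsDedekindDomain O] [Module.Free ℤ O] [Module.Finite ℤ O]
  [Ring R] [Algebra O R] (Q : DefiniteData O R) {q : Ideal O}

theorem card_quotient (q : Ideal O) : Nat.card (O ⧸ q) = Ideal.absNorm q := rfl

/-- Write `r = z y` and `s = w y`. Scalars are fixed by conjugation, so `r s = z y ȳ w̄ = nm(y) z
w̄`, and saturation turns `z w̄` into an element of `O`. -/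
theorem mul_mem_span_nm {y : R} (h : ext R q ≤ Ideal.span {y}) (hy : Q.nm y ≠ 0) :
    q ^ 2 ≤ Ideal.span {Q.nm y} := by
  rw [sq, Ideal.mul_le]
  intro r hr s hs
  obtain ⟨z, hz⟩ := Ideal.mem_span_singleton'.1 (h (algebraMap_mem_ext R hr))
  obtain ⟨w, hw⟩ := Ideal.mem_span_singleton'.1 (h (algebraMap_mem_ext R hs))
  have h1 : algebraMap O R (Q.nm y) * (z * Q.conj w) = algebraMap O R (r * s) := by
    rw [map_mul, ← Q.conj_algebraMap s, ← hz, ← hw, Q.conj_mul, ← mul_assoc, ← mul_assoc,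
      mul_assoc z y, Q.mul_conj y, Algebra.commutes (Q.nm y) z]
  obtain ⟨c, hc⟩ := Q.saturated _ _ _ hy h1
  rw [hc, ← map_mul] at h1
  rw [← Q.injective h1]
  exact Ideal.mul_mem_right _ _ (Ideal.mem_span_singleton_self _)

theorem nm_ne_zero_of_ext_le {y : R} (hq0 : q ≠ ⊥) (h : ext R q ≤ Ideal.span {y}) :
    Q.nm y ≠ 0 := by
  intro h0
  rw [Q.eq_zero_of_nm y h0, Ideal.span_singleton_eq_bot.2 rfl, ext_le_iff] at h
  refine hq0 ((Submodule.eq_bot_iff _).2 fun r hr => Q.injective ?_)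
  rw [map_zero]; exact h r hr

theorem nm_mem_of_ext_le [hq : q.IsMaximal] {y : R} (h : ext R q ≤ Ideal.span {y})
    (ht : Ideal.span {y} ≠ ⊤) : Q.nm y ∈ q := by
  by_contra hn
  obtain ⟨s, i, hi, hs⟩ := hq.exists_inv hn
  refine ht ((Ideal.eq_top_iff_one _).2 ?_)
  rw [← map_one (algebraMap O R), ← hs, map_add, map_mul, ← Q.conj_mul_self]
  exact add_mem (Ideal.mul_mem_left _ _ (Ideal.mul_mem_left _ _ (Ideal.mem_span_singleton_self _)))
    (h (algebraMap_mem_ext R hi))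

/-- The norm of `y` divides `q²`; it is not a unit, since otherwise `ȳ y` would put 1 into the
ideal. -/
theorem span_nm_eq (hq0 : q ≠ ⊥) [hq : q.IsMaximal] {y : R} (h : ext R q ≤ Ideal.span {y})
    (ht : Ideal.span {y} ≠ ⊤) : Ideal.span {Q.nm y} = q ∨ Ideal.span {Q.nm y} = q ^ 2 := by
  have h1 : Ideal.span {Q.nm y} ∣ q ^ 2 :=
    Ideal.dvd_iff_le.2 (Q.mul_mem_span_nm h (Q.nm_ne_zero_of_ext_le hq0 h))
  obtain ⟨i, hi, ha⟩ := (dvd_prime_pow (Ideal.prime_of_isPrime hq0 hq.isPrime) 2).1 h1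
  rw [associated_iff_eq] at ha
  have h2 : i ≠ 0 := by
    rintro rfl
    rw [pow_zero, Ideal.one_eq_top] at ha
    have : Ideal.span {Q.nm y} ≤ q :=
      (Ideal.span_singleton_le_iff_mem _).2 (Q.nm_mem_of_ext_le h ht)
    exact hq.ne_top (top_le_iff.1 (ha ▸ this))
  interval_cases i
  · exact absurd rfl h2
  · left; simpa using ha
  · right; exact ha

include Q in
theorem card_quot_ext (hq0 : q ≠ ⊥) (hP : PrincipalAt R q) :
    Nat.card (R ⧸ ext R q) = Ideal.absNorm q ^ 4 := by
  obtain ⟨y, hy⟩ := hP _ le_rfl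
  have hn : Q.nm y ∈ q ^ 2 := Q.nm_mem_sq_of_mem_ext (hy ▸ Ideal.mem_span_singleton_self _)
  have hle := Q.mul_mem_span_nm hy.le (Q.nm_ne_zero_of_ext_le hq0 hy.le)
  rw [hy, Q.card_quot _ (Q.nm_ne_zero_of_ext_le hq0 hy.le),
    le_antisymm ((Ideal.span_singleton_le_iff_mem _).2 hn) hle, map_pow, ← pow_mul]

theorem absNorm_pos (hq0 : q ≠ ⊥) : 0 < Ideal.absNorm q :=
  Nat.pos_of_ne_zero fun h => hq0 (Ideal.absNorm_eq_zero_iff.1 h)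

theorem one_lt_absNorm (hq0 : q ≠ ⊥) [hq : q.IsPrime] : 1 < Ideal.absNorm q := by
  have := absNorm_pos hq0
  have h1 : Ideal.absNorm q ≠ 1 := fun h => hq.ne_top (Ideal.absNorm_eq_one_iff.1 h)
  omega

include Q in
theorem finite_quot_ext (hq0 : q ≠ ⊥) (hP : PrincipalAt R q) :
    Finite (R ⧸ ext R q) := Nat.finite_of_card_ne_zero <| by
  rw [Q.card_quot_ext hq0 hP]
  exact (pow_pos (absNorm_pos hq0) _).ne'

theorem finite_quot_of_le {I J : Ideal R} (h : I ≤ J) [Finite (R ⧸ I)] : Finite (R ⧸ J) :=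
  Finite.of_surjective (Submodule.factor h) (Submodule.factor_surjective h)

/-- The left ideals strictly between `q R` and `R`. -/
def IsMid (q : Ideal O) (I : Ideal R) : Prop := ext R q ≤ I ∧ I ≠ ⊤ ∧ I ≠ ext R q

theorem IsMid.exists_generator (hq0 : q ≠ ⊥) [hq : q.IsMaximal] (hP : PrincipalAt R q)
    {I : Ideal R} (hI : IsMid q I) : ∃ y, I = Ideal.span {y} ∧ Ideal.span {Q.nm y} = q := by
  obtain ⟨y, rfl⟩ := hP I hI.1
  -- A generator of norm `q²` would give `I` the same finite index as `q R`, forcing equality.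
  refine ⟨y, rfl, (Q.span_nm_eq hq0 hI.1 hI.2.1).resolve_right fun h => hI.2.2 ?_⟩
  refine (eq_of_le_of_card_eq hI.1 ?_ ?_).symm
  · rw [Q.card_quot_ext hq0 hP, Q.card_quot _ (Q.nm_ne_zero_of_ext_le hq0 hI.1), h, map_pow,
      ← pow_mul]
  · rw [Q.card_quot_ext hq0 hP]
    exact (pow_pos (absNorm_pos hq0) _).ne'

theorem card_quot_of_span {y : R} (hq0 : q ≠ ⊥) (hy : Ideal.span {Q.nm y} = q) :
    Nat.card (R ⧸ Ideal.span {y}) = Ideal.absNorm q ^ 2 := by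
  rw [Q.card_quot y ?_, hy]
  rintro h
  rw [h, Ideal.span_singleton_eq_bot.2 rfl] at hy
  exact hq0 hy.symm

include Q in
theorem IsMid.card_quot (hq0 : q ≠ ⊥) [hq : q.IsMaximal] (hP : PrincipalAt R q)
    {I : Ideal R} (hI : IsMid q I) : Nat.card (R ⧸ I) = Ideal.absNorm q ^ 2 := by
  obtain ⟨y, rfl, hy⟩ := hI.exists_generator Q hq0 hP
  exact Q.card_quot_of_span hq0 hy

include Q in
-- All intermediate left ideals have the same index `N(q)²`, so none contains another.
theorem IsMid.eq_of_le (hq0 : q ≠ ⊥) [hq : q.IsMaximal] (hP : PrincipalAt R q)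
    {I J : Ideal R} (hI : IsMid q I) (hJ : IsMid q J) (h : I ≤ J) : I = J := by
  refine eq_of_le_of_card_eq h ?_ ?_
  · rw [hI.card_quot Q hq0 hP, hJ.card_quot Q hq0 hP]
  · rw [hI.card_quot Q hq0 hP]; exact (pow_pos (absNorm_pos hq0) _).ne'

include Q in
theorem IsMid.eq_top_of_lt (hq0 : q ≠ ⊥) [hq : q.IsMaximal] (hP : PrincipalAt R q)
    {I J : Ideal R} (hI : IsMid q I) (h : I < J) : J = ⊤ := by
  by_contra ht
  have hJ : IsMid q J := ⟨hI.1.trans h.le, ht, fun h' => by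
    rw [h'] at h; exact absurd hI.1 (not_le_of_gt h)⟩
  exact h.ne (hI.eq_of_le Q hq0 hP hJ h.le)

theorem radical_ne_top [hq : q.IsPrime] : Q.radical q ≠ ⊤ := fun h => hq.ne_top <|
  (Ideal.eq_top_iff_one _).2 <| by
    have : (1 : R) ∈ Q.radical q := h ▸ trivial
    simpa [Q.nm_one] using this.1

/-- If `x` were outside a maximal radical, then `1 = j + z x` with `j` in the radical. Multiplying
by `x̄` on the right gives `x̄ = j x̄ + z nm(x)`, which lies in the radical. -/
theorem nm_mem_iff_mem_radical (hJ : ∀ J, Q.radical q < J → J = ⊤) (x : R) :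
    Q.nm x ∈ q ↔ x ∈ Q.radical q := by
  refine ⟨fun hx => ?_, fun h => h.1⟩
  by_contra hx'
  have h1 : Q.radical q ⊔ Ideal.span {x} = ⊤ := hJ _ <| left_lt_sup.2 fun h =>
    hx' (h (Ideal.mem_span_singleton_self _))
  obtain ⟨j, hj, w, hw, h2⟩ := Submodule.mem_sup.1 (h1.symm ▸ Submodule.mem_top : (1 : R) ∈ _)
  obtain ⟨z, rfl⟩ := Ideal.mem_span_singleton'.1 hw
  have h3 : Q.conj x = j * Q.conj x + z * (x * Q.conj x) := by
    rw [← mul_assoc, ← add_mul, h2, one_mul]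
  have h4 : Q.conj x ∈ Q.radical q := by
    rw [h3, Q.mul_conj]
    exact add_mem (Ideal.mul_mem_right _ _ hj)
      (Ideal.mul_mem_left _ _ (Q.algebraMap_mem_radical hx))
  have := Q.conj_mem_radical h4
  rw [Q.conj_conj] at this
  exact hx' this

/-- The radical has index at most `N(q)²`, less than the index `N(q)⁴` of `q R`. So it is an
intermediate ideal: principal, and maximal as a left ideal. -/
theorem exists_generator_of_discLE (hq0 : q ≠ ⊥) [hq : q.IsMaximal] (hP : PrincipalAt R q)
    (hD : Q.DiscLE q) :
    ∃ y, Ideal.span {Q.nm y} = q ∧ ∀ x, Q.nm x ∈ q ↔ x ∈ Ideal.span {y} := by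
  have := Q.finite_quot_ext hq0 hP
  have := finite_quot_of_le (Q.ext_le_radical (q := q))
  have : Finite (O ⧸ q) := Ideal.finiteQuotientOfFreeOfNeBot q hq0
  have hc := hD.card_le
  have hmid : IsMid q (Q.radical q) := by
    refine ⟨Q.ext_le_radical, Q.radical_ne_top, fun h => ?_⟩
    rw [h, Q.card_quot_ext hq0 hP, card_quotient] at hc
    have := (Nat.pow_le_pow_iff_right (one_lt_absNorm hq0)).1 hc
    omega
  obtain ⟨y, hy, hy'⟩ := hmid.exists_generator Q hq0 hP
  refine ⟨y, hy', ?_⟩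
  rw [← hy]
  exact Q.nm_mem_iff_mem_radical fun J hJ => hmid.eq_top_of_lt Q hq0 hP hJ

/-- A finite ring without proper left ideals is commutative. -/
theorem commutator_mem_of_maximal {R : Type*} [Ring R] {T : Ideal R} [T.IsTwoSided]
    [Finite (R ⧸ T)] (hT : T ≠ ⊤) (hmax : ∀ J, T < J → J = ⊤) (x y : R) :
    x * y - y * x ∈ T := by
  have : Nontrivial (R ⧸ T) := Submodule.Quotient.nontrivial_iff.2 hT
  have : NoZeroDivisors (R ⧸ T) := ⟨fun {a b} hab => by
    obtain ⟨a, rfl⟩ := Ideal.Quotient.mk_surjective a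
    obtain ⟨b, rfl⟩ := Ideal.Quotient.mk_surjective b
    rw [← map_mul, Ideal.Quotient.eq_zero_iff_mem] at hab
    rw [Ideal.Quotient.eq_zero_iff_mem, Ideal.Quotient.eq_zero_iff_mem, or_iff_not_imp_left]
    intro ha
    have h1 : T ⊔ Ideal.span {a} = ⊤ := hmax _ <| left_lt_sup.2 fun h =>
      ha (h (Ideal.mem_span_singleton_self _))
    obtain ⟨j, hj, w, hw, h2⟩ := Submodule.mem_sup.1 (h1.symm ▸ Submodule.mem_top : (1 : R) ∈ _)
    obtain ⟨z, rfl⟩ := Ideal.mem_span_singleton'.1 hw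
    rw [← one_mul b, ← h2, add_mul, mul_assoc]
    exact add_mem (Ideal.mul_mem_right _ _ hj) (Ideal.mul_mem_left _ _ hab)⟩
  have : IsDomain (R ⧸ T) := NoZeroDivisors.to_isDomain _
  rw [← Ideal.Quotient.eq, map_mul, map_mul]
  exact (Finite.isDomain_to_isField (R ⧸ T)).mul_comm _ _

/-- A two-sided ideal strictly between `q R` and `R` forces `q` to divide the discriminant. -/
theorem IsMid.discLE_of_isTwoSided (hq0 : q ≠ ⊥) [hq : q.IsMaximal] (hP : PrincipalAt R q)
    {T : Ideal R} [T.IsTwoSided] (hT : IsMid q T) : Q.DiscLE q := by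
  have := Q.finite_quot_ext hq0 hP
  have := finite_quot_of_le hT.1
  have hcomm := commutator_mem_of_maximal hT.2.1 fun J hJ => hT.eq_top_of_lt Q hq0 hP hJ
  -- The largest part of `T` stable under conjugation. The trace of an element of it lies in `T`,
  -- and the scalars in the proper ideal `T` all belong to `q`.
  let S : Ideal R :=
    { carrier := {x | x ∈ T ∧ Q.conj x ∈ T}
      zero_mem' := by simp [Q.conj_zero]
      add_mem' := fun {x y} hx hy => ⟨add_mem hx.1 hy.1, by
        rw [Q.conj_add]; exact add_mem hx.2 hy.2⟩
      smul_mem' := fun r x hx => ⟨Ideal.mul_mem_left _ _ hx.1, by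
        rw [smul_eq_mul, Q.conj_mul]; exact Ideal.mul_mem_right _ _ hx.2⟩ }
  have hS : ∀ x, x ∈ S ↔ x ∈ T ∧ Q.conj x ∈ T := fun x => Iff.rfl
  have hST : S ≤ T := fun x hx => hx.1
  have hcS (x y w : R) : (x * y - y * x) * w ∈ S := by
    refine ⟨Ideal.mul_mem_right _ _ (hcomm x y), ?_⟩
    rw [Q.conj_mul, Q.conj_sub, Q.conj_mul, Q.conj_mul]
    exact Ideal.mul_mem_left _ _ (hcomm _ _)
  have hle : ext R q ≤ S := fun x hx => ⟨hT.1 hx, hT.1 (Q.conj_mem_ext hx)⟩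
  by_cases hSe : S = ext R q
  · intro x y w
    exact Q.tr_mem_of_mem_ext (hSe ▸ hcS x y w)
  · intro x y w
    have h := hcS x y w
    have h1 : algebraMap O R (Q.tr ((x * y - y * x) * w)) ∈ T := by
      rw [← Q.add_conj]; exact add_mem h.1 h.2
    by_contra hn
    obtain ⟨s, i, hi, hs⟩ := hq.exists_inv hn
    refine hT.2.1 ((Ideal.eq_top_iff_one _).2 ?_)
    rw [← map_one (algebraMap O R), ← hs, map_add, map_mul]
    exact add_mem (Ideal.mul_mem_left _ _ h1) (hT.1 (algebraMap_mem_ext R hi))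

end DefiniteData
end QuatOrders

/-! ### Left ideals at an unramified prime -/

namespace QuatOrders

theorem isUnit_of_span_eq_top {B : Type*} [Ring B] [Finite B] {x : B}
    (h : Ideal.span {x} = ⊤) : IsUnit x := by
  obtain ⟨z, hz⟩ := Ideal.mem_span_singleton'.1 (h ▸ Submodule.mem_top : (1 : B) ∈ Ideal.span {x})
  have hinj : Function.Injective (x * ·) := fun a b hab => by
    have := congrArg (z * ·) hab
    simpa [← mul_assoc, hz] using this
  obtain ⟨w, hw⟩ := Finite.surjective_of_injective hinj 1
  have hw' : x * w = 1 := hw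
  refine ⟨⟨x, w, hw', ?_⟩, rfl⟩
  have : z = w := by rw [← mul_one z, ← hw', ← mul_assoc, hz, one_mul]
  rw [← this, hz]

/-- The number of proper nonzero left ideals in a finite ring whose size and group of units are
those of the ring of `2 × 2` matrices. -/
theorem card_proper_ideals {B : Type*} [Ring B] [Finite B] {N : ℕ} (hN : 1 < N)
    (hB : Nat.card B = N ^ 4) (hU : Nat.card Bˣ = (N ^ 2 - 1) * (N ^ 2 - N))
    (hI : ∀ I : Ideal B, I ≠ ⊥ → I ≠ ⊤ → Nat.card I = N ^ 2) :
    Nat.card {I : Ideal B // I ≠ ⊥ ∧ I ≠ ⊤} = N + 1 := by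
  classical
  have : Finite (Ideal B) := Finite.of_injective (fun I : Ideal B => (I : Set B))
    SetLike.coe_injective
  have hBn : Nontrivial B := by
    rw [← Finite.one_lt_card_iff_nontrivial, hB]; exact Nat.one_lt_pow (by norm_num) hN
  have hne {x : B} (hx : x ≠ 0 ∧ ¬ IsUnit x) :
      Ideal.span {x} ≠ (⊥ : Ideal B) ∧ Ideal.span {x} ≠ (⊤ : Ideal B) :=
    ⟨fun h => hx.1 (Ideal.span_singleton_eq_bot.1 h), fun h => hx.2 (isUnit_of_span_eq_top h)⟩
  -- Every nonzero nonunit lies in exactly one proper ideal: it generates one, and all of them have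
  -- equal size.
  let e : {x : B // x ≠ 0 ∧ ¬ IsUnit x} ≃
      Σ I : {I : Ideal B // I ≠ ⊥ ∧ I ≠ ⊤}, {x : I.1 // x ≠ 0} :=
    { toFun := fun x => ⟨⟨Ideal.span {x.1}, hne x.2⟩,
        ⟨⟨x.1, Ideal.mem_span_singleton_self _⟩, fun h => x.2.1 (congrArg Subtype.val h)⟩⟩
      invFun := fun y => ⟨y.2.1.1, fun h => y.2.2 (Subtype.ext h), fun h =>
        y.1.2.2 (Ideal.eq_top_of_isUnit_mem _ y.2.1.2 h)⟩
      left_inv := fun x => rfl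
      right_inv := by
        rintro ⟨⟨I, hI0, hI1⟩, ⟨⟨x, hxI⟩, hx0⟩⟩
        have hx0' : x ≠ 0 := fun h => hx0 (Subtype.ext h)
        have hxu : ¬ IsUnit x := fun h => hI1 (Ideal.eq_top_of_isUnit_mem _ hxI h)
        have hs := hne ⟨hx0', hxu⟩
        have hle : Ideal.span {x} ≤ I := (Ideal.span_singleton_le_iff_mem _).2 hxI
        have : Ideal.span {x} = I := by
          apply SetLike.coe_injective
          refine Set.eq_of_subset_of_ncard_le hle ?_
          have h1 := hI I hI0 hI1
          have h2 := hI _ hs.1 hs.2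
          rw [← Nat.card_coe_set_eq, ← Nat.card_coe_set_eq]
          exact (h1.trans h2.symm).le
        subst this
        rfl }
  have h1 := Nat.card_congr e
  have : Fintype {I : Ideal B // I ≠ ⊥ ∧ I ≠ ⊤} := Fintype.ofFinite _
  rw [Nat.card_sigma] at h1
  have h2 (I : {I : Ideal B // I ≠ ⊥ ∧ I ≠ ⊤}) : Nat.card {x : I.1 // x ≠ 0} = N ^ 2 - 1 := by
    have h := hI I.1 I.2.1 I.2.2
    have h3 : Nat.card {x : I.1 // x ≠ 0} = Nat.card I.1 - 1 := by
      have := Nat.card_congr (Equiv.sumCompl (fun x : I.1 => x = 0))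
      rw [Nat.card_sum, Nat.card_unique] at this
      have h' : Nat.card {x : I.1 // ¬ x = 0} = Nat.card {x : I.1 // x ≠ 0} := rfl
      omega
    rw [h3, h]
  rw [Finset.sum_congr rfl fun I _ => h2 I, Finset.sum_const, smul_eq_mul, Finset.card_univ,
    ← Nat.card_eq_fintype_card] at h1
  have h4 : Nat.card {x : B // x ≠ 0 ∧ ¬ IsUnit x} + 1 + Nat.card Bˣ = Nat.card B := by
    have e1 := Nat.card_congr (Equiv.sumCompl (fun x : B => IsUnit x))
    rw [Nat.card_sum] at e1
    have e2 : Nat.card {x : B // IsUnit x} = Nat.card Bˣ := Nat.card_congr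
      ⟨fun x => x.2.unit, fun u => ⟨u, u.isUnit⟩, fun x => rfl, fun u => by ext; rfl⟩
    have e3 : Nat.card {x : B // ¬ IsUnit x} = Nat.card {x : B // x ≠ 0 ∧ ¬ IsUnit x} + 1 := by
      change Nat.card {x : B | ¬ IsUnit x} = Nat.card {x : B | x ≠ 0 ∧ ¬ IsUnit x} + 1
      rw [Nat.card_coe_set_eq, Nat.card_coe_set_eq, ← Set.ncard_insert_of_notMem
        (a := 0) (by simp)]
      congr 1
      ext x
      by_cases hx : x = 0 <;> simp [hx]
    omega
  rw [h1, hU, hB] at h4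
  -- The count closes by `N⁴ - 1 - (N² - 1)(N² - N) = (N² - 1)(N + 1)`, where each ideal has `N² -
  -- 1` nonzero elements.
  have h5 : N ≤ N ^ 2 := Nat.le_self_pow two_ne_zero N
  have h6 : 1 ≤ N ^ 2 := Nat.one_le_pow _ _ (by omega)
  zify [h5, h6] at h4 ⊢
  have h7 : ((N : ℤ) ^ 2 - 1) ≠ 0 := by
    have : (1 : ℤ) < N := by exact_mod_cast hN
    nlinarith
  apply mul_right_cancel₀ h7
  linear_combination h4


namespace DefiniteData
open QuadraticData

variable {O R : Type*} [CommRing O] [IsDedekindDomain O] [Module.Free ℤ O] [Module.Finite ℤ O]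
  [Ring R] [Algebra O R] (Q : DefiniteData O R) {q : Ideal O}

include Q in
-- Otherwise `q R` is a maximal left ideal and the quotient a finite division ring. It is
-- commutative, so all commutators lie in `q R` and `q` contains the discriminant.
theorem exists_isMid (hq0 : q ≠ ⊥) [hq : q.IsMaximal] (hP : PrincipalAt R q)
    (hD : ¬ Q.DiscLE q) : ∃ I : Ideal R, IsMid q I := by
  by_contra! hI
  have := Q.finite_quot_ext hq0 hP
  have htop : ext R q ≠ ⊤ := fun h => hq.ne_top <| (Ideal.eq_top_iff_one _).2 <| by
    rw [← Q.algebraMap_mem_ext_iff, h]; trivial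
  refine hD fun x y w => Q.tr_mem_of_mem_ext (Ideal.mul_mem_right _ _ ?_)
  refine commutator_mem_of_maximal htop (fun J hJ => ?_) x y
  by_contra hJ'
  exact hI J ⟨hJ.le, hJ', hJ.ne'⟩

theorem comap_mk_eq_ext_iff {V : Ideal (R ⧸ ext R q)} :
    V.comap (Ideal.Quotient.mk (ext R q)) = ext R q ↔ V = ⊥ := by
  constructor
  · intro h
    rw [eq_bot_iff]
    intro x hx
    obtain ⟨x, rfl⟩ := Ideal.Quotient.mk_surjective x
    have : x ∈ V.comap (Ideal.Quotient.mk (ext R q)) := hx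
    rw [h, ← Ideal.Quotient.eq_zero_iff_mem] at this
    rw [this]; exact zero_mem _
  · rintro rfl
    ext x
    rw [Ideal.mem_comap, Ideal.mem_bot, Ideal.Quotient.eq_zero_iff_mem]

theorem isMid_comap_iff {V : Ideal (R ⧸ ext R q)} :
    IsMid q (V.comap (Ideal.Quotient.mk (ext R q))) ↔ V ≠ ⊥ ∧ V ≠ ⊤ := by
  rw [IsMid, Ne, Ne, Ideal.comap_eq_top_iff, comap_mk_eq_ext_iff]
  refine ⟨fun h => ⟨h.2.2, h.2.1⟩, fun h => ⟨fun x hx => ?_, h.2, h.1⟩⟩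
  rw [Ideal.mem_comap, Ideal.Quotient.eq_zero_iff_mem.2 hx]
  exact zero_mem _

theorem comap_map_mk {I : Ideal R} (hI : ext R q ≤ I) :
    (I.map (Ideal.Quotient.mk (ext R q))).comap (Ideal.Quotient.mk (ext R q)) = I := by
  rw [Ideal.comap_map_of_surjective _ Ideal.Quotient.mk_surjective, comap_mk_eq_ext_iff.2 rfl,
    sup_eq_left.2 hI]

theorem card_isMid_eq : Nat.card {I : Ideal R // IsMid q I} =
    Nat.card {V : Ideal (R ⧸ ext R q) // V ≠ ⊥ ∧ V ≠ ⊤} := by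
  refine (Nat.card_congr (Equiv.ofBijective
    (fun V => ⟨V.1.comap (Ideal.Quotient.mk (ext R q)), isMid_comap_iff.2 V.2⟩) ⟨?_, ?_⟩)).symm
  · intro V W h
    exact Subtype.ext (Ideal.comap_injective_of_surjective _ Ideal.Quotient.mk_surjective
      (congrArg Subtype.val h))
  · intro I
    have h := comap_map_mk I.2.1
    exact ⟨⟨I.1.map (Ideal.Quotient.mk (ext R q)), isMid_comap_iff.1 (h.symm ▸ I.2)⟩,
      Subtype.ext h⟩

include Q in
theorem card_proper_ideal (hq0 : q ≠ ⊥) [hq : q.IsMaximal] (hP : PrincipalAt R q)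
    {V : Ideal (R ⧸ ext R q)} (hV : V ≠ ⊥ ∧ V ≠ ⊤) : Nat.card V = Ideal.absNorm q ^ 2 := by
  have hI := isMid_comap_iff.2 hV
  have h1 := Submodule.card_quotient_mul_card_quotient _ _ hI.1
  rw [Q.card_quot_ext hq0 hP, hI.card_quot Q hq0 hP] at h1
  have h2 : Nat.card V = Nat.card (Submodule.map (ext R q).mkQ
      (V.comap (Ideal.Quotient.mk (ext R q)))) := by
    refine Nat.card_congr (Equiv.subtypeEquivRight fun x => ?_)
    constructor
    · intro hx
      obtain ⟨y, rfl⟩ := Ideal.Quotient.mk_surjective x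
      exact ⟨y, hx, rfl⟩
    · rintro ⟨y, hy, rfl⟩
      exact hy
  rw [h2]
  refine Nat.eq_of_mul_eq_mul_right (pow_pos (absNorm_pos hq0) 2) (h1.trans ?_)
  ring

instance quotExtAlgebra (q : Ideal O) : Algebra (O ⧸ q) (R ⧸ ext R q) :=
  RingHom.toAlgebra' (Ideal.Quotient.lift q
    ((Ideal.Quotient.mk (ext R q)).comp (algebraMap O R)) fun _ ha =>
      Ideal.Quotient.eq_zero_iff_mem.2 (algebraMap_mem_ext R ha)) (by
    intro c x
    obtain ⟨c, rfl⟩ := Ideal.Quotient.mk_surjective c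
    obtain ⟨x, rfl⟩ := Ideal.Quotient.mk_surjective x
    simp only [Ideal.Quotient.lift_mk, RingHom.comp_apply, ← map_mul, Algebra.commutes])

include Q in
-- The annihilator of a left ideal is two-sided. Were it larger than `q R`, it would be an
-- intermediate two-sided ideal, possible only at primes dividing the discriminant.
theorem lsmul_injective (hq0 : q ≠ ⊥) [hq : q.IsMaximal] (hP : PrincipalAt R q)
    (hD : ¬ Q.DiscLE q) {V : Ideal (R ⧸ ext R q)} (hV : V ≠ ⊥) {x : R ⧸ ext R q}
    (hx : ∀ v ∈ V, x * v = 0) : x = 0 := by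
  let T : Ideal R :=
    { carrier := {x | ∀ v ∈ V, Ideal.Quotient.mk _ x * v = 0}
      zero_mem' := by simp
      add_mem' := fun {x y} hx hy v hv => by
        rw [map_add, add_mul, hx v hv, hy v hv, add_zero]
      smul_mem' := fun r x hx v hv => by
        rw [smul_eq_mul, map_mul, mul_assoc, hx v hv, mul_zero] }
  have : T.IsTwoSided := ⟨fun {a} b ha v hv => by
    rw [map_mul, mul_assoc]
    exact ha _ (Ideal.mul_mem_left _ _ hv)⟩
  obtain ⟨x, rfl⟩ := Ideal.Quotient.mk_surjective x
  have hxT : x ∈ T := hx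
  rw [Ideal.Quotient.eq_zero_iff_mem]
  by_contra hx0
  have hT : IsMid q T := by
    refine ⟨fun y hy v hv => ?_, fun h => hV ?_, fun h => hx0 (h ▸ hxT)⟩
    · rw [Ideal.Quotient.eq_zero_iff_mem.2 hy, zero_mul]
    · rw [Submodule.eq_bot_iff]
      intro v hv
      have : (1 : R) ∈ T := h.symm ▸ Submodule.mem_top
      simpa using this v hv
  exact hD (hT.discLE_of_isTwoSided Q hq0 hP)

include Q in
-- An intermediate left ideal gives a module of dimension 2 over the residue field on which `R/qR`
-- acts faithfully. Both this ring and the 2 by 2 matrix ring have `N(q)⁴` elements, so they are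
-- isomorphic.
theorem card_units (hq0 : q ≠ ⊥) [hq : q.IsMaximal] (hP : PrincipalAt R q)
    (hD : ¬ Q.DiscLE q) : Nat.card (R ⧸ ext R q)ˣ =
      (Ideal.absNorm q ^ 2 - 1) * (Ideal.absNorm q ^ 2 - Ideal.absNorm q) := by
  obtain ⟨I, hI⟩ := Q.exists_isMid hq0 hP hD
  set V := I.map (Ideal.Quotient.mk (ext R q))
  have hV : V ≠ ⊥ ∧ V ≠ ⊤ := isMid_comap_iff.1 ((comap_map_mk hI.1).symm ▸ hI)
  have hcV := Q.card_proper_ideal hq0 hP hV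
  have hfin := Q.finite_quot_ext hq0 hP
  have : Finite (O ⧸ q) := Ideal.finiteQuotientOfFreeOfNeBot q hq0
  let _ : Field (O ⧸ q) := Ideal.Quotient.field q
  let _ : Fintype (O ⧸ q) := Fintype.ofFinite _
  let _ : Fintype V := Fintype.ofFinite _
  have hN : Fintype.card (O ⧸ q) = Ideal.absNorm q := by
    rw [← Nat.card_eq_fintype_card, card_quotient]
  have hrank : Module.finrank (O ⧸ q) V = 2 := by
    have h := Module.card_eq_pow_finrank (K := O ⧸ q) (V := V)
    rw [hN, ← Nat.card_eq_fintype_card, hcV] at h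
    exact (Nat.pow_right_injective (one_lt_absNorm hq0) h).symm
  let b := Module.finBasisOfFinrankEq (O ⧸ q) V hrank
  let f : (R ⧸ ext R q) →ₐ[O ⧸ q] Matrix (Fin 2) (Fin 2) (O ⧸ q) :=
    (algEquivMatrix b).toAlgHom.comp (Algebra.lsmul (O ⧸ q) (O ⧸ q) V)
  have hinj : Function.Injective f := by
    refine (algEquivMatrix b).injective.comp ?_
    refine (injective_iff_map_eq_zero _).2 fun x hx => ?_
    refine Q.lsmul_injective hq0 hP hD hV.1 fun v hv => ?_
    exact congrArg Subtype.val (LinearMap.congr_fun hx ⟨v, hv⟩)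
  have hcard : Nat.card (R ⧸ ext R q) = Nat.card (Matrix (Fin 2) (Fin 2) (O ⧸ q)) := by
    rw [Q.card_quot_ext hq0 hP, Matrix, Nat.card_fun, Nat.card_fun, Nat.card_eq_fintype_card
      (α := O ⧸ q), hN, Nat.card_fin, ← pow_mul]
  have hbij : Function.Bijective f := (Nat.bijective_iff_injective_and_card f).2 ⟨hinj, hcard⟩
  rw [Nat.card_congr (Units.mapEquiv (AlgEquiv.ofBijective f hbij).toMulEquiv).toEquiv]
  have := Matrix.card_GL_field (𝔽 := O ⧸ q) 2
  rw [hN] at this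
  simpa [Fin.prod_univ_two] using this

theorem card_isMid (hq0 : q ≠ ⊥) [hq : q.IsMaximal] (hP : PrincipalAt R q)
    (hD : ¬ Q.DiscLE q) : Nat.card {I : Ideal R // IsMid q I} = Ideal.absNorm q + 1 := by
  have hfin := Q.finite_quot_ext hq0 hP
  rw [card_isMid_eq]
  exact card_proper_ideals (one_lt_absNorm hq0) (Q.card_quot_ext hq0 hP)
    (Q.card_units hq0 hP hD) fun I h0 h1 => Q.card_proper_ideal hq0 hP ⟨h0, h1⟩

end DefiniteData
end QuatOrders

/-! ### Indices of lattices, integrality of trace and norm -/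

namespace QuatOrders

section Lattice

variable {K : Type*} [Field K] [NumberField K] {V : Type*} [AddCommGroup V] [Module K V]
  [Module (𝓞 K) V] [IsScalarTower (𝓞 K) K V] [Module ℚ V] [IsScalarTower ℚ K V] [Module.Finite K V]

theorem isLattice_restrictScalars (L : Submodule (𝓞 K) V) [hL : Submodule.IsLattice K L] :
    Submodule.IsLattice ℚ (L.restrictScalars ℤ) where
  fg := by
    have : Module.Finite ℤ L := Module.Finite.trans (𝓞 K) L
    exact Module.Finite.iff_fg.1 this
  span_eq_top := by
    rw [eq_top_iff]
    intro x _
    have hx : x ∈ Submodule.span K (L : Set V) := hL.span_eq_top ▸ Submodule.mem_top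
    refine Submodule.span_induction (p := fun x _ => x ∈ Submodule.span ℚ (L : Set V))
      (fun x hx => Submodule.subset_span hx) (zero_mem _) (fun _ _ _ _ => add_mem) ?_ hx |> id
    intro k x _ hx
    refine Submodule.span_induction (p := fun x _ => k • x ∈ Submodule.span ℚ (L : Set V))
      ?_ (by simp) (fun _ _ _ _ h1 h2 => by rw [smul_add]; exact add_mem h1 h2)
      (fun c x _ h => by
        rw [← algebraMap_smul K c x, smul_smul, mul_comm, ← smul_smul, algebraMap_smul]
        exact Submodule.smul_mem _ _ h) hx
    intro x hx
    -- A rational integer `n` clears the denominator of `k`, so `k • x` is a rational multiple of a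
    -- vector of `L`.
    obtain ⟨n, hn, hi⟩ := IsAlgebraic.exists_integral_multiple (R := ℤ)
      ((IsFractionRing.isAlgebraic_iff ℤ ℚ K).2 (Algebra.IsAlgebraic.isAlgebraic k))
    obtain ⟨o, ho⟩ : ∃ o : 𝓞 K, algebraMap (𝓞 K) K o = n • k := ⟨⟨n • k, hi⟩, rfl⟩
    have h1 : k • x = (n : ℚ)⁻¹ • (o • x) := by
      rw [← algebraMap_smul K o x, ← algebraMap_smul K (n : ℚ)⁻¹ ((algebraMap (𝓞 K) K o) • x),
        smul_smul, ho, zsmul_eq_mul, map_inv₀, map_intCast, inv_mul_cancel_left₀]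
      exact_mod_cast hn
    rw [h1]
    exact Submodule.smul_mem _ _ (Submodule.subset_span (L.smul_mem o hx))

/-- The index of the image of a lattice under an endomorphism. -/
theorem relIndex_map_eq (L : Submodule (𝓞 K) V) [hL : Submodule.IsLattice K L] (f : V →ₗ[K] V)
    (hf : LinearMap.det f ≠ 0) (hfL : ∀ x ∈ L, f x ∈ L) :
    ((L.toAddSubgroup.map f.toAddMonoidHom).relIndex L.toAddSubgroup : ℚ) =
      |Algebra.norm ℚ (LinearMap.det f)| := by
  classical
  have := isLattice_restrictScalars L
  have : Module.Finite ℚ V := Module.Finite.trans K V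
  let b := Module.Free.chooseBasis ℤ (L.restrictScalars ℤ)
  let b₂ := b.extendOfIsLattice ℚ
  have hdet' : LinearMap.det (f.restrictScalars ℚ) = Algebra.norm ℚ (LinearMap.det f) :=
    LinearMap.det_restrictScalars
  let e := (f.restrictScalars ℚ).equivOfDetNeZero (by
    rw [hdet']; exact Algebra.norm_ne_zero_iff.2 hf)
  have h2 : L.toAddSubgroup = AddSubgroup.closure (Set.range b₂) := by
    have h1 : Submodule.span ℤ (Set.range b₂) = L.restrictScalars ℤ := by
      have : Set.range b₂ = (L.restrictScalars ℤ).subtype '' Set.range b := by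
        rw [← Set.range_comp]; congr 1; ext i; simp [b₂]
      rw [this, ← Submodule.map_span, b.span_eq, Submodule.map_top, Submodule.range_subtype]
    rw [← Submodule.span_int_eq_addSubgroupClosure, h1]
    rfl
  have h1 : L.toAddSubgroup.map f.toAddMonoidHom = AddSubgroup.closure (Set.range (b₂.map e)) := by
    rw [h2, AddMonoidHom.map_closure, ← Set.range_comp]
    rfl
  rw [AddSubgroup.relIndex_eq_abs_det _ _ (by rintro _ ⟨x, hx, rfl⟩; exact hfL x hx) _ _ h1 h2,
    ← hdet', show ⇑(b₂.map e) = f.restrictScalars ℚ ∘ b₂ from rfl, Module.Basis.det_comp,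
    Module.Basis.det_self, mul_one]

end Lattice

section Integrality

variable {K : Type*} [Field K] [NumberField K] {a b : K}

theorem star_eq (x : ℍ[K,a,b]) : star x = algebraMap K ℍ[K,a,b] (trd x) - x :=
  eq_sub_of_add_eq' (add_star_eq_trd x)

theorem mul_self_eq (x : ℍ[K,a,b]) :
    x * x = algebraMap K ℍ[K,a,b] (trd x) * x - algebraMap K ℍ[K,a,b] (nrd x) := by
  rw [← mul_star_eq_nrd, star_eq, mul_sub, Algebra.commutes, sub_sub_cancel]

theorem trd_mul_comm (x y : ℍ[K,a,b]) : trd (x * y) = trd (y * x) := by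
  simp [trd]; ring

theorem trd_algebraMap (r : K) : trd (algebraMap K ℍ[K,a,b] r) = 2 * r := by
  simp [trd]; ring

theorem nrd_algebraMap (r : K) : nrd (algebraMap K ℍ[K,a,b] r) = r ^ 2 := by
  simp [nrd_eq]

open Polynomial in
-- A nonscalar `x` has `X² - trd(x) X + nrd(x)` as minimal polynomial over `K`. It divides a monic
-- integral polynomial, and by Gauss's lemma its coefficients are integral.
theorem isIntegral_trd_nrd {x : ℍ[K,a,b]} (hx : IsIntegral (𝓞 K) x) :
    IsIntegral (𝓞 K) (trd x) ∧ IsIntegral (𝓞 K) (nrd x) := by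
  by_cases hK : ∃ r, x = algebraMap K _ r
  · obtain ⟨r, rfl⟩ := hK
    have hr : IsIntegral (𝓞 K) r :=
      (isIntegral_algebraMap_iff (algebraMap K ℍ[K,a,b]).injective).1 hx
    rw [trd_algebraMap, nrd_algebraMap, two_mul]
    exact ⟨hr.add hr, hr.pow 2⟩
  obtain ⟨f, hf, hfx⟩ := hx
  let g : K[X] := X ^ 2 - C (trd x) * X + C (nrd x)
  have hg : g.Monic := by unfold g; monicity!
  have hgx : aeval x g = 0 := by
    simp only [g, map_add, map_sub, map_mul, aeval_X, aeval_C, map_pow]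
    rw [sq, mul_self_eq]; abel
  have hfx' : aeval x (f.map (algebraMap (𝓞 K) K)) = 0 := by
    rw [aeval_map_algebraMap]; exact hfx
  have hdvd : g ∣ f.map (algebraMap (𝓞 K) K) := by
    rw [← modByMonic_eq_zero_iff_dvd hg]
    set r := f.map (algebraMap (𝓞 K) K) %ₘ g with hr
    have hrx : aeval x r = 0 := by
      have := congrArg (aeval x) (modByMonic_add_div (f.map (algebraMap (𝓞 K) K)) g)
      rw [map_add, map_mul, hgx, zero_mul, add_zero, hfx'] at this
      exact this
    have hdeg : r.degree ≤ 1 := by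
      have h1 := degree_modByMonic_lt (f.map (algebraMap (𝓞 K) K)) hg
      have h2 : g.degree = 2 := by unfold g; compute_degree!
      rw [h2] at h1
      exact Order.le_of_lt_succ h1
    rw [eq_X_add_C_of_degree_le_one hdeg] at hrx ⊢
    simp only [map_add, map_mul, aeval_X, aeval_C] at hrx
    -- A linear relation with nonzero leading coefficient would make `x` a scalar.
    have h1 : r.coeff 1 = 0 := by
      by_contra h1
      refine hK ⟨-(r.coeff 0 / r.coeff 1), ?_⟩
      have : algebraMap K ℍ[K,a,b] (r.coeff 1)⁻¹ * (algebraMap K ℍ[K,a,b] (r.coeff 1) * x +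
        algebraMap K ℍ[K,a,b] (r.coeff 0)) = 0 := by rw [hrx, mul_zero]
      rw [mul_add, ← mul_assoc, ← map_mul, inv_mul_cancel₀ h1, map_one, one_mul, ← map_mul] at this
      rw [eq_neg_of_add_eq_zero_left this, ← map_neg]
      congr 2
      ring
    rw [h1, map_zero, zero_mul, zero_add] at hrx
    rw [h1, (algebraMap K ℍ[K,a,b]).injective (hrx.trans (map_zero _).symm)]
    simp
  obtain ⟨g', hg'⟩ := IsIntegrallyClosed.eq_map_mul_C_of_dvd K hf hdvd
  rw [hg.leadingCoeff, C_1, mul_one] at hg'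
  have hc (n : ℕ) : IsIntegral (𝓞 K) (g.coeff n) := by
    rw [← hg', coeff_map]; exact isIntegral_algebraMap
  constructor
  · have := (hc 1).neg
    simpa [g, coeff_X] using this
  · simpa [g] using hc 0

end Integrality
end QuatOrders

/-! ### Orders in a definite quaternion algebra as instances of the abstract data -/

namespace QuatOrders

section Integrality

variable {K : Type*} [Field K] [NumberField K] {a b : K}

theorem det_mulRight (y : ℍ[K,a,b]) :
    LinearMap.det (LinearMap.mulRight K y) = nrd y ^ 2 := by
  have h : LinearMap.toMatrix (QuaternionAlgebra.basisOneIJK a 0 b)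
      (QuaternionAlgebra.basisOneIJK a 0 b) (LinearMap.mulRight K y) =
      !![y.re, a * y.imI, b * y.imJ, -(a * b * y.imK);
         y.imI, y.re, -(b * y.imK), b * y.imJ;
         y.imJ, a * y.imK, y.re, -(a * y.imI);
         y.imK, y.imJ, -y.imI, y.re] := by
    ext i j
    rw [LinearMap.toMatrix_apply, QuaternionAlgebra.coe_basisOneIJK_repr]
    fin_cases i <;> fin_cases j <;> simp [QuaternionAlgebra.basisOneIJK]
  rw [← LinearMap.det_toMatrix (QuaternionAlgebra.basisOneIJK a 0 b), h]
  simp [Matrix.det_succ_row_zero, Fin.sum_univ_succ, nrd_eq, Fin.succAbove]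
  ring

theorem IsDefinite.eq_zero [NumberField.IsTotallyReal K] (hdef : IsDefinite a b) {x : ℍ[K,a,b]}
    (hx : nrd x = 0) : x = 0 := by
  by_contra h
  obtain ⟨v⟩ : Nonempty (NumberField.InfinitePlace K) := inferInstance
  have := hdef x h (NumberField.InfinitePlace.embedding_of_isReal
    (NumberField.IsTotallyReal.isReal v))
  rw [hx, map_zero] at this
  exact lt_irrefl _ this

theorem norm_abs_eq_absNorm (r : 𝓞 K) :
    |Algebra.norm ℚ (r : K)| = Ideal.absNorm (Ideal.span {r}) := by
  rw [Ideal.absNorm_span_singleton, ← Algebra.coe_norm_int, Nat.cast_natAbs, Int.cast_abs]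

variable {H : Subalgebra (𝓞 K) ℍ[K,a,b]}

theorem IsOrder.isIntegral (hH : IsOrder H) {x : ℍ[K,a,b]} (hx : x ∈ H) :
    IsIntegral (𝓞 K) x :=
  IsIntegral.of_mem_of_fg H hH.fg x hx

theorem IsOrder.exists_trd (hH : IsOrder H) (x : H) : ∃ r : 𝓞 K, (r : K) = trd (x : ℍ[K,a,b]) :=
  IsIntegrallyClosed.isIntegral_iff.1 (isIntegral_trd_nrd (hH.isIntegral x.2)).1

theorem IsOrder.exists_nrd (hH : IsOrder H) (x : H) : ∃ r : 𝓞 K, (r : K) = nrd (x : ℍ[K,a,b]) :=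
  IsIntegrallyClosed.isIntegral_iff.1 (isIntegral_trd_nrd (hH.isIntegral x.2)).2

theorem IsOrder.star_mem (hH : IsOrder H) {x : ℍ[K,a,b]} (hx : x ∈ H) : star x ∈ H := by
  obtain ⟨r, hr⟩ := hH.exists_trd ⟨x, hx⟩
  rw [star_eq, ← hr]
  exact sub_mem (H.algebraMap_mem r) hx

theorem coe_algebraMap (r : 𝓞 K) :
    ((algebraMap (𝓞 K) H r : H) : ℍ[K,a,b]) = algebraMap K ℍ[K,a,b] (r : K) := rfl

theorem algebraMap_injective : Function.Injective (algebraMap K ℍ[K,a,b]) :=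
  (algebraMap K ℍ[K,a,b]).injective

/-- Right multiplication by `y` has determinant `nrd(y)²` over `K`, and the index of the image of a
lattice is the absolute value of the field norm of the determinant. -/
theorem card_quot_span (hH : IsOrder H) (y : H) {r : 𝓞 K} (hr : (r : K) = nrd (y : ℍ[K,a,b]))
    (h0 : r ≠ 0) : Nat.card (H ⧸ Ideal.span {y}) = Ideal.absNorm (Ideal.span {r}) ^ 2 := by
  have hL : Submodule.IsLattice K (Subalgebra.toSubmodule H) := hH
  have hd : LinearMap.det (LinearMap.mulRight K (y : ℍ[K,a,b])) = ((r ^ 2 : 𝓞 K) : K) := by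
    rw [det_mulRight, ← hr]; exact (map_pow (algebraMap (𝓞 K) K) r 2).symm
  have h1 := relIndex_map_eq (Subalgebra.toSubmodule H) (LinearMap.mulRight K (y : ℍ[K,a,b]))
    (by rw [hd]; simpa using h0) (fun x hx => H.mul_mem hx y.2)
  rw [hd, norm_abs_eq_absNorm, ← Ideal.span_singleton_pow, map_pow] at h1
  rw [← Nat.cast_injective h1]
  have : (Submodule.toAddSubgroup (Ideal.span {y})) =
      ((Subalgebra.toSubmodule H).toAddSubgroup.map (LinearMap.mulRight K
        (y : ℍ[K,a,b])).toAddMonoidHom).addSubgroupOf (Subalgebra.toSubmodule H).toAddSubgroup := by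
    ext z
    rw [Submodule.mem_toAddSubgroup, Ideal.mem_span_singleton']
    constructor
    · rintro ⟨w, rfl⟩
      exact ⟨w, w.2, rfl⟩
    · rintro ⟨w, hw, hz⟩
      exact ⟨⟨w, hw⟩, Subtype.ext hz⟩
  rw [AddSubgroup.relIndex, ← this]
  rfl

/-- The norm form of an order in a definite quaternion algebra. -/
def IsOrder.data [NumberField.IsTotallyReal K] (hdef : IsDefinite a b) (hH : IsOrder H) :
    DefiniteData (𝓞 K) H where
  conj x := ⟨star (x : ℍ[K,a,b]), hH.star_mem x.2⟩
  tr x := (hH.exists_trd x).choose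
  nm x := (hH.exists_nrd x).choose
  conj_add x y := Subtype.ext (star_add _ _)
  conj_mul x y := Subtype.ext (star_mul _ _)
  conj_conj x := Subtype.ext (star_star _)
  conj_algebraMap r := Subtype.ext (QuaternionAlgebra.star_coe (r : K))
  add_conj x := Subtype.ext <| by
    rw [coe_algebraMap, (hH.exists_trd x).choose_spec, ← add_star_eq_trd]; rfl
  mul_conj x := Subtype.ext <| by
    rw [coe_algebraMap, (hH.exists_nrd x).choose_spec, ← mul_star_eq_nrd]; rfl
  tr_mul_comm x y := NumberField.RingOfIntegers.ext <| by
    rw [(hH.exists_trd _).choose_spec, (hH.exists_trd _).choose_spec]; exact trd_mul_comm _ _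
  injective r s h := NumberField.RingOfIntegers.ext <|
    algebraMap_injective (a := a) (b := b) (congrArg Subtype.val h)
  cancel r x hr h := Subtype.ext <| by
    have h1 : algebraMap K ℍ[K,a,b] (r : K) * x = 0 := congrArg Subtype.val h
    have h2 : (r : K) ≠ 0 := by simpa using hr
    rw [← Algebra.smul_def] at h1
    exact (smul_eq_zero.1 h1).resolve_left h2
  saturated r s x hr h := by
    have h1 : algebraMap K ℍ[K,a,b] (r : K) * x = algebraMap K ℍ[K,a,b] (s : K) :=
      congrArg Subtype.val h
    have h2 : (r : K) ≠ 0 := by simpa using hr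
    have h3 : (x : ℍ[K,a,b]) = algebraMap K ℍ[K,a,b] ((r : K)⁻¹ * s) := by
      rw [map_mul, ← h1, ← mul_assoc, ← map_mul, inv_mul_cancel₀ h2, map_one, one_mul]
    have h4 := hH.isIntegral x.2
    rw [h3, isIntegral_algebraMap_iff algebraMap_injective] at h4
    obtain ⟨c, hc⟩ := IsIntegrallyClosed.isIntegral_iff.1 h4
    exact ⟨c, Subtype.ext (by rw [h3, ← hc]; rfl)⟩
  eq_zero_of_nm x hx := Subtype.ext <| hdef.eq_zero <| by
    rw [← (hH.exists_nrd x).choose_spec, hx]; exact map_zero (algebraMap (𝓞 K) K)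
  card_quot y hy := card_quot_span hH y (hH.exists_nrd y).choose_spec hy

variable [NumberField.IsTotallyReal K] (hdef : IsDefinite a b) (hH : IsOrder H)

theorem IsOrder.coe_nm (x : H) : (((hH.data hdef).nm x : 𝓞 K) : K) = nrd (x : ℍ[K,a,b]) :=
  (hH.exists_nrd x).choose_spec

theorem IsOrder.coe_tr (x : H) : (((hH.data hdef).tr x : 𝓞 K) : K) = trd (x : ℍ[K,a,b]) :=
  (hH.exists_trd x).choose_spec

theorem IsOrder.discLE_iff {q : Ideal (𝓞 K)} : (hH.data hdef).DiscLE q ↔ discrd H ≤ q := by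
  rw [discrd, Ideal.span_le]
  constructor
  · rintro h d ⟨x, hx, y, hy, z, hz, hd⟩
    have := h ⟨x, hx⟩ ⟨y, hy⟩ ⟨star z, hH.star_mem hz⟩
    have hd' : d = (hH.data hdef).tr ((⟨x, hx⟩ * ⟨y, hy⟩ - ⟨y, hy⟩ * ⟨x, hx⟩) *
        ⟨star z, hH.star_mem hz⟩) := NumberField.RingOfIntegers.ext <| by
      rw [hd, hH.coe_tr]; rfl
    rw [hd']
    exact this
  · intro h x y z
    refine h ⟨x, x.2, y, y.2, star (z : ℍ[K,a,b]), hH.star_mem z.2, ?_⟩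
    rw [hH.coe_tr, star_star]
    rfl

end Integrality
end QuatOrders

/-! ### Principal ideals from class number one -/

namespace QuatOrders
open QuadraticData

theorem fg_of_le {O M : Type*} [CommRing O] [IsNoetherianRing O] [AddCommGroup M] [Module O M]
    {N L : Submodule O M} (hL : L.FG) (h : N ≤ L) : N.FG := by
  have : Module.Finite O L := Module.Finite.iff_fg.2 hL
  exact Module.Finite.iff_fg.1 (Module.Finite.of_injective (Submodule.inclusion h)
    (Submodule.inclusion_injective h))

section Algebra

variable {O A : Type*} [CommRing O] [Ring A] [Algebra O A]

/-- The scalars that move `y` into `G`. -/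
def denomIdeal (G : Subalgebra O A) (y : A) : Ideal O where
  carrier := {t | algebraMap O A t * y ∈ G}
  zero_mem' := by simp
  add_mem' {s t} hs ht := by
    change algebraMap O A (s + t) * y ∈ G
    rw [map_add, add_mul]; exact add_mem hs ht
  smul_mem' r t ht := by
    change algebraMap O A (r * t) * y ∈ G
    rw [map_mul, mul_assoc]; exact G.mul_mem (G.algebraMap_mem r) ht

theorem mem_denomIdeal {G : Subalgebra O A} {y : A} {t : O} :
    t ∈ denomIdeal G y ↔ algebraMap O A t * y ∈ G := Iff.rfl

theorem exists_common_denominator [IsDomain O] {G H : Subalgebra O A}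
    (hH : (Subalgebra.toSubmodule H).FG)
    (h : ∀ x : A, ∃ c : O, c ≠ 0 ∧ algebraMap O A c * x ∈ G) :
    ∃ c : O, c ≠ 0 ∧ ∀ x ∈ H, algebraMap O A c * x ∈ G := by
  classical
  obtain ⟨s, hs⟩ := hH
  choose c hc0 hc using h
  refine ⟨∏ x ∈ s, c x, Finset.prod_ne_zero_iff.2 fun x _ => hc0 x, ?_⟩
  intro x hx
  have hle : Subalgebra.toSubmodule H ≤ Submodule.comap
      (LinearMap.lsmul O A (∏ x ∈ s, c x)) (Subalgebra.toSubmodule G) := by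
    rw [← hs, Submodule.span_le]
    intro y hy
    change (∏ x ∈ s, c x) • y ∈ Subalgebra.toSubmodule G
    rw [← Finset.prod_erase_mul s c hy, mul_smul, Algebra.smul_def (c y)]
    exact Submodule.smul_mem _ _ (hc y)
  rw [← Algebra.smul_def]
  exact hle hx

end Algebra

section ClassNumber

variable {K : Type*} [Field K] [NumberField K] {a b : K}

theorem isLattice_of_smul_mem {M N L : Submodule (𝓞 K) ℍ[K,a,b]} (hM : Submodule.IsLattice K M)
    (hL : L.FG) (hNL : N ≤ L) {r : 𝓞 K} (hr : r ≠ 0) (h : ∀ x ∈ M, r • x ∈ N) :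
    Submodule.IsLattice K N where
  fg := by
    exact fg_of_le hL hNL
  span_eq_top := by
    rw [eq_top_iff, ← hM.span_eq_top, Submodule.span_le]
    intro x hx
    have hr' : (r : K) ≠ 0 := by simpa using hr
    have : x = (r : K)⁻¹ • (r • x) := by
      rw [← algebraMap_smul K r x, smul_smul]
      exact (by rw [inv_mul_cancel₀ hr', one_smul] : ((r : K)⁻¹ * (r : K)) • x = x).symm
    rw [this]
    exact Submodule.smul_mem _ _ (Submodule.subset_span (h x hx))

theorem smul_eq_mul_left (r : 𝓞 K) (x : ℍ[K,a,b]) : r • x = algebraMap (𝓞 K) ℍ[K,a,b] r * x :=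
  Algebra.smul_def _ _

/-- The order `G` is itself a lattice with right order `G`, so the only class is that of `G`. -/
theorem exists_eq_mul_of_classNumber {G : Subalgebra (𝓞 K) ℍ[K,a,b]} (hG : IsOrder G)
    (hcls : classNumber G = 1) {L : Submodule (𝓞 K) ℍ[K,a,b]} (hL : Submodule.IsLattice K L)
    (hLG : rightOrder L = G) :
    ∃ x : ℍ[K,a,b]ˣ, (L : Set ℍ[K,a,b]) = (fun m => (x : ℍ[K,a,b]) * m) '' (G : Set ℍ[K,a,b]) := by
  have hGG : rightOrder (Subalgebra.toSubmodule G) = G := by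
    ext y
    exact ⟨fun h => by
      have := h 1 G.one_mem
      rwa [one_mul] at this, fun h x hx => G.mul_mem hx h⟩
  have h := (Nat.card_eq_one_iff_unique.1 hcls).1
  exact Quotient.exact (h.elim (Quotient.mk (rightEquiv G) ⟨L, hL, hLG⟩)
    (Quotient.mk (rightEquiv G) ⟨Subalgebra.toSubmodule G, hG, hGG⟩))

/-- A maximal order is the right order of each of its right ideals. -/
theorem IsMaximalOrder.mem_of_mem_rightOrder {H : Subalgebra (𝓞 K) ℍ[K,a,b]}
    (hH : IsMaximalOrder H) {I : Submodule (𝓞 K) ℍ[K,a,b]} (hI : I.FG) {r : 𝓞 K} (hr : r ≠ 0)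
    (hrI : algebraMap (𝓞 K) ℍ[K,a,b] r ∈ I) (hstab : ∀ x ∈ I, ∀ y ∈ H, x * y ∈ I)
    {x : ℍ[K,a,b]} (hx : x ∈ rightOrder I) : x ∈ H := by
  have hle : H ≤ rightOrder I := fun y hy x hx => hstab x hx y hy
  have hle' : rightOrder I ≤ H := by
    refine hH.2 ?_ hle
    have hHL : Submodule.IsLattice K (Subalgebra.toSubmodule H) := hH.1
    refine ⟨?_, ?_⟩
    · have : Module.Finite (𝓞 K) I := Module.Finite.iff_fg.2 hI
      -- The right order is finitely generated because multiplication by the scalar `r ∈ I` embeds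
      -- it into `I`.
      let f : Subalgebra.toSubmodule (rightOrder I) →ₗ[𝓞 K] I :=
        { toFun := fun y => ⟨algebraMap (𝓞 K) ℍ[K,a,b] r * y, y.2 _ hrI⟩
          map_add' := fun y z => Subtype.ext (mul_add _ _ _)
          map_smul' := fun c y => Subtype.ext (mul_smul_comm _ _ _) }
      have hf : Function.Injective f := by
        rw [injective_iff_map_eq_zero]
        intro y hy
        have hy' : (r : K) • (y : ℍ[K,a,b]) = 0 := by
          rw [Algebra.smul_def]; exact congrArg Subtype.val hy
        exact Subtype.ext ((smul_eq_zero.1 hy').resolve_left (by simpa using hr))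
      exact Module.Finite.iff_fg.1 (Module.Finite.of_injective f hf)
    · rw [eq_top_iff, ← hHL.span_eq_top]
      exact Submodule.span_mono hle
  exact hle' hx

variable {G H : Subalgebra (𝓞 K) ℍ[K,a,b]}

/-- The right ideal conjugate to a left ideal of an order. -/
def conjIdeal (I : Ideal H) : Submodule (𝓞 K) ℍ[K,a,b] where
  carrier := {x | ∃ y ∈ I, (y : ℍ[K,a,b]) = star x}
  zero_mem' := ⟨0, zero_mem _, by simp⟩
  add_mem' := by
    rintro x x' ⟨y, hy, h⟩ ⟨y', hy', h'⟩
    exact ⟨y + y', add_mem hy hy', by rw [star_add, ← h, ← h']; rfl⟩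
  smul_mem' := by
    rintro r x ⟨y, hy, h⟩
    refine ⟨algebraMap (𝓞 K) H r * y, Ideal.mul_mem_left _ _ hy, ?_⟩
    have hr : star (algebraMap (𝓞 K) ℍ[K,a,b] r) = algebraMap (𝓞 K) ℍ[K,a,b] r :=
      QuaternionAlgebra.star_coe (r : K)
    rw [smul_eq_mul_left, star_mul, hr, ← h, ← Algebra.commutes]
    rfl

theorem conjIdeal_le (hH : IsOrder H) (I : Ideal H) :
    conjIdeal I ≤ Subalgebra.toSubmodule H := by
  rintro x ⟨y, hy, h⟩
  have := hH.star_mem y.2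
  rw [h, star_star] at this
  exact this

theorem conjIdeal_mul_mem (hH : IsOrder H) {I : Ideal H} {x : ℍ[K,a,b]} (hx : x ∈ conjIdeal I)
    {y : ℍ[K,a,b]} (hy : y ∈ H) : x * y ∈ conjIdeal I := by
  obtain ⟨z, hz, h⟩ := hx
  exact ⟨⟨star y, hH.star_mem hy⟩ * z, Ideal.mul_mem_left _ _ hz, by rw [star_mul, ← h]; rfl⟩

theorem algebraMap_mem_conjIdeal {I : Ideal H} {r : 𝓞 K}
    (hr : algebraMap (𝓞 K) H r ∈ I) : algebraMap (𝓞 K) ℍ[K,a,b] r ∈ conjIdeal I :=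
  ⟨_, hr, (QuaternionAlgebra.star_coe (r : K)).symm⟩

theorem conjIdeal_fg (hH : IsOrder H) (I : Ideal H) : (conjIdeal I).FG := by
  exact fg_of_le hH.fg (conjIdeal_le hH I)

/-- If `G` has class number one, left ideals of the maximal order `H` at a prime at which
`G` and `H` agree are principal. -/
theorem principalAt_of_classNumber (hH : IsMaximalOrder H) (hG : IsOrder G) (hGH : G ≤ H)
    (hcls : classNumber G = 1) {f q : Ideal (𝓞 K)}
    (hf : ∀ r ∈ f, ∀ x ∈ H, algebraMap (𝓞 K) ℍ[K,a,b] r * x ∈ G) (hq0 : q ≠ ⊥)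
    (hcop : IsCoprime q f) : PrincipalAt H q := by
  intro I hI
  have hHo : IsOrder H := hH.1
  rw [ext_le_iff] at hI
  obtain ⟨r, hrq, hr0⟩ := Submodule.exists_mem_ne_zero_of_ne_bot hq0
  set J := conjIdeal I
  have hqJ {s : 𝓞 K} (hs : s ∈ q) : algebraMap (𝓞 K) ℍ[K,a,b] s ∈ J :=
    algebraMap_mem_conjIdeal (hI s hs)
  set L := J ⊓ Subalgebra.toSubmodule G
  have hqL {s : 𝓞 K} (hs : s ∈ q) : algebraMap (𝓞 K) ℍ[K,a,b] s ∈ L :=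
    ⟨hqJ hs, G.algebraMap_mem s⟩
  have hfL {t : 𝓞 K} (ht : t ∈ f) {x : ℍ[K,a,b]} (hx : x ∈ J) :
      algebraMap (𝓞 K) ℍ[K,a,b] t * x ∈ L :=
    ⟨by rw [← smul_eq_mul_left]; exact J.smul_mem t hx, hf t ht x (conjIdeal_le hHo I hx)⟩
  have hLlat : Submodule.IsLattice K L := by
    refine isLattice_of_smul_mem (M := Subalgebra.toSubmodule G) hG hG.fg inf_le_right hr0 ?_
    intro x hx
    rw [smul_eq_mul_left]
    exact ⟨conjIdeal_mul_mem hHo (hqJ hrq) (hGH hx), G.mul_mem (G.algebraMap_mem r) hx⟩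
  -- Where `q` is trivial `L` looks like `G`; where `f` is trivial `G = H` and `L` looks like `J`.
  -- For `y` in the right order, `f y` stabilizes `J`, so it lies in `H` and `f² y` in `G`; also `q
  -- y` lies in `G`, as `q ⊆ L`. Coprimality of `q` and `f²` glues these together.
  have hLG : rightOrder L = G := by
    refine le_antisymm (fun y hy => ?_) fun y hy x hx =>
      ⟨conjIdeal_mul_mem hHo hx.1 (hGH hy), G.mul_mem hx.2 hy⟩
    have hfy {t : 𝓞 K} (ht : t ∈ f) : algebraMap (𝓞 K) ℍ[K,a,b] t * y ∈ H := by
      refine hH.mem_of_mem_rightOrder (conjIdeal_fg hHo I) hr0 (hqJ hrq)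
        (fun x hx z hz => conjIdeal_mul_mem hHo hx hz) (fun x hx => ?_)
      rw [← mul_assoc, ← Algebra.commutes]
      exact (hy _ (hfL ht hx)).1
    have hff : f * f ≤ denomIdeal G y := by
      rw [Ideal.mul_le]
      intro t ht t' ht'
      rw [mem_denomIdeal, map_mul, mul_assoc]
      exact hf t ht _ (hfy ht')
    obtain ⟨s, hs, t, ht, hst⟩ := Ideal.isCoprime_iff_exists.1 (hcop.mul_right hcop)
    have h1 : algebraMap (𝓞 K) ℍ[K,a,b] s * y ∈ G := (hy _ (hqL hs)).2
    have h2 : algebraMap (𝓞 K) ℍ[K,a,b] t * y ∈ G := hff ht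
    have := add_mem h1 h2
    rwa [← add_mul, ← map_add, hst, map_one, one_mul] at this
  obtain ⟨x, hx⟩ := exists_eq_mul_of_classNumber hG hcls hLlat hLG
  have hmem (z : ℍ[K,a,b]) : z ∈ L ↔ ∃ g ∈ G, (x : ℍ[K,a,b]) * g = z := by
    rw [← SetLike.mem_coe, hx]; rfl
  obtain ⟨y, hyI, hy⟩ : (x : ℍ[K,a,b]) ∈ J := ((hmem x).2 ⟨1, G.one_mem, mul_one _⟩).1
  refine ⟨y, le_antisymm (fun z hz => ?_) ((Ideal.span_singleton_le_iff_mem _).2 hyI)⟩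
  -- With `1 = s + t`, both `s` and `t * star z` lie in `L = x G`. Hence `star z ∈ x H`, so that `x`
  -- generates `J` and its conjugate generates `I`.
  obtain ⟨s, hs, t, ht, hst⟩ := Ideal.isCoprime_iff_exists.1 hcop
  have hzJ : star (z : ℍ[K,a,b]) ∈ J := ⟨z, hz, (star_star _).symm⟩
  obtain ⟨g, hg, hg'⟩ := (hmem _).1 (hqL hs)
  obtain ⟨g₁, hg₁, hg₁'⟩ := (hmem _).1 (hfL ht hzJ)
  have h1 : star (z : ℍ[K,a,b]) = x * (g * star (z : ℍ[K,a,b]) + g₁) := by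
    rw [mul_add, ← mul_assoc, hg', hg₁', ← add_mul, ← map_add, hst, map_one, one_mul]
  have h2 : g * star (z : ℍ[K,a,b]) + g₁ ∈ H :=
    add_mem (H.mul_mem (hGH hg) (hHo.star_mem z.2)) (hGH hg₁)
  refine Ideal.mem_span_singleton'.2 ⟨⟨_, hHo.star_mem h2⟩, Subtype.ext ?_⟩
  have h3 := congrArg star h1
  rw [star_star, star_mul, ← hy] at h3
  exact h3.symm

/-- Two orders are commensurable. -/
theorem exists_conductor (hG : IsOrder G) (hH : IsOrder H) :
    ∃ c : 𝓞 K, c ≠ 0 ∧ ∀ x ∈ H, algebraMap (𝓞 K) ℍ[K,a,b] c * x ∈ G := by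
  refine exists_common_denominator hH.fg fun x => ?_
  have hx : x ∈ Submodule.span K (G : Set ℍ[K,a,b]) :=
    (hG.span_eq_top : Submodule.span K (G : Set ℍ[K,a,b]) = ⊤) ▸ Submodule.mem_top
  refine Submodule.span_induction (p := fun x _ => ∃ c : 𝓞 K, c ≠ 0 ∧
    algebraMap (𝓞 K) ℍ[K,a,b] c * x ∈ G) ?_ ?_ ?_ ?_ hx
  · intro x hx
    exact ⟨1, one_ne_zero, by rw [map_one, one_mul]; exact hx⟩
  · exact ⟨1, one_ne_zero, by rw [mul_zero]; exact zero_mem G⟩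
  · rintro x y - - ⟨c, hc, hx⟩ ⟨d, hd, hy⟩
    refine ⟨c * d, mul_ne_zero hc hd, ?_⟩
    have e1 : algebraMap (𝓞 K) ℍ[K,a,b] (c * d) * (x + y) =
        algebraMap (𝓞 K) ℍ[K,a,b] d * (algebraMap (𝓞 K) ℍ[K,a,b] c * x) +
        algebraMap (𝓞 K) ℍ[K,a,b] c * (algebraMap (𝓞 K) ℍ[K,a,b] d * y) := by
      rw [mul_add, ← mul_assoc, ← mul_assoc, ← map_mul, ← map_mul, mul_comm d c]
    rw [e1]
    exact add_mem (G.mul_mem (G.algebraMap_mem _) hx) (G.mul_mem (G.algebraMap_mem _) hy)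
  · rintro k x - ⟨c, hc, hx⟩
    obtain ⟨n, d, hd, rfl⟩ := IsFractionRing.div_surjective (𝓞 K) k
    have hd0 : d ≠ 0 := nonZeroDivisors.ne_zero hd
    have hd' : algebraMap (𝓞 K) K d ≠ 0 := by simpa using hd0
    refine ⟨c * d, mul_ne_zero hc hd0, ?_⟩
    have e1 : algebraMap (𝓞 K) ℍ[K,a,b] (c * d) *
        ((algebraMap (𝓞 K) K n / algebraMap (𝓞 K) K d) • x) =
        algebraMap (𝓞 K) ℍ[K,a,b] n * (algebraMap (𝓞 K) ℍ[K,a,b] c * x) := by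
      rw [Algebra.smul_def, ← mul_assoc, ← mul_assoc]
      congr 1
      change algebraMap K ℍ[K,a,b] (algebraMap (𝓞 K) K (c * d)) * _ =
        algebraMap K ℍ[K,a,b] (algebraMap (𝓞 K) K n) * algebraMap K ℍ[K,a,b] (algebraMap (𝓞 K) K c)
      rw [← map_mul, ← map_mul]
      congr 1
      rw [map_mul]
      field_simp
    rw [e1]
    exact G.mul_mem (G.algebraMap_mem _) hx

end ClassNumber
end QuatOrders

/-! ### Totally positive generators and totally positive units -/

namespace QuatOrders
open QuadraticData NumberField

section TotallyPositive

variable {K : Type*} [Field K] [NumberField K]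

theorem TotallyPositive.mul {x y : K} (hx : TotallyPositive x) (hy : TotallyPositive y) :
    TotallyPositive (x * y) := fun σ => by
  rw [map_mul]; exact mul_pos (hx σ) (hy σ)

theorem TotallyPositive.of_mul_left {x y : K} (hxy : TotallyPositive (x * y))
    (hx : TotallyPositive x) : TotallyPositive y := fun σ => by
  have := hxy σ
  rw [map_mul] at this
  exact pos_of_mul_pos_right this (hx σ).le

theorem totallyPositive_one : TotallyPositive (1 : K) := fun σ => by
  rw [map_one]; exact one_pos

theorem TotallyPositive.ne_zero [IsTotallyReal K] {x : K} (hx : TotallyPositive x) : x ≠ 0 := by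
  rintro rfl
  obtain ⟨v⟩ : Nonempty (InfinitePlace K) := inferInstance
  have := hx (InfinitePlace.embedding_of_isReal (IsTotallyReal.isReal v))
  rw [map_zero] at this
  exact lt_irrefl _ this

/-- The ideal has a totally positive generator. -/
def HasPosGenerator (I : Ideal (𝓞 K)) : Prop :=
  ∃ r : 𝓞 K, TotallyPositive (r : K) ∧ Ideal.span {r} = I

theorem hasPosGenerator_of_primes {I : Ideal (𝓞 K)} (hI : I ≠ ⊥)
    (h : ∀ P : Ideal (𝓞 K), P.IsPrime → P ≠ ⊥ → P ∣ I → HasPosGenerator P) :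
    HasPosGenerator I := by
  induction I using UniqueFactorizationMonoid.induction_on_prime with
  | h₁ => exact absurd rfl hI
  | h₂ I hu =>
    refine ⟨1, by simpa using totallyPositive_one, ?_⟩
    rw [Ideal.isUnit_iff.1 hu, Ideal.span_singleton_one]
  | h₃ I P hI0 hP ih =>
    obtain ⟨r, hr, rfl⟩ := ih hI0 fun P' h1 h2 h3 => h P' h1 h2 (h3.mul_left _)
    obtain ⟨s, hs, rfl⟩ := h P (Ideal.isPrime_of_prime hP) hP.ne_zero (dvd_mul_right _ _)
    refine ⟨s * r, ?_, by rw [Ideal.span_singleton_mul_span_singleton]⟩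
    exact TotallyPositive.mul (x := (s : K)) (y := (r : K)) hs hr

theorem exists_nat_totallyPositive_add (y : K) {m : ℕ} (hm : 0 < m) :
    ∃ t : ℕ, TotallyPositive (y + ((t * m : ℕ) : K)) := by
  have hfin : Finite (K →+* ℝ) := inferInstance
  obtain ⟨B, hB⟩ := (Set.finite_range fun σ : K →+* ℝ => -σ y).bddAbove
  obtain ⟨t, ht⟩ := exists_nat_gt B
  refine ⟨t, fun σ => ?_⟩
  have h1 : -σ y ≤ B := hB ⟨σ, rfl⟩
  have h2 : (t : ℝ) ≤ ((t * m : ℕ) : ℝ) := by exact_mod_cast Nat.le_mul_of_pos_right t hm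
  rw [map_add, map_natCast]
  linarith

/-- If all primes not containing `c` have totally positive generators, so have all ideals. -/
theorem hasPosGenerator_of_away {c : 𝓞 K} (hc : c ≠ 0)
    (h : ∀ P : Ideal (𝓞 K), P.IsPrime → P ≠ ⊥ → c ∉ P → HasPosGenerator P)
    {I : Ideal (𝓞 K)} (hI : I ≠ ⊥) : HasPosGenerator I := by
  classical
  refine hasPosGenerator_of_primes hI fun q hq hq0 _ => ?_
  by_cases hcq : c ∉ q
  · exact h q hq hq0 hcq
  push Not at hcq
  have hc' : Ideal.span {c} ≠ ⊥ := by simpa using hc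
  let S := (UniqueFactorizationMonoid.normalizedFactors (Ideal.span {c})).toFinset
  have hS (P : Ideal (𝓞 K)) : P ∈ S ↔ P.IsPrime ∧ P ≠ ⊥ ∧ c ∈ P := by
    rw [Multiset.mem_toFinset, Ideal.mem_normalizedFactors_iff hc',
      Ideal.span_singleton_le_iff_mem]
    refine ⟨fun hP => ⟨hP.1, ?_, hP.2⟩, fun hP => ⟨hP.1, hP.2.2⟩⟩
    rintro rfl
    exact hc (by simpa using hP.2)
  obtain ⟨z, hz, hz'⟩ : ∃ z ∈ q, z ∉ q ^ 2 := by
    have hlt := Ideal.pow_right_strictAnti q hq0 hq.ne_top (show 1 < 2 by norm_num)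
    simp only [pow_one] at hlt
    exact SetLike.exists_of_lt hlt
  -- An element of valuation exactly 1 at `q`, and congruent to 1 at the other primes containing
  -- `c`.
  obtain ⟨y, hy⟩ := IsDedekindDomain.exists_forall_sub_mem_ideal (s := S) (fun P => P)
    (fun _ => 2) (fun P hP => Ideal.prime_of_isPrime ((hS P).1 hP).2.1 ((hS P).1 hP).1)
    (fun P _ P' _ h => h) (fun P => if P.1 = q then z else 1)
  -- Large multiples of this norm make `y` totally positive. They lie in `(c²)`, so the congruences
  -- modulo `P ^ 2` survive for all `P` containing `c`.
  have hm : 0 < Ideal.absNorm (Ideal.span {c ^ 2}) := Nat.pos_of_ne_zero fun h0 => by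
    rw [Ideal.absNorm_eq_zero_iff] at h0
    exact hc (by simpa using h0)
  obtain ⟨t, ht⟩ := exists_nat_totallyPositive_add (y : K) hm
  set n : ℕ := t * Ideal.absNorm (Ideal.span {c ^ 2}) with hn
  have hnc : (n : 𝓞 K) ∈ Ideal.span {c ^ 2} := by
    rw [hn, Nat.cast_mul]
    exact Ideal.mul_mem_left _ _ (Ideal.absNorm_mem _)
  have hnP {P : Ideal (𝓞 K)} (hP : c ∈ P) : (n : 𝓞 K) ∈ P ^ 2 :=
    (Ideal.span_singleton_le_iff_mem _).2 (Ideal.pow_mem_pow hP 2) hnc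
  set x : 𝓞 K := y + n
  have hx : TotallyPositive (x : K) := by
    have : (x : K) = (y : K) + (n : K) := by simp [x]
    rw [this]; exact ht
  have hxP {P : Ideal (𝓞 K)} (hP : P.IsPrime) (hP0 : P ≠ ⊥) (hcP : c ∈ P) :
      x - (if P = q then z else 1) ∈ P ^ 2 := by
    have h1 := hy P ((hS P).2 ⟨hP, hP0, hcP⟩)
    have h2 := add_mem h1 (hnP hcP)
    convert h2 using 1
    simp only [x]; ring
  have hxq := hxP hq hq0 hcq
  rw [if_pos rfl] at hxq
  have hxq1 : x ∈ q := by
    have := add_mem (Ideal.pow_le_self two_ne_zero hxq) hz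
    rwa [sub_add_cancel] at this
  have hxq2 : x ∉ q ^ 2 := fun h0 => hz' (by
    have := sub_mem h0 hxq
    rwa [sub_sub_cancel] at this)
  obtain ⟨b, hb⟩ := Ideal.dvd_span_singleton.2 hxq1
  have hx0 : x ≠ 0 := by rintro h0; rw [h0] at hxq2; exact hxq2 (zero_mem _)
  have hb0 : b ≠ ⊥ := by
    rintro rfl
    rw [Ideal.mul_bot, Ideal.span_singleton_eq_bot] at hb
    exact hx0 hb
  -- The cofactor of `q` in `(x)` involves only primes avoiding `c`: `q` is excluded by `x ∉ q ^ 2`,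
  -- the others by `x ≡ 1`. The generator of `q` is then the quotient `γ` of the totally positive
  -- `x` and `β`.
  obtain ⟨β, hβ, rfl⟩ := hasPosGenerator_of_primes hb0 fun P hP hP0 hPb => h P hP hP0 fun hcP => by
    by_cases hPq : P = q
    · subst hPq
      apply hxq2
      rw [← Ideal.dvd_span_singleton, hb, sq]
      exact mul_dvd_mul_left _ hPb
    · have h1 := hxP hP hP0 hcP
      rw [if_neg hPq] at h1
      have h2 : x ∈ P := by
        rw [← Ideal.dvd_span_singleton, hb]; exact hPb.mul_left _
      have h3 := sub_mem h2 (Ideal.pow_le_self two_ne_zero h1)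
      rw [sub_sub_cancel] at h3
      exact hP.ne_top ((Ideal.eq_top_iff_one _).2 h3)
  have hβx : x ∈ Ideal.span {β} := by
    rw [← Ideal.dvd_span_singleton, hb]; exact dvd_mul_left _ _
  obtain ⟨γ, hγ⟩ := Ideal.mem_span_singleton'.1 hβx
  refine ⟨γ, ?_, ?_⟩
  · rw [← hγ, mul_comm] at hx
    exact TotallyPositive.of_mul_left (x := (β : K)) (y := (γ : K)) hx hβ
  · rw [← hγ, ← Ideal.span_singleton_mul_span_singleton] at hb
    exact mul_right_cancel₀ (b := Ideal.span {β}) hb0 hb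

variable [IsTotallyReal K]

/-- The real embedding that belongs to an infinite place of a totally real field. -/
def realEmb (v : InfinitePlace K) : K →+* ℝ :=
  InfinitePlace.embedding_of_isReal (IsTotallyReal.isReal v)

theorem abs_realEmb (v : InfinitePlace K) (x : K) : |realEmb v x| = v x :=
  InfinitePlace.norm_embedding_of_isReal (IsTotallyReal.isReal v) x

/-- Weak approximation finds `x ∈ K` closer than 1 to the prescribed `±1` at each real place.
Multiplying by the square of a denominator makes it integral without changing signs. -/
theorem exists_signs (s : InfinitePlace K → Bool) :
    ∃ x : 𝓞 K, x ≠ 0 ∧ ∀ v, 0 < realEmb v (x : K) ↔ s v = true := by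
  obtain ⟨x, hx⟩ := (InfinitePlace.denseRange_algebraMap_pi K).exists_dist_lt
    (fun v => algebraMap K (WithAbs v.1) (if s v then 1 else -1)) one_pos
  rw [dist_pi_lt_iff one_pos] at hx
  have h1 (v : InfinitePlace K) : |(if s v then 1 else -1) - realEmb v x| < 1 := by
    have h2 := hx v
    rw [dist_eq_norm, Pi.algebraMap_apply, ← map_sub, WithAbs.norm_eq_apply_ofAbs] at h2
    have h3 : v ((if s v then 1 else -1) - x) < 1 := h2
    rw [← abs_realEmb, map_sub] at h3
    cases h : s v <;> simpa [h] using h3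
  have h2 (v : InfinitePlace K) : 0 < realEmb v x ↔ s v = true := by
    have := abs_lt.1 (h1 v)
    cases h : s v <;> simp only [h, if_true, Bool.false_eq_true, if_false, iff_true,
      iff_false, not_lt] at this ⊢ <;> linarith
  obtain ⟨n, d, hd, rfl⟩ := IsFractionRing.div_surjective (𝓞 K) x
  have hd0 : algebraMap (𝓞 K) K d ≠ 0 := by simpa using nonZeroDivisors.ne_zero hd
  have hpos (v : InfinitePlace K) : 0 < realEmb v (algebraMap (𝓞 K) K d) ^ 2 :=
    sq_pos_of_ne_zero ((map_ne_zero _).2 hd0)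
  have h3 (v : InfinitePlace K) : 0 < realEmb v ((n * d : 𝓞 K) : K) ↔ s v = true := by
    have : ((n * d : 𝓞 K) : K) =
        algebraMap (𝓞 K) K n / algebraMap (𝓞 K) K d * algebraMap (𝓞 K) K d ^ 2 := by
      change algebraMap (𝓞 K) K (n * d) = _
      rw [map_mul]; field_simp
    rw [this, map_mul, map_pow, mul_pos_iff_of_pos_right (hpos v)]
    exact h2 v
  refine ⟨n * d, ?_, h3⟩
  intro h0
  obtain ⟨v⟩ : Nonempty (InfinitePlace K) := inferInstance
  have h4 := abs_lt.1 (h1 v)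
  rcases mul_eq_zero.1 h0 with h | h
  · rw [h, map_zero, zero_div, map_zero] at h4
    cases h5 : s v <;> simp [h5] at h4
  · exact nonZeroDivisors.ne_zero hd h

theorem torsion_eq (ζ : (𝓞 K)ˣ) (hζ : ζ ∈ Units.torsion K) : ζ = 1 ∨ ζ = -1 := by
  obtain ⟨v⟩ : Nonempty (InfinitePlace K) := inferInstance
  obtain ⟨n, hn, h⟩ := isOfFinOrder_iff_pow_eq_one.1 ((CommGroup.mem_torsion _).1 hζ)
  let f : 𝓞 K →+* ℝ := (realEmb v).comp (algebraMap (𝓞 K) K)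
  have hf : Function.Injective f := (realEmb v).injective.comp RingOfIntegers.coe_injective
  have h1 : f ζ ^ n = 1 := by
    rw [← map_pow, ← Units.val_pow_eq_pow_val, h, Units.val_one, map_one]
  have h2 : |f ζ| = 1 := by
    rw [← pow_eq_one_iff_of_nonneg (abs_nonneg _) hn.ne', ← abs_pow, h1, abs_one]
  rcases (abs_eq zero_le_one).1 h2 with h3 | h3
  · left; exact Units.ext (hf (by rw [h3, Units.val_one, map_one]))
  · right; exact Units.ext (hf (by rw [h3, Units.val_neg, Units.val_one, map_neg, map_one]))

/-- In narrow class number one, totally positive units are squares. -/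
theorem exists_sq_of_totallyPositive (hpos : ∀ I : Ideal (𝓞 K), I ≠ ⊥ → HasPosGenerator I)
    (u : (𝓞 K)ˣ) (hu : TotallyPositive (u : K)) : ∃ w : (𝓞 K)ˣ, u = w ^ 2 := by
  classical
  let χ : (𝓞 K)ˣ → InfinitePlace K → Bool := fun u v => decide (0 < realEmb v (u : K))
  have hχ (u w : (𝓞 K)ˣ) : χ (u * w ^ 2) = χ u := by
    funext v
    have h0 : realEmb v (w : K) ≠ 0 := (map_ne_zero _).2 (by simp)
    have h1 : ((u * w ^ 2 : (𝓞 K)ˣ) : K) = (u : K) * (w : K) ^ 2 := by simp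
    simp only [χ, h1, map_mul, map_pow, mul_pos_iff_of_pos_right (sq_pos_of_ne_zero h0)]
  let E := Bool × (Fin (Units.rank K) → Fin 2)
  -- By Dirichlet's theorem, and since the roots of unity are `±1`, these represent all units modulo
  -- squares.
  let g : E → (𝓞 K)ˣ := fun e =>
    (if e.1 then 1 else -1) * ∏ i, Units.fundSystem K i ^ (e.2 i : ℕ)
  have hg (u : (𝓞 K)ˣ) : ∃ (e : E) (w : (𝓞 K)ˣ), u = g e * w ^ 2 := by
    obtain ⟨⟨ζ, k⟩, hk, -⟩ := Units.exist_unique_eq_mul_prod K u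
    have hζ : ∃ ε : Bool, (ζ : (𝓞 K)ˣ) = if ε then 1 else -1 := by
      rcases torsion_eq _ ζ.2 with h | h
      · exact ⟨true, by simpa using h⟩
      · exact ⟨false, by simpa using h⟩
    obtain ⟨ε, hε⟩ := hζ
    refine ⟨(ε, fun i => ⟨(k i % 2).toNat, by omega⟩), ∏ i, Units.fundSystem K i ^ (k i / 2), ?_⟩
    simp only [g, hk, hε, mul_assoc]
    congr 1
    rw [← Finset.prod_pow, ← Finset.prod_mul_distrib]
    refine Finset.prod_congr rfl fun i _ => ?_
    rw [← zpow_natCast, ← zpow_natCast, ← zpow_mul, ← zpow_add]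
    congr 1
    push_cast
    omega
  -- An integer with the prescribed signs differs from a totally positive generator of its ideal by
  -- a unit with these signs.
  have hsurj : Function.Surjective (χ ∘ g) := by
    intro s
    obtain ⟨x, hx0, hx⟩ := exists_signs s
    obtain ⟨y, hy, hxy⟩ := hpos (Ideal.span {x}) (by simpa using hx0)
    obtain ⟨u, hu⟩ := Ideal.span_singleton_eq_span_singleton.1 hxy
    obtain ⟨e, w, hw⟩ := hg u
    refine ⟨e, ?_⟩
    rw [Function.comp_apply, ← hχ (g e) w, ← hw]
    funext v
    have h1 : 0 < realEmb v (y : K) := hy _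
    have h2 : (x : K) = (y : K) * (u : K) := by rw [← hu]; simp
    have h3 := hx v
    rw [h2, map_mul, mul_pos_iff_of_pos_left h1] at h3
    simp only [χ, h3, Bool.decide_eq_true]
  -- The unit rank is one less than the number of infinite places, and the sign `±1` makes up for
  -- it. So the surjection is a bijection, and trivial signs force the trivial class.
  have hcard : Fintype.card E = Fintype.card (InfinitePlace K → Bool) := by
    have : 0 < Fintype.card (InfinitePlace K) := Fintype.card_pos
    have h1 : Fintype.card E = 2 * 2 ^ Units.rank K := by simp [E]
    have h2 : Units.rank K = Fintype.card (InfinitePlace K) - 1 := rfl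
    rw [h1, ← pow_succ', h2, Nat.sub_add_cancel this]
    simp
  have hinj := ((Fintype.bijective_iff_surjective_and_card _).2 ⟨hsurj, hcard⟩).1
  obtain ⟨e, w, hw⟩ := hg u
  have h1 : (χ ∘ g) e = (χ ∘ g) (true, fun _ => 0) := by
    rw [Function.comp_apply, ← hχ (g e) w, ← hw]
    funext v
    have h2 : 0 < realEmb v (u : K) := hu _
    simp [χ, g, h2]
  refine ⟨w, ?_⟩
  rw [hw, hinj h1]
  simp [g]

end TotallyPositive
end QuatOrders

/-! ### The index ideal, and totally positive generators from class number one -/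

namespace QuatOrders
open QuadraticData NumberField

section Index

variable {K : Type*} [Field K] [NumberField K] {V : Type*} [AddCommGroup V] [Module K V]
  [Module (𝓞 K) V] [IsScalarTower (𝓞 K) K V] [Module.Finite K V]
  [IsPrincipalIdealRing (𝓞 K)]

/-- Over a principal ideal ring both lattices are free of the same rank, so a basis of one can be
sent to a basis of the other. -/
theorem exists_equiv_map_eq (L M : Submodule (𝓞 K) V) [hL : Submodule.IsLattice K L]
    [hM : Submodule.IsLattice K M] :
    ∃ f : V ≃ₗ[K] V, L.map (f.toLinearMap.restrictScalars (𝓞 K)) = M := by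
  have hrL : Module.finrank (𝓞 K) L = Module.finrank K V :=
    Module.finrank_eq_of_rank_eq
      ((Submodule.IsLattice.rank' K L).trans (Module.finrank_eq_rank K V).symm)
  have hrM : Module.finrank (𝓞 K) M = Module.finrank K V :=
    Module.finrank_eq_of_rank_eq
      ((Submodule.IsLattice.rank' K M).trans (Module.finrank_eq_rank K V).symm)
  have := Submodule.IsLattice.free K L
  have := Submodule.IsLattice.free K M
  let bL := Module.finBasisOfFinrankEq (𝓞 K) L hrL
  let bM := Module.finBasisOfFinrankEq (𝓞 K) M hrM
  let f := (bL.extendOfIsLattice K).equiv (bM.extendOfIsLattice K) (Equiv.refl _)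
  have hf (i) : f (bL i : V) = bM i := by
    have := (bL.extendOfIsLattice K).equiv_apply i (bM.extendOfIsLattice K) (Equiv.refl _)
    rwa [Module.Basis.extendOfIsLattice_apply, Equiv.refl_apply,
      Module.Basis.extendOfIsLattice_apply] at this
  have hspan {N : Submodule (𝓞 K) V} (b : Module.Basis (Fin (Module.finrank K V)) (𝓞 K) N) :
      N = Submodule.span (𝓞 K) (Set.range fun i => (b i : V)) := by
    have : (Set.range fun i => (b i : V)) = N.subtype '' Set.range b := by
      rw [← Set.range_comp]; rfl
    rw [this, ← Submodule.map_span, b.span_eq, Submodule.map_top, Submodule.range_subtype]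
  refine ⟨f, ?_⟩
  rw [hspan bL, Submodule.map_span, ← Set.range_comp, hspan bM]
  congr 2
  funext i
  exact hf i

/-- In a basis of `L` the matrix of `f` is integral; the adjugate matrix gives the preimages of the
multiples by the determinant. -/
theorem exists_det_eq (L : Submodule (𝓞 K) V) [hL : Submodule.IsLattice K L] (f : V →ₗ[K] V)
    (hf : ∀ x ∈ L, f x ∈ L) :
    ∃ d : 𝓞 K, (d : K) = LinearMap.det f ∧ ∀ x ∈ L, ∃ y ∈ L, f y = (d : K) • x := by
  classical
  have := Submodule.IsLattice.free K L
  let b := Module.Free.chooseBasis (𝓞 K) L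
  let B := b.extendOfIsLattice K
  let g : L →ₗ[𝓞 K] L := (f.restrictScalars (𝓞 K)).restrict hf
  let A := LinearMap.toMatrix b b g
  have hrepr (x : L) (i) : B.repr (x : V) i = algebraMap (𝓞 K) K (b.repr x i) := by
    have h1 : (x : V) = ∑ j, algebraMap (𝓞 K) K (b.repr x j) • B j := by
      conv_lhs => rw [← b.sum_repr x]
      rw [Submodule.coe_sum]
      refine Finset.sum_congr rfl fun j _ => ?_
      rw [algebraMap_smul, Submodule.coe_smul, Module.Basis.extendOfIsLattice_apply]
    rw [h1, B.repr_sum_self]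
  have hA : LinearMap.toMatrix B B f = A.map (algebraMap (𝓞 K) K) := by
    ext i j
    have h1 : A i j = b.repr (g (b j)) i := LinearMap.toMatrix_apply _ _ _ _ _
    have h2 : B j = b j := Module.Basis.extendOfIsLattice_apply _ _ _
    rw [LinearMap.toMatrix_apply, Matrix.map_apply, h1, ← hrepr, h2]
    rfl
  refine ⟨A.det, ?_, fun x hx => ?_⟩
  · rw [← LinearMap.det_toMatrix B f, hA]
    exact RingHom.map_det _ _
  · refine ⟨Matrix.toLin b b A.adjugate ⟨x, hx⟩, Subtype.property _, ?_⟩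
    have h1 : g ∘ₗ Matrix.toLin b b A.adjugate = A.det • LinearMap.id := by
      rw [← Matrix.toLin_toMatrix b b g, ← Matrix.toLin_mul, Matrix.mul_adjugate, map_smul,
        Matrix.toLin_one]
    refine (congrArg Subtype.val (LinearMap.congr_fun h1 ⟨x, hx⟩)).trans ?_
    exact (algebraMap_smul K A.det x).symm

end Index

section ClassNumber

variable {K : Type*} [Field K] [NumberField K] [IsTotallyReal K] {a b : K}
  {G H : Subalgebra (𝓞 K) ℍ[K,a,b]}

theorem DefiniteData.exists_nm_eq {O R : Type*} [CommRing O] [IsDedekindDomain O]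
    [Module.Free ℤ O] [Module.Finite ℤ O] [Ring R] [Algebra O R] (Q : DefiniteData O R)
    {q : Ideal O} (hq0 : q ≠ ⊥) [hq : q.IsMaximal] (hP : PrincipalAt R q) :
    ∃ y, Ideal.span {Q.nm y} = q := by
  by_cases hD : Q.DiscLE q
  · obtain ⟨y, hy, -⟩ := Q.exists_generator_of_discLE hq0 hP hD
    exact ⟨y, hy⟩
  · obtain ⟨I, hI⟩ := Q.exists_isMid hq0 hP hD
    obtain ⟨y, -, hy⟩ := hI.exists_generator Q hq0 hP
    exact ⟨y, hy⟩

/-- At a prime not containing a common denominator `c`, ideals of `H` are principal, and some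
element has a norm generating the prime. Definiteness makes this norm totally positive; the
remaining primes follow from these. -/
theorem hasPosGenerator_of_classNumber (hdef : IsDefinite a b) (hH : IsMaximalOrder H)
    (hG : IsOrder G) (hGH : G ≤ H) (hcls : classNumber G = 1) {I : Ideal (𝓞 K)} (hI : I ≠ ⊥) :
    HasPosGenerator I := by
  have hHo : IsOrder H := hH.1
  obtain ⟨c, hc0, hc⟩ := exists_conductor hG hHo
  refine hasPosGenerator_of_away hc0 (fun P hP hP0 hcP => ?_) hI
  have hPm := hP.isMaximal hP0
  have hcop : IsCoprime P (Ideal.span {c}) := by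
    rw [Ideal.isCoprime_iff_sup_eq]
    exact hPm.1.2 _ (left_lt_sup.2 fun h => hcP (h (Ideal.mem_span_singleton_self c)))
  have hPr : PrincipalAt H P := by
    refine principalAt_of_classNumber hH hG hGH hcls (f := Ideal.span {c}) ?_ hP0 hcop
    intro r hr x hx
    obtain ⟨s, rfl⟩ := Ideal.mem_span_singleton'.1 hr
    rw [map_mul, mul_assoc]
    exact G.mul_mem (G.algebraMap_mem s) (hc x hx)
  obtain ⟨y, hy⟩ := (hHo.data hdef).exists_nm_eq hP0 hPr
  refine ⟨_, ?_, hy⟩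
  rw [hHo.coe_nm]
  apply hdef
  intro h0
  apply hP0
  rw [← hy, Ideal.span_singleton_eq_bot]
  have : y = 0 := Subtype.ext h0
  rw [this]
  exact (hHo.data hdef).nm_zero

theorem isPrincipalIdealRing_of_hasPosGenerator
    (h : ∀ I : Ideal (𝓞 K), I ≠ ⊥ → HasPosGenerator I) : IsPrincipalIdealRing (𝓞 K) := by
  refine ⟨fun I => ?_⟩
  by_cases hI : I = ⊥
  · rw [hI]; infer_instance
  · obtain ⟨r, -, hr⟩ := h I hI
    exact ⟨r, hr.symm⟩

/-- The index ideal annihilates `H / G`, and its absolute norm is the group index. -/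
theorem HasIndex.conductor_and_index [IsPrincipalIdealRing (𝓞 K)] (hG : IsOrder G)
    (hH : IsOrder H) (hGH : G ≤ H) {I : Ideal (𝓞 K)} (hI : HasIndex H G I) :
    (∀ r ∈ I, ∀ x ∈ H, algebraMap (𝓞 K) ℍ[K,a,b] r * x ∈ G) ∧
      (Subalgebra.toSubmodule G).toAddSubgroup.relIndex (Subalgebra.toSubmodule H).toAddSubgroup =
        Ideal.absNorm I := by
  have hLG : Submodule.IsLattice K (Subalgebra.toSubmodule G) := hG
  have hLH : Submodule.IsLattice K (Subalgebra.toSubmodule H) := hH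
  obtain ⟨f, hf⟩ := exists_equiv_map_eq (K := K) (Subalgebra.toSubmodule H)
    (Subalgebra.toSubmodule G)
  have hfG : ∀ x ∈ H, f x ∈ G := fun x hx => by
    have : f x ∈ Subalgebra.toSubmodule G := hf ▸ ⟨x, hx, rfl⟩
    exact this
  obtain ⟨d, hd, hd'⟩ := exists_det_eq (K := K) (Subalgebra.toSubmodule H) f.toLinearMap
    fun x hx => hGH (hfG x hx)
  have hspan : I = Ideal.span {d} := by
    apply IsFractionRing.coeSubmodule_injective (𝓞 K) K
    rw [← hI, IsLocalization.coeSubmodule_span_singleton]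
    refine le_antisymm (Submodule.span_le.2 ?_)
      (Submodule.span_mono (Set.singleton_subset_iff.2 ⟨f.toLinearMap, hfG, hd⟩))
    -- Composing with the inverse of `f` yields an endomorphism of `H`, whose determinant is
    -- integral. Thus the determinant of `f` alone generates the index ideal.
    rintro _ ⟨δ, hδ, rfl⟩
    obtain ⟨c, hc, -⟩ := exists_det_eq (K := K) (Subalgebra.toSubmodule H)
      (f.symm.toLinearMap ∘ₗ δ) fun x hx => by
        obtain ⟨y, hy, h⟩ : δ x ∈ (Subalgebra.toSubmodule H).map
            (f.toLinearMap.restrictScalars (𝓞 K)) := hf ▸ hδ x hx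
        have : f.symm (δ x) = y := by rw [← h]; exact f.symm_apply_apply y
        rw [LinearMap.comp_apply]
        exact this.symm ▸ hy
    have hdet : LinearMap.det δ = LinearMap.det f.toLinearMap * (c : K) := by
      rw [hc, ← LinearMap.det_comp]
      congr 1
      ext1 x
      simp
    refine Submodule.mem_span_singleton.2 ⟨c, ?_⟩
    rw [hdet, ← hd, Algebra.smul_def, mul_comm]
  refine ⟨fun r hr x hx => ?_, ?_⟩
  · rw [hspan] at hr
    obtain ⟨s, rfl⟩ := Ideal.mem_span_singleton'.1 hr
    obtain ⟨y, hy, h⟩ := hd' x hx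
    have h2 : algebraMap (𝓞 K) ℍ[K,a,b] d * x = f y :=
      (Algebra.smul_def (d : K) x).symm.trans h.symm
    rw [map_mul, mul_assoc, h2]
    exact G.mul_mem (G.algebraMap_mem s) (hfG y hy)
  · have h0 : LinearMap.det f.toLinearMap ≠ 0 := f.isUnit_det'.ne_zero
    have h1 := relIndex_map_eq (Subalgebra.toSubmodule H) f.toLinearMap h0
      fun x hx => hGH (hfG x hx)
    rw [← hd, norm_abs_eq_absNorm, ← hspan] at h1
    have h2 : (Subalgebra.toSubmodule G).toAddSubgroup =
        (Subalgebra.toSubmodule H).toAddSubgroup.map f.toLinearMap.toAddMonoidHom := by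
      rw [← hf]; rfl
    rw [h2]
    exact_mod_cast h1

end ClassNumber
end QuatOrders

/-! ### Perceptive suborders: the quotient by the radical has no zero divisors -/

namespace QuatOrders
namespace DefiniteData
open QuadraticData

variable {O R : Type*} [CommRing O] [IsDedekindDomain O] [Module.Free ℤ O] [Module.Finite ℤ O]
  [Ring R] [Algebra O R]

theorem mem_ext_span {ϖ : O} {x : R} :
    x ∈ ext R (Ideal.span {ϖ}) ↔ ∃ z, x = algebraMap O R ϖ * z := by
  constructor
  · intro hx
    refine ext_induction (P := fun x => ∃ z, x = algebraMap O R ϖ * z) ⟨0, by simp⟩ ?_ ?_ hx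
    · rintro x y - - ⟨z, rfl⟩ ⟨w, rfl⟩
      exact ⟨z + w, by rw [mul_add]⟩
    · intro r hr x
      obtain ⟨s, rfl⟩ := Ideal.mem_span_singleton.1 hr
      exact ⟨algebraMap O R s * x, by rw [map_mul, mul_assoc]⟩
  · rintro ⟨z, rfl⟩
    exact algebraMap_mul_mem_ext (Ideal.mem_span_singleton_self ϖ) z

/-- A suborder `S` of `R` that contains `ϖ² R`, meets all orbits of the elements of norm one,
and has index `N(ϖ)²`, where `R` is ramified and maximal at `ϖ`. -/
structure IsPerceptiveAt (Q : DefiniteData O R) (ϖ : O) (S : Subalgebra O R) : Prop where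
  prime : Prime ϖ
  discLE : Q.DiscLE (Ideal.span {ϖ})
  perceptive : ∀ x, ∃ u, Q.nm u = 1 ∧ u * x ∈ S
  conductor : ∀ x, algebraMap O R (ϖ ^ 2) * x ∈ S
  index : (Subalgebra.toSubmodule S).toAddSubgroup.index = Ideal.absNorm (Ideal.span {ϖ}) ^ 2
  maximal : ∀ x, (∀ y ∈ Q.radical (Ideal.span {ϖ}), ∃ w ∈ Q.radical (Ideal.span {ϖ}),
    y * x = algebraMap O R ϖ * w) → ∃ w, x = algebraMap O R ϖ * w

namespace IsPerceptiveAt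

variable {Q : DefiniteData O R} {ϖ : O} {S : Subalgebra O R} (hS : Q.IsPerceptiveAt ϖ S)
include hS

theorem span_ne_bot : Ideal.span {ϖ} ≠ ⊥ := by
  simpa using hS.prime.ne_zero

theorem isPrime : (Ideal.span {ϖ}).IsPrime :=
  (Ideal.span_singleton_prime hS.prime.ne_zero).2 hS.prime

theorem isMaximal : (Ideal.span {ϖ}).IsMaximal := hS.isPrime.isMaximal hS.span_ne_bot

theorem one_lt_norm : 1 < Ideal.absNorm (Ideal.span {ϖ}) :=
  have := hS.isPrime
  one_lt_absNorm hS.span_ne_bot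

theorem card_quot_ext : Nat.card (R ⧸ ext R (Ideal.span {ϖ})) =
    Ideal.absNorm (Ideal.span {ϖ}) ^ 4 := by
  have h : ext R (Ideal.span {ϖ}) = Ideal.span {algebraMap O R ϖ} := by
    ext x
    rw [mem_ext_span, Ideal.mem_span_singleton']
    exact ⟨fun ⟨z, hz⟩ => ⟨z, by rw [hz, Algebra.commutes]⟩,
      fun ⟨z, hz⟩ => ⟨z, by rw [← hz, Algebra.commutes]⟩⟩
  rw [h, Q.card_quot _ (by rw [Q.nm_algebraMap]; exact pow_ne_zero 2 hS.prime.ne_zero),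
    Q.nm_algebraMap, ← Ideal.span_singleton_pow, map_pow, ← pow_mul]

theorem finite_quot : Finite (R ⧸ ext R (Ideal.span {ϖ})) := Nat.finite_of_card_ne_zero <| by
  rw [hS.card_quot_ext]
  exact (pow_pos (absNorm_pos hS.span_ne_bot) _).ne'

theorem ne_top : S ≠ ⊤ := by
  rintro rfl
  have h := hS.index
  have h1 : (Subalgebra.toSubmodule (⊤ : Subalgebra O R)).toAddSubgroup = ⊤ := rfl
  rw [h1, AddSubgroup.index_top] at h
  have := hS.one_lt_norm
  nlinarith

/-- A perceptive suborder is determined by its image modulo the radical. -/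
theorem eq_top_of_add_radical
    (h : ∀ x, ∃ s ∈ S, x - s ∈ Q.radical (Ideal.span {ϖ})) : S = ⊤ := by
  have := hS.finite_quot
  let B := R ⧸ ext R (Ideal.span {ϖ})
  let mk := Ideal.Quotient.mk (ext R (Ideal.span {ϖ}))
  -- Elements of the radical square to zero modulo `ϖ`, so `1 + y x` has the inverse `1 - y x`.
  have hJ : ∀ x ∈ Q.radical (Ideal.span {ϖ}), mk x ∈ Ring.jacobson B := by
    intro x hx
    rw [← Ideal.jacobson_bot, Ideal.mem_jacobson_iff]
    intro y
    obtain ⟨y, rfl⟩ := Ideal.Quotient.mk_surjective y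
    have h1 : y * x * (y * x) ∈ ext R (Ideal.span {ϖ}) :=
      Q.mul_self_mem_of_mem_radical (Ideal.mul_mem_left _ y hx)
    have h2 : mk (y * x * (y * x)) = 0 := Ideal.Quotient.eq_zero_iff_mem.2 h1
    refine ⟨mk (1 - y * x), ?_⟩
    rw [Ideal.mem_bot, ← neg_eq_zero, ← h2, ← map_mul, ← map_mul, ← map_add,
      ← map_one mk, ← map_sub, ← map_neg]
    congr 1
    noncomm_ring
  have key (n : ℕ) : ∀ x, ∃ s ∈ S, mk (x - s) ∈ Ring.jacobson B ^ (n + 1) := by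
    induction n with
    | zero =>
      intro x
      obtain ⟨s, hs, hx⟩ := h x
      exact ⟨s, hs, by rw [zero_add, Submodule.pow_one]; exact hJ _ hx⟩
    | succ n ih =>
      intro x
      obtain ⟨s, hs, hx⟩ := ih x
      obtain ⟨u, hu, hus⟩ := hS.perceptive (x - s)
      obtain ⟨g, hg, hj⟩ := h (Q.conj u)
      refine ⟨s + g * (u * (x - s)), add_mem hs (mul_mem hg hus), ?_⟩
      -- Since `ū u = 1`, the error `x - s` equals `ū (u (x - s))`, where `u (x - s)` lies in `S`.
      -- Replacing `ū` by an approximation `g ∈ S` leaves an error one power deeper in the Jacobson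
      -- radical, which is nilpotent.
      have h1 : x - (s + g * (u * (x - s))) = (Q.conj u - g) * (u * (x - s)) := by
        have h2 : Q.conj u * (u * (x - s)) = x - s := by
          rw [← mul_assoc, Q.conj_mul_self, hu, map_one, one_mul]
        rw [sub_mul, h2, sub_sub]
      rw [h1, map_mul, map_mul, add_comm, Submodule.pow_add _ n.succ_ne_zero,
        Submodule.pow_one]
      exact Ideal.mul_mem_mul (hJ _ hj) (Ideal.mul_mem_left _ _ hx)
  obtain ⟨k, hk⟩ := IsSemiprimaryRing.isNilpotent (R := B)
  have hSI (x : R) : ∃ s ∈ S, x - s ∈ ext R (Ideal.span {ϖ}) := by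
    obtain ⟨s, hs, hx⟩ := key k x
    refine ⟨s, hs, Ideal.Quotient.eq_zero_iff_mem.1 ?_⟩
    rw [Submodule.pow_succ, hk] at hx
    simpa using hx
  rw [eq_top_iff]
  intro x _
  obtain ⟨s, hs, hx⟩ := hSI x
  obtain ⟨y, hy⟩ := mem_ext_span.1 hx
  obtain ⟨t, ht, hyt⟩ := hSI y
  obtain ⟨z, hz⟩ := mem_ext_span.1 hyt
  -- Approximating modulo `ϖ` twice leaves an error in `ϖ² R`, which is contained in `S`.
  have : x = s + (algebraMap O R ϖ * t + algebraMap O R (ϖ ^ 2) * z) := by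
    rw [map_pow, sq, mul_assoc, ← hz, ← mul_add, add_sub_cancel, ← hy, add_sub_cancel]
  rw [this]
  exact add_mem hs (add_mem (mul_mem (S.algebraMap_mem ϖ) ht) (hS.conductor z))

/-- A counterexample yields a nontrivial idempotent `e` modulo the radical. Perceptivity gives a
unit `u` with `u e ∈ S`, and a power of `u e` is congruent to `e`. As `e` and `1 - e` span the
quotient, `S` would map onto it and be all of `R`. -/
theorem mem_radical_of_nm {x : R} (hx : Q.nm x ∈ Ideal.span {ϖ}) :
    x ∈ Q.radical (Ideal.span {ϖ}) := by
  by_contra hx'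
  have := hS.isMaximal
  have := hS.finite_quot
  have := finite_quot_of_le (Q.ext_le_radical (q := Ideal.span {ϖ}))
  obtain ⟨r, hr⟩ := hS.discLE.exists_isIdem hx' hx
  set e := algebraMap O R r * x
  obtain ⟨u, hu, hue⟩ := hS.perceptive e
  let C := R ⧸ Q.radical (Ideal.span {ϖ})
  let mk := Ideal.Quotient.mk (Q.radical (Ideal.span {ϖ}))
  have hcomm : Commute (mk u) (mk e) := by
    rw [commute_iff_eq, ← map_mul, ← map_mul, Ideal.Quotient.eq]
    exact hS.discLE.commutator_mem u e
  have h1 : u * Q.conj u = 1 := by rw [Q.mul_conj, hu, map_one]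
  have h2 : Q.conj u * u = 1 := by rw [Q.conj_mul_self, hu, map_one]
  let v : Cˣ := ⟨mk u, mk (Q.conj u), by rw [← map_mul, h1, map_one], by
    rw [← map_mul, h2, map_one]⟩
  have hv : mk u ^ Nat.card Cˣ = 1 := by
    have h3 := congrArg Units.val (pow_card_eq_one' (x := v))
    rwa [Units.val_pow_eq_pow_val, Units.val_one] at h3
  have he : IsIdempotentElem (mk e) := by
    rw [IsIdempotentElem, ← map_mul, Ideal.Quotient.eq]
    exact hr.mul_self
  obtain ⟨k, hk⟩ := Nat.exists_eq_succ_of_ne_zero (Nat.card_pos (α := Cˣ)).ne'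
  -- The quotient is commutative, so the power acts separately on `u` and `e`; the exponent kills
  -- the unit and is positive, so it fixes the idempotent.
  have hpow : e - (u * e) ^ Nat.card Cˣ ∈ Q.radical (Ideal.span {ϖ}) := by
    rw [← Ideal.Quotient.eq]
    change mk e = mk _
    have h3 : mk ((u * e) ^ Nat.card Cˣ) = (mk u * mk e) ^ Nat.card Cˣ := by
      rw [map_pow, map_mul mk u e]
    rw [h3, hcomm.mul_pow, hv, one_mul, hk, Nat.succ_eq_add_one, he.pow_succ_eq]
  refine hS.ne_top (hS.eq_top_of_add_radical fun z => ?_)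
  obtain ⟨c, d, hcd⟩ := hr.span hS.discLE z
  have hmem := pow_mem hue (Nat.card Cˣ)
  set g := (u * e) ^ Nat.card Cˣ
  refine ⟨algebraMap O R c * g + algebraMap O R d * (1 - g),
    add_mem (mul_mem (S.algebraMap_mem c) hmem)
      (mul_mem (S.algebraMap_mem d) (sub_mem (one_mem S) hmem)), ?_⟩
  have : z - (algebraMap O R c * g + algebraMap O R d * (1 - g)) =
      (z - (algebraMap O R c * e + algebraMap O R d * (1 - e))) +
        (algebraMap O R c * (e - g) - algebraMap O R d * (e - g)) := by noncomm_ring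
  rw [this]
  exact add_mem hcd (sub_mem (Ideal.mul_mem_left _ _ hpow) (Ideal.mul_mem_left _ _ hpow))

theorem nm_mem_iff {x : R} : Q.nm x ∈ Ideal.span {ϖ} ↔ x ∈ Q.radical (Ideal.span {ϖ}) :=
  ⟨hS.mem_radical_of_nm, fun h => h.1⟩

end IsPerceptiveAt
end DefiniteData
end QuatOrders

/-! ### Indices and valuations at the distinguished prime -/

namespace QuatOrders
namespace DefiniteData
open QuadraticData

theorem eq_and_eq_of_mul_le_sq {x y n : ℕ} (hn : 0 < n) (hx : n ≤ x) (hy : n ≤ y)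
    (h : x * y ≤ n ^ 2) : x = n ∧ y = n := by
  constructor <;> by_contra hne
  · have : n + 1 ≤ x := by omega
    nlinarith [Nat.mul_le_mul this hy]
  · have : n + 1 ≤ y := by omega
    nlinarith [Nat.mul_le_mul hx this]

variable {O R : Type*} [CommRing O] [IsDedekindDomain O] [Module.Free ℤ O] [Module.Finite ℤ O]
  [Ring R] [Algebra O R]

/-- The map `r ↦ r b` embeds `O/q` into the quotient: its kernel contains the maximal ideal `q` and
is proper. -/
theorem absNorm_le_relIndex {q : Ideal O} [hq : q.IsMaximal] {A B : AddSubgroup R}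
    (hA : ∀ r : O, ∀ x ∈ A, algebraMap O R r * x ∈ A) {b : R}
    (hb : ∀ r : O, algebraMap O R r * b ∈ B) (hbA : b ∉ A)
    (hqb : ∀ r ∈ q, algebraMap O R r * b ∈ A) (h0 : A.relIndex B ≠ 0) :
    Ideal.absNorm q ≤ A.relIndex B := by
  let g : O →+ B ⧸ A.addSubgroupOf B := (QuotientAddGroup.mk' _).comp
    { toFun := fun r => ⟨algebraMap O R r * b, hb r⟩
      map_zero' := by ext; simp
      map_add' := fun r s => by ext; simp [add_mul] }
  have hg (r : O) : r ∈ g.ker ↔ algebraMap O R r * b ∈ A :=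
    (QuotientAddGroup.eq_zero_iff (N := A.addSubgroupOf B) _).trans AddSubgroup.mem_addSubgroupOf
  have hker : g.ker = q.toAddSubgroup := by
    ext r
    rw [hg]
    refine ⟨fun h => ?_, hqb r⟩
    by_contra hr
    obtain ⟨s, i, hi, hs⟩ := hq.exists_inv hr
    apply hbA
    rw [← one_mul b, ← map_one (algebraMap O R), ← hs, map_add, map_mul, add_mul, mul_assoc]
    exact add_mem (hA _ _ h) (hqb i hi)
  have h1 : g.ker.index = Ideal.absNorm q := by rw [hker]; rfl
  have : Finite (B ⧸ A.addSubgroupOf B) := Nat.finite_of_card_ne_zero h0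
  rw [← h1, AddSubgroup.index_ker]
  exact Nat.card_le_card_of_injective _ Subtype.val_injective

namespace IsPerceptiveAt

variable {Q : DefiniteData O R} {ϖ : O} {S : Subalgebra O R}

/-- The subalgebra `S + J`, with `J` the radical at `ϖ`. -/
def addRadical (Q : DefiniteData O R) (ϖ : O) (S : Subalgebra O R) : Subalgebra O R where
  carrier := {x | ∃ s ∈ S, x - s ∈ Q.radical (Ideal.span {ϖ})}
  mul_mem' := by
    rintro x y ⟨s, hs, hx⟩ ⟨t, ht, hy⟩
    refine ⟨s * t, mul_mem hs ht, ?_⟩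
    have : x * y - s * t = (x - s) * y + s * (y - t) := by noncomm_ring
    rw [this]
    exact add_mem (Ideal.mul_mem_right _ _ hx) (Ideal.mul_mem_left _ _ hy)
  add_mem' := by
    rintro x y ⟨s, hs, hx⟩ ⟨t, ht, hy⟩
    exact ⟨s + t, add_mem hs ht, by rw [add_sub_add_comm]; exact add_mem hx hy⟩
  algebraMap_mem' r := ⟨_, S.algebraMap_mem r, by simp⟩

theorem le_addRadical : S ≤ addRadical Q ϖ S := fun x hx => ⟨x, hx, by simp⟩

theorem radical_le_addRadical {x : R} (hx : x ∈ Q.radical (Ideal.span {ϖ})) :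
    x ∈ addRadical Q ϖ S := ⟨0, zero_mem S, by simpa using hx⟩

/-- The additive group of a subalgebra. -/
abbrev add (S : Subalgebra O R) : AddSubgroup R := (Subalgebra.toSubmodule S).toAddSubgroup

theorem mem_add {S : Subalgebra O R} {x : R} : x ∈ add S ↔ x ∈ S := Iff.rfl

theorem add_addRadical :
    add (addRadical Q ϖ S) = add S ⊔ (Q.radical (Ideal.span {ϖ})).toAddSubgroup := by
  ext x
  rw [mem_add, AddSubgroup.mem_sup]
  constructor
  · rintro ⟨s, hs, hx⟩
    exact ⟨s, hs, x - s, hx, by abel⟩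
  · rintro ⟨s, hs, j, hj, rfl⟩
    exact ⟨s, hs, by rw [add_sub_cancel_left]; exact hj⟩

variable (hS : Q.IsPerceptiveAt ϖ S)
include hS

/-- In the chain `J < S + J < R` both inclusions are strict, the first because of 1, the second
because otherwise `S = R`. Each step has index at least `N`, and the total is at most `N²`. -/
theorem index_facts :
    (Q.radical (Ideal.span {ϖ})).toAddSubgroup.index = Ideal.absNorm (Ideal.span {ϖ}) ^ 2 ∧
    (add (addRadical Q ϖ S)).index = Ideal.absNorm (Ideal.span {ϖ}) := by
  have := hS.isMaximal
  have := hS.finite_quot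
  have := finite_quot_of_le (Q.ext_le_radical (q := Ideal.span {ϖ}))
  have hN := hS.one_lt_norm
  have : Finite (O ⧸ Ideal.span {ϖ}) :=
    Ideal.finiteQuotientOfFreeOfNeBot (Ideal.span {ϖ}) hS.span_ne_bot
  have h1 : (Q.radical (Ideal.span {ϖ})).toAddSubgroup.index ≤
      Ideal.absNorm (Ideal.span {ϖ}) ^ 2 := hS.discLE.card_le
  have h10 : (Q.radical (Ideal.span {ϖ})).toAddSubgroup.index ≠ 0 :=
    (Nat.card_pos (α := R ⧸ Q.radical (Ideal.span {ϖ}))).ne'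
  have hle : (Q.radical (Ideal.span {ϖ})).toAddSubgroup ≤ add (addRadical Q ϖ S) :=
    fun x hx => radical_le_addRadical hx
  have h2 := AddSubgroup.relIndex_mul_index hle
  have h3 : Ideal.absNorm (Ideal.span {ϖ}) ≤
      (Q.radical (Ideal.span {ϖ})).toAddSubgroup.relIndex (add (addRadical Q ϖ S)) := by
    refine absNorm_le_relIndex (b := 1) (fun r x hx => Ideal.mul_mem_left _ _ hx)
      (fun r => by rw [mul_one]; exact Subalgebra.algebraMap_mem _ r)
      (fun h => Q.radical_ne_top ((Ideal.eq_top_iff_one _).2 h))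
      (fun r hr => by rw [mul_one]; exact Q.algebraMap_mem_radical hr) (fun h => ?_)
    rw [h, zero_mul] at h2
    exact h10 h2.symm
  obtain ⟨b, hb⟩ : ∃ b, b ∉ addRadical Q ϖ S := by
    by_contra! hb
    exact hS.ne_top (hS.eq_top_of_add_radical hb)
  have h4 : Ideal.absNorm (Ideal.span {ϖ}) ≤ (add (addRadical Q ϖ S)).index := by
    rw [← AddSubgroup.relIndex_top_right]
    refine absNorm_le_relIndex (b := b)
      (fun r x hx => (addRadical Q ϖ S).mul_mem (Subalgebra.algebraMap_mem _ r) hx)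
      (fun r => trivial) hb
      (fun r hr => radical_le_addRadical (Ideal.mul_mem_right _ _ (Q.algebraMap_mem_radical hr)))
      (fun h => ?_)
    rw [AddSubgroup.relIndex_top_right] at h
    rw [h, mul_zero] at h2
    exact h10 h2.symm
  obtain ⟨h5, h6⟩ := eq_and_eq_of_mul_le_sq (by omega) h3 h4 (h2.le.trans h1)
  rw [h5, h6, ← sq] at h2
  exact ⟨h2.symm, h6⟩

theorem relIndex_radical :
    (add S).relIndex (Q.radical (Ideal.span {ϖ})).toAddSubgroup =
      Ideal.absNorm (Ideal.span {ϖ}) := by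
  have h1 := AddSubgroup.relIndex_mul_index
    (show add S ≤ add (addRadical Q ϖ S) from fun x hx => le_addRadical hx)
  rw [hS.index_facts.2, add_addRadical, AddSubgroup.relIndex_sup_left, hS.index, sq] at h1
  exact Nat.eq_of_mul_eq_mul_right (absNorm_pos hS.span_ne_bot) h1

theorem ext_relIndex_radical : (ext R (Ideal.span {ϖ})).toAddSubgroup.relIndex
    (Q.radical (Ideal.span {ϖ})).toAddSubgroup = Ideal.absNorm (Ideal.span {ϖ}) ^ 2 := by
  have h1 := AddSubgroup.relIndex_mul_index
    (show (ext R (Ideal.span {ϖ})).toAddSubgroup ≤ (Q.radical (Ideal.span {ϖ})).toAddSubgroup from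
      fun x hx => Q.ext_le_radical hx)
  have h2 : (ext R (Ideal.span {ϖ})).toAddSubgroup.index = Ideal.absNorm (Ideal.span {ϖ}) ^ 4 :=
    hS.card_quot_ext
  rw [hS.index_facts.1, h2, show 4 = 2 + 2 from rfl, pow_add] at h1
  exact Nat.eq_of_mul_eq_mul_right (pow_pos (absNorm_pos hS.span_ne_bot) 2) h1

theorem exists_mem_radical_notMem_ext :
    ∃ x ∈ Q.radical (Ideal.span {ϖ}), x ∉ ext R (Ideal.span {ϖ}) := by
  by_contra! h
  have h1 := hS.ext_relIndex_radical
  rw [AddSubgroup.relIndex_eq_one.2 (show (Q.radical (Ideal.span {ϖ})).toAddSubgroup ≤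
    (ext R (Ideal.span {ϖ})).toAddSubgroup from h)] at h1
  have := hS.one_lt_norm
  nlinarith

/-- For `x` in the radical, but not in `ϖ R`: the radical annihilates `x` modulo `ϖ`,
and `R x + ϖ R` is the radical. -/
theorem mul_mem_ext_and_exists {x : R} (hx : x ∈ Q.radical (Ideal.span {ϖ}))
    (hx' : x ∉ ext R (Ideal.span {ϖ})) :
    (∀ y ∈ Q.radical (Ideal.span {ϖ}), y * x ∈ ext R (Ideal.span {ϖ})) ∧
      ∀ y ∈ Q.radical (Ideal.span {ϖ}), ∃ r, y - r * x ∈ ext R (Ideal.span {ϖ}) := by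
  have hmax := hS.isMaximal
  have := hS.finite_quot
  let I := (ext R (Ideal.span {ϖ})).toAddSubgroup
  let J := (Q.radical (Ideal.span {ϖ})).toAddSubgroup
  let f : R →+ R ⧸ I := (QuotientAddGroup.mk' I).comp (AddMonoidHom.mulRight x)
  have hf (r : R) : r ∈ f.ker ↔ r * x ∈ ext R (Ideal.span {ϖ}) :=
    QuotientAddGroup.eq_zero_iff (N := I) (r * x)
  -- If `r` is outside the radical, its norm is invertible modulo `ϖ`, and `r x ≡ 0` would give `x ≡
  -- 0`.
  have hker : f.ker ≤ J := by
    intro r hr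
    rw [hf] at hr
    by_contra hrJ
    obtain ⟨s, i, hi, hs⟩ := hmax.exists_inv (mt hS.nm_mem_iff.1 hrJ)
    apply hx'
    rw [← one_mul x, ← map_one (algebraMap O R), ← hs, map_add, map_mul, add_mul,
      ← Q.conj_mul_self, mul_assoc, mul_assoc]
    exact add_mem (Ideal.mul_mem_left _ _ (Ideal.mul_mem_left _ _ hr))
      (algebraMap_mul_mem_ext hi x)
  have hrange : f.range ≤ J.map (QuotientAddGroup.mk' I) := by
    rintro _ ⟨r, rfl⟩
    exact ⟨r * x, Ideal.mul_mem_left _ _ hx, rfl⟩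
  have h1 : f.ker.relIndex J * J.index = f.ker.index := AddSubgroup.relIndex_mul_index hker
  have h2 : Nat.card (J.map (QuotientAddGroup.mk' I)) = J.index := by
    rw [← AddSubgroup.relIndex_ker, QuotientAddGroup.ker_mk', hS.ext_relIndex_radical,
      hS.index_facts.1]
  have hpos : 0 < J.index := by
    rw [hS.index_facts.1]; exact pow_pos (absNorm_pos hS.span_ne_bot) 2
  have hfin : Finite (J.map (QuotientAddGroup.mk' I)) :=
    Nat.finite_of_card_ne_zero (by rw [h2]; exact hpos.ne')
  have h3 : Nat.card f.range ≤ J.index := by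
    rw [← h2]
    exact Nat.card_le_card_of_injective _ (AddSubgroup.inclusion_injective hrange)
  rw [← AddSubgroup.index_ker] at h3
  -- The range lies in `J/ϖR`, which has `N²` elements, as many as `R/J`. So the kernel, contained
  -- in `J`, cannot be smaller than `J`, and the range is everything.
  have h4 : f.ker.relIndex J = 1 := by
    have h5 : f.ker.relIndex J ≤ 1 := by
      by_contra h6
      have : 2 ≤ f.ker.relIndex J := by omega
      nlinarith
    have h6 : f.ker.index ≠ 0 := by
      have : Finite (R ⧸ I) := ‹Finite (R ⧸ ext R (Ideal.span {ϖ}))›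
      have : Finite f.range := inferInstance
      rw [AddSubgroup.index_ker]
      exact Nat.card_pos.ne'
    have h7 : f.ker.relIndex J ≠ 0 := fun h => h6 (by rw [← h1, h, zero_mul])
    omega
  constructor
  · intro y hy
    exact (hf y).1 (AddSubgroup.relIndex_eq_one.1 h4 hy)
  · have h5 : f.range = J.map (QuotientAddGroup.mk' I) := by
      refine AddSubgroup.eq_of_le_of_card_ge hrange ?_
      rw [h2, ← AddSubgroup.index_ker, ← h1, h4, one_mul]
    intro y hy
    obtain ⟨r, hr⟩ : QuotientAddGroup.mk' I y ∈ f.range := h5 ▸ ⟨y, hy, rfl⟩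
    exact ⟨r, by
      have := (QuotientAddGroup.eq (s := I)).1 hr
      rwa [neg_add_eq_sub] at this⟩

theorem mul_mem_ext {x y : R} (hx : x ∈ Q.radical (Ideal.span {ϖ}))
    (hy : y ∈ Q.radical (Ideal.span {ϖ})) : x * y ∈ ext R (Ideal.span {ϖ}) := by
  by_cases h : y ∈ ext R (Ideal.span {ϖ})
  · exact Ideal.mul_mem_left _ _ h
  · exact (hS.mul_mem_ext_and_exists hy h).1 x hx

/-- For an exceptional `x` the radical is `R x + ϖ R`, and then all norms on it are divisible by
`ϖ²`. Products of two elements of `J` would lie in `ϖ J`, and maximality of the order would give `J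
⊆ ϖ R`. -/
theorem mem_ext_of_sq_dvd {x : R} (hx : ϖ ^ 2 ∣ Q.nm x) : x ∈ ext R (Ideal.span {ϖ}) := by
  by_contra hx'
  have hxJ : x ∈ Q.radical (Ideal.span {ϖ}) := hS.mem_radical_of_nm <|
    Ideal.mem_span_singleton.2 ((dvd_pow_self ϖ two_ne_zero).trans hx)
  have h1 : ∀ y ∈ Q.radical (Ideal.span {ϖ}), ϖ ^ 2 ∣ Q.nm y := by
    intro y hy
    obtain ⟨r, hr⟩ := (hS.mul_mem_ext_and_exists hxJ hx').2 y hy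
    obtain ⟨z, hz⟩ := mem_ext_span.1 hr
    have h2 : y = r * x + algebraMap O R ϖ * z := by rw [← hz]; abel
    have h3 : Q.tr (r * x * Q.conj (algebraMap O R ϖ * z)) = ϖ * Q.tr (r * x * Q.conj z) := by
      rw [Q.conj_mul, Q.conj_algebraMap, ← Algebra.commutes, ← mul_assoc, ← Algebra.commutes,
        mul_assoc, Q.tr_smul]
    have h4 : ϖ ∣ Q.tr (r * x * Q.conj z) :=
      Ideal.mem_span_singleton.1 ((Ideal.mul_mem_left _ r hxJ).2 _)
    rw [h2, Q.nm_add, Q.nm_mul, Q.nm_smul, h3, sq]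
    rw [sq] at hx
    exact dvd_add (dvd_add (hx.mul_left _) (dvd_mul_right _ _)) (mul_dvd_mul_left _ h4)
  obtain ⟨x, hx, hx'⟩ := hS.exists_mem_radical_notMem_ext
  -- Writing `y x = ϖ w`, the norm `ϖ² nm(w)` is divisible by `ϖ⁴`, so `w` is again in the radical.
  refine hx' (mem_ext_span.2 (hS.maximal x fun y hy => ?_))
  obtain ⟨w, hw⟩ := mem_ext_span.1 (hS.mul_mem_ext hy hx)
  refine ⟨w, hS.mem_radical_of_nm (Ideal.mem_span_singleton.2 ?_), hw⟩
  have h2 := mul_dvd_mul (h1 y hy) (h1 x hx)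
  rw [← Q.nm_mul, hw, Q.nm_smul] at h2
  exact (dvd_pow_self ϖ two_ne_zero).trans
    ((mul_dvd_mul_iff_left (pow_ne_zero 2 hS.prime.ne_zero)).1 h2)

theorem exists_uniformizer : ∃ x ∈ Q.radical (Ideal.span {ϖ}), ∃ c, Q.nm x = ϖ * c ∧ ¬ ϖ ∣ c := by
  obtain ⟨x, hx, hx'⟩ := hS.exists_mem_radical_notMem_ext
  obtain ⟨c, hc⟩ := Ideal.mem_span_singleton.1 hx.1
  refine ⟨x, hx, c, hc, fun h => hx' (hS.mem_ext_of_sq_dvd ?_)⟩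
  rw [hc, sq]
  exact mul_dvd_mul_left _ h

/-- Otherwise `S ∩ J + ϖ R`, already of index at least `N` over `S ∩ J`, is all of `J`. Together
with `ϖ² R ⊆ S` this gives `ϖ J ⊆ S` and then `J J ⊆ S`; but `J J` and `ϖ² R` already generate `ϖ
R`. -/
theorem ext_le {x : R} (hx : x ∈ ext R (Ideal.span {ϖ})) : x ∈ S := by
  by_contra hxS
  have := hS.isMaximal
  have hϖ2 (r : O) (hr : r ∈ Ideal.span {ϖ}) (y : R) (hy : y ∈ ext R (Ideal.span {ϖ})) :
      algebraMap O R r * y ∈ S := by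
    obtain ⟨s, rfl⟩ := Ideal.mem_span_singleton.1 hr
    obtain ⟨z, rfl⟩ := mem_ext_span.1 hy
    have : algebraMap O R (ϖ * s) * (algebraMap O R ϖ * z) =
        algebraMap O R (ϖ ^ 2) * (algebraMap O R s * z) := by
      rw [← mul_assoc, ← mul_assoc, ← map_mul, ← map_mul]
      congr 2
      ring
    rw [this]
    exact hS.conductor _
  let I := (ext R (Ideal.span {ϖ})).toAddSubgroup
  let J := (Q.radical (Ideal.span {ϖ})).toAddSubgroup
  have hN := absNorm_pos hS.span_ne_bot
  have hIJ : I ≤ J := fun x hx => Q.ext_le_radical hx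
  have hle : add S ⊓ J ⊔ I ≤ J := sup_le inf_le_right hIJ
  have h1 := AddSubgroup.relIndex_mul_relIndex _ _ _ (le_sup_left : add S ⊓ J ≤ add S ⊓ J ⊔ I) hle
  rw [AddSubgroup.inf_relIndex_right, hS.relIndex_radical] at h1
  have h2 : Ideal.absNorm (Ideal.span {ϖ}) ≤ (add S ⊓ J).relIndex (add S ⊓ J ⊔ I) := by
    refine absNorm_le_relIndex (b := x)
      (fun r y hy => ⟨S.mul_mem (S.algebraMap_mem r) hy.1, Ideal.mul_mem_left _ _ hy.2⟩)
      (fun r => AddSubgroup.mem_sup_right (Ideal.mul_mem_left _ _ hx)) (fun h => hxS h.1)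
      (fun r hr => ⟨hϖ2 r hr x hx, Ideal.mul_mem_left _ _ (Q.ext_le_radical hx)⟩) (fun h => ?_)
    rw [h, zero_mul] at h1
    exact hN.ne h1
  have h3 : (add S ⊓ J ⊔ I).relIndex J = 1 := by
    have h4 : (add S ⊓ J ⊔ I).relIndex J ≤ 1 := by
      by_contra h5
      have : 2 ≤ (add S ⊓ J ⊔ I).relIndex J := by omega
      nlinarith
    have h5 : (add S ⊓ J ⊔ I).relIndex J ≠ 0 := fun h => by
      rw [h, mul_zero] at h1
      exact hN.ne h1
    omega
  have hdec : ∀ y ∈ Q.radical (Ideal.span {ϖ}), ∃ s ∈ S, ∃ z, y = s + algebraMap O R ϖ * z ∧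
      s ∈ Q.radical (Ideal.span {ϖ}) := by
    intro y hy
    obtain ⟨s, hs, i, hi, rfl⟩ := AddSubgroup.mem_sup.1 (AddSubgroup.relIndex_eq_one.1 h3 hy)
    obtain ⟨z, rfl⟩ := mem_ext_span.1 hi
    exact ⟨s, hs.1, z, rfl, hs.2⟩
  have hϖJ : ∀ y ∈ Q.radical (Ideal.span {ϖ}), algebraMap O R ϖ * y ∈ S := by
    intro y hy
    obtain ⟨s, hs, z, rfl, -⟩ := hdec y hy
    rw [mul_add, ← mul_assoc, ← map_mul, ← sq]
    exact add_mem (mul_mem (S.algebraMap_mem _) hs) (hS.conductor z)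
  have hJJ : ∀ y ∈ Q.radical (Ideal.span {ϖ}), ∀ y' ∈ Q.radical (Ideal.span {ϖ}), y * y' ∈ S := by
    intro y hy y' hy'
    obtain ⟨s, hs, z, rfl, hsJ⟩ := hdec y hy
    obtain ⟨t, ht, w, rfl, htJ⟩ := hdec y' hy'
    have : (s + algebraMap O R ϖ * z) * (t + algebraMap O R ϖ * w) =
        s * t + algebraMap O R ϖ * (s * w) +
          algebraMap O R ϖ * (z * (t + algebraMap O R ϖ * w)) := by
      rw [add_mul, mul_add, ← mul_assoc s, ← Algebra.commutes, mul_assoc, mul_assoc]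
    rw [this]
    exact add_mem (add_mem (mul_mem hs ht) (hϖJ _ (Ideal.mul_mem_right _ _ hsJ)))
      (hϖJ _ (Ideal.mul_mem_left _ _ hy'))
  obtain ⟨y, hy, c, hc, hc'⟩ := hS.exists_uniformizer
  obtain ⟨z, rfl⟩ := mem_ext_span.1 hx
  obtain ⟨s, i, hi, hs⟩ := this.exists_inv (mt Ideal.mem_span_singleton.1 hc')
  apply hxS
  -- Here `s c + i = 1` and `y ȳ = ϖ c`: the first summand is a product of two elements of the
  -- radical, the second is in `ϖ² R`.
  have h4 : algebraMap O R ϖ * z = (algebraMap O R s * z * y) * Q.conj y +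
      algebraMap O R i * (algebraMap O R ϖ * z) := by
    rw [mul_assoc _ y, Q.mul_conj, hc, ← Algebra.commutes, ← mul_assoc, ← mul_assoc, ← map_mul,
      ← map_mul, ← add_mul, ← map_add, show ϖ * c * s + i * ϖ = ϖ * (s * c + i) by ring, hs,
      mul_one]
  rw [h4]
  exact add_mem (hJJ _ (Ideal.mul_mem_left _ _ hy) _ (Q.conj_mem_radical hy)) (hϖ2 i hi _ hx)

end IsPerceptiveAt
end DefiniteData
end QuatOrders

/-! ### Counting by orbits of the norm-one elements -/

namespace QuatOrders
namespace DefiniteData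
open QuadraticData

variable {O R : Type*} [CommRing O] [IsDedekindDomain O] [Module.Free ℤ O] [Module.Finite ℤ O]
  [Ring R] [Algebra O R]

/-- The elements of norm `α` in a suborder. -/
def fiber (Q : DefiniteData O R) (T : Subalgebra O R) (α : O) : Set R := {x | x ∈ T ∧ Q.nm x = α}

theorem conj_mem (Q : DefiniteData O R) {T : Subalgebra O R} {x : R} (hx : x ∈ T) :
    Q.conj x ∈ T := by
  rw [Q.conj_eq]; exact sub_mem (T.algebraMap_mem _) hx

theorem conj_mul_cancel (Q : DefiniteData O R) {u : R} (hu : Q.nm u = 1) (x : R) :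
    Q.conj u * (u * x) = x := by
  rw [← mul_assoc, Q.conj_mul_self, hu, map_one, one_mul]

theorem mul_conj_cancel (Q : DefiniteData O R) {u : R} (hu : Q.nm u = 1) (x : R) :
    u * (Q.conj u * x) = x := by
  rw [← mul_assoc, Q.mul_conj, hu, map_one, one_mul]

theorem mul_cancel_conj (Q : DefiniteData O R) {u : R} (hu : Q.nm u = 1) (x : R) :
    x * Q.conj u * u = x := by
  rw [mul_assoc, Q.conj_mul_self, hu, map_one, mul_one]

theorem mul_cancel_conj' (Q : DefiniteData O R) {u : R} (hu : Q.nm u = 1) (x : R) :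
    x * u * Q.conj u = x := by
  rw [mul_assoc, Q.mul_conj, hu, map_one, mul_one]

/-- The number of elements `u` of norm one such that `u x` lies in `S`. -/
def hits (Q : DefiniteData O R) (S : Subalgebra O R) (x : R) : Set R :=
  {u | Q.nm u = 1 ∧ u * x ∈ S}

theorem card_hits_mul (Q : DefiniteData O R) (S : Subalgebra O R) {v : R} (hv : Q.nm v = 1)
    (x : R) : Nat.card (Q.hits S (v * x)) = Nat.card (Q.hits S x) :=
  Nat.card_congr
    { toFun := fun u => ⟨u * v, by rw [Q.nm_mul, u.2.1, hv, one_mul], by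
        rw [mul_assoc]; exact u.2.2⟩
      invFun := fun u => ⟨u * Q.conj v, by rw [Q.nm_mul, Q.nm_conj, u.2.1, hv, one_mul], by
        rw [← mul_assoc, Q.mul_cancel_conj hv]; exact u.2.2⟩
      left_inv := fun u => Subtype.ext (Q.mul_cancel_conj' hv _)
      right_inv := fun u => Subtype.ext (Q.mul_cancel_conj hv _) }

/-- The map `(x, u) ↦ (u, u x)` is a bijection from the pairs with `u x ∈ S` to pairs of a norm-one
element and an element of the fiber in `S`. -/
theorem card_fiber_mul (Q : DefiniteData O R) (S : Subalgebra O R) {α : O} {k : ℕ}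
    (h1 : (Q.fiber ⊤ 1).Finite) (hα : (Q.fiber ⊤ α).Finite)
    (h : ∀ x, Q.nm x = α → Nat.card (Q.hits S x) = k) :
    Nat.card (Q.fiber ⊤ 1) * Nat.card (Q.fiber S α) = Nat.card (Q.fiber ⊤ α) * k := by
  let e : (Σ x : Q.fiber ⊤ α, Q.hits S (x : R)) ≃ Q.fiber ⊤ 1 × Q.fiber S α :=
    { toFun := fun y => (⟨y.2, trivial, y.2.2.1⟩, ⟨y.2 * y.1, y.2.2.2, by
        rw [Q.nm_mul, y.2.2.1, y.1.2.2, one_mul]⟩)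
      invFun := fun y => ⟨⟨Q.conj y.1 * y.2, trivial, by
          rw [Q.nm_mul, Q.nm_conj, y.1.2.2, y.2.2.2, one_mul]⟩,
        ⟨y.1, y.1.2.2, by
          change (y.1 : R) * (Q.conj y.1 * y.2) ∈ S
          rw [Q.mul_conj_cancel y.1.2.2]; exact y.2.2.1⟩⟩
      left_inv := fun y => by
        refine Sigma.subtype_ext (Subtype.ext (Q.conj_mul_cancel y.2.2.1 _)) rfl
      right_inv := fun y => Prod.ext rfl (Subtype.ext (Q.mul_conj_cancel y.1.2.2 _)) }
  have := hα.fintype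
  have hfin (x : Q.fiber ⊤ α) : Finite (Q.hits S (x : R)) :=
    Set.Finite.subset h1 fun u hu => ⟨trivial, hu.1⟩
  rw [← Nat.card_prod, ← Nat.card_congr e, Nat.card_sigma,
    Finset.sum_congr rfl (fun x _ => h x.1 x.2.2), Finset.sum_const, Finset.card_univ,
    Nat.card_eq_fintype_card, smul_eq_mul]

namespace IsPerceptiveAt

variable {Q : DefiniteData O R} {ϖ : O} {S : Subalgebra O R} (hS : Q.IsPerceptiveAt ϖ S)
include hS

/-- One has `u nm(y) = (u y) ȳ ∈ T`, and `nm y` is invertible modulo `ϖ` while `ϖ u ∈ T`. -/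
theorem mem_of_mul_mem {T : Subalgebra O R} (hT : ∀ x ∈ ext R (Ideal.span {ϖ}), x ∈ T) {u y : R}
    (hy : y ∈ T) (huy : u * y ∈ T) (hn : ¬ ϖ ∣ Q.nm y) : u ∈ T := by
  obtain ⟨s, i, hi, hs⟩ := hS.isMaximal.exists_inv (mt Ideal.mem_span_singleton.1 hn)
  have h1 : u = algebraMap O R s * (u * y * Q.conj y) + algebraMap O R i * u := by
    rw [mul_assoc u, Q.mul_conj, ← Algebra.commutes, ← mul_assoc, ← map_mul, ← add_mul, ← map_add,
      hs, map_one, one_mul]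
  rw [h1]
  exact add_mem (T.mul_mem (T.algebraMap_mem s) (T.mul_mem huy (Q.conj_mem hy)))
    (hT _ (algebraMap_mul_mem_ext hi u))

/-- Elements of `J` multiply `q` into `J J ⊆ ϖ R ⊆ S`. Conversely, the group of all admissible `u`
contains `S + J`, of index `N` in `R`; if larger it would be `R`, and `J = R q + ϖ R` would lie in
`S`, against the index of `S ∩ J` in `J`. -/
theorem mul_mem_iff {q u : R} (hq : q ∈ S) (h1 : ϖ ∣ Q.nm q) (h2 : ¬ ϖ ^ 2 ∣ Q.nm q) :
    u * q ∈ S ↔ u ∈ addRadical Q ϖ S := by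
  have hmax := hS.isMaximal
  have hqJ := hS.mem_radical_of_nm (Ideal.mem_span_singleton.2 h1)
  have hqI : q ∉ ext R (Ideal.span {ϖ}) := fun h => by
    have := Q.nm_mem_sq_of_mem_ext h
    rw [Ideal.span_singleton_pow, Ideal.mem_span_singleton] at this
    exact h2 this
  have key (u : R) (hu : u ∈ addRadical Q ϖ S) : u * q ∈ S := by
    obtain ⟨s, hs, hj⟩ := hu
    have : u * q = s * q + (u - s) * q := by rw [← add_mul, add_sub_cancel]
    rw [this]
    exact add_mem (S.mul_mem hs hq) (hS.ext_le (hS.mul_mem_ext hj hqJ))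
  refine ⟨fun hu => ?_, key u⟩
  by_contra huM
  let A : AddSubgroup R := (add S).comap (AddMonoidHom.mulRight q)
  have hA (x : R) : x ∈ A ↔ x * q ∈ S := Iff.rfl
  have hMA : add (addRadical Q ϖ S) ≤ A := fun x hx => key x hx
  have h3 := AddSubgroup.relIndex_mul_index hMA
  rw [hS.index_facts.2] at h3
  have hN := hS.one_lt_norm
  have h4 : Ideal.absNorm (Ideal.span {ϖ}) ≤ (add (addRadical Q ϖ S)).relIndex A := by
    refine absNorm_le_relIndex (b := u)
      (fun r x hx => (addRadical Q ϖ S).mul_mem (Subalgebra.algebraMap_mem _ r) hx)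
      (fun r => by rw [hA, mul_assoc]; exact S.mul_mem (S.algebraMap_mem r) hu) huM
      (fun r hr => radical_le_addRadical (Ideal.mul_mem_right _ _ (Q.algebraMap_mem_radical hr)))
      (fun h => ?_)
    rw [h, zero_mul] at h3
    omega
  have h5 : A.index = 1 := by
    have h6 : A.index ≠ 0 := fun h => by rw [h, mul_zero] at h3; omega
    by_contra h7
    have : 2 ≤ A.index := by omega
    nlinarith
  rw [AddSubgroup.index_eq_one] at h5
  have h6 : (Q.radical (Ideal.span {ϖ})).toAddSubgroup ≤ add S := by
    intro y hy
    obtain ⟨r, hr⟩ := (hS.mul_mem_ext_and_exists hqJ hqI).2 y hy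
    have hrA : r * q ∈ S := (hA r).1 (h5 ▸ trivial)
    have := add_mem (hS.ext_le hr) hrA
    rwa [sub_add_cancel] at this
  have h7 := hS.relIndex_radical
  rw [AddSubgroup.relIndex_eq_one.2 h6] at h7
  omega

/-- The classes modulo `ϖ` of the elements of a suborder whose norm is prime to `ϖ`. -/
def unitClasses (Q : DefiniteData O R) (ϖ : O) (T : Subalgebra O R) :
    Set (R ⧸ ext R (Ideal.span {ϖ})) :=
  Ideal.Quotient.mk (ext R (Ideal.span {ϖ})) '' {y | y ∈ T ∧ ¬ ϖ ∣ Q.nm y}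

theorem card_unitClasses (T : Subalgebra O R) :
    Nat.card (unitClasses Q ϖ T) + (ext R (Ideal.span {ϖ})).toAddSubgroup.relIndex
      (add T ⊓ (Q.radical (Ideal.span {ϖ})).toAddSubgroup) =
    (ext R (Ideal.span {ϖ})).toAddSubgroup.relIndex (add T) := by
  have := hS.finite_quot
  let J := (Q.radical (Ideal.span {ϖ})).toAddSubgroup
  let g : R →+ R ⧸ ext R (Ideal.span {ϖ}) :=
    (Ideal.Quotient.mk (ext R (Ideal.span {ϖ}))).toAddMonoidHom
  have hg : g.ker = (ext R (Ideal.span {ϖ})).toAddSubgroup := by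
    ext x
    exact Ideal.Quotient.eq_zero_iff_mem
  have hdiff : unitClasses Q ϖ T = ((add T).map g : Set _) \ ((add T ⊓ J).map g) := by
    ext c
    constructor
    · rintro ⟨y, ⟨hy, hn⟩, rfl⟩
      refine ⟨⟨y, hy, rfl⟩, ?_⟩
      rintro ⟨z, hz, hzy⟩
      have h1 : y - z ∈ ext R (Ideal.span {ϖ}) := Ideal.Quotient.eq.1 hzy.symm
      have h2 : y ∈ Q.radical (Ideal.span {ϖ}) := by
        have := add_mem (Q.ext_le_radical h1) hz.2
        rwa [sub_add_cancel] at this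
      exact hn (Ideal.mem_span_singleton.1 h2.1)
    · rintro ⟨⟨y, hy, rfl⟩, hn⟩
      exact ⟨y, ⟨hy, fun h => hn ⟨y, ⟨hy, hS.mem_radical_of_nm (Ideal.mem_span_singleton.2 h)⟩,
        rfl⟩⟩, rfl⟩
  rw [← hg, AddSubgroup.relIndex_ker, AddSubgroup.relIndex_ker, Nat.card_coe_set_eq, hdiff]
  exact Set.ncard_sdiff_add_ncard_of_subset (AddSubgroup.map_mono inf_le_left)

/-- Count the pairs of a class `c` from `T` and a norm-one `u ∈ T` with `u c` a class from `S`. The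
map `(c, u) ↦ (u, u c)` gives the right-hand side; perceptivity gives the left. -/
theorem card_units_mul (h1 : (Q.fiber ⊤ 1).Finite) {T : Subalgebra O R} (hST : S ≤ T) :
    Nat.card (unitClasses Q ϖ T) * Nat.card (Q.fiber S 1) =
      Nat.card (Q.fiber T 1) * Nat.card (unitClasses Q ϖ S) := by
  have := hS.finite_quot
  let mk := Ideal.Quotient.mk (ext R (Ideal.span {ϖ}))
  have hTI : ∀ x ∈ ext R (Ideal.span {ϖ}), x ∈ T := fun x hx => hST (hS.ext_le hx)
  have hone (T : Subalgebra O R) {u y : R} (hu : u ∈ Q.fiber T 1)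
      (hy : y ∈ {y | y ∈ T ∧ ¬ ϖ ∣ Q.nm y}) : Q.conj u * y ∈ {y | y ∈ T ∧ ¬ ϖ ∣ Q.nm y} :=
    ⟨T.mul_mem (Q.conj_mem hu.1) hy.1, by rw [Q.nm_mul, Q.nm_conj, hu.2, one_mul]; exact hy.2⟩
  let F : unitClasses Q ϖ T → Set R := fun c => {u | u ∈ Q.fiber T 1 ∧ mk u * c ∈ unitClasses Q ϖ S}
  have hmk {u : R} (hu : Q.nm u = 1) (c : R ⧸ ext R (Ideal.span {ϖ})) :
      mk (Q.conj u) * (mk u * c) = c := by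
    rw [← mul_assoc, ← map_mul, Q.conj_mul_self, hu, map_one, map_one, one_mul]
  have hmk' {u : R} (hu : Q.nm u = 1) (c : R ⧸ ext R (Ideal.span {ϖ})) :
      mk u * (mk (Q.conj u) * c) = c := by
    rw [← mul_assoc, ← map_mul, Q.mul_conj, hu, map_one, map_one, one_mul]
  let e : (Σ c : unitClasses Q ϖ T, F c) ≃ Q.fiber T 1 × unitClasses Q ϖ S :=
    { toFun := fun y => (⟨y.2, y.2.2.1⟩, ⟨mk y.2 * y.1, y.2.2.2⟩)
      invFun := fun y => ⟨⟨mk (Q.conj y.1) * y.2, by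
          obtain ⟨⟨u, hu⟩, ⟨_, ⟨z, hz, rfl⟩⟩⟩ := y
          refine ⟨Q.conj u * z, hone T hu ⟨hST hz.1, hz.2⟩, ?_⟩
          rw [map_mul]⟩, ⟨y.1, y.1.2, by
            change mk y.1 * (mk (Q.conj y.1) * y.2) ∈ _
            rw [hmk' y.1.2.2]; exact y.2.2⟩⟩
      left_inv := fun y => Sigma.subtype_ext (Subtype.ext (hmk y.2.2.1.2 _)) rfl
      right_inv := fun y => Prod.ext rfl (Subtype.ext (hmk' y.1.2.2 _)) }
  -- If `v` moves a representative `y` into `S`, then `v ∈ T`, and the admissible `u` form the coset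
  -- of the norm-one elements of `S` through `v`.
  have hF (c : unitClasses Q ϖ T) : Nat.card (F c) = Nat.card (Q.fiber S 1) := by
    obtain ⟨_, ⟨y, ⟨hy, hn⟩, rfl⟩⟩ := c
    obtain ⟨v, hv, hvy⟩ := hS.perceptive y
    have hvT : v ∈ T := hS.mem_of_mul_mem hTI hy (hST hvy) hn
    have hiff (u : R) (hu : Q.nm u = 1) : mk u * mk y ∈ unitClasses Q ϖ S ↔ u * y ∈ S := by
      constructor
      · rintro ⟨z, hz, hzy⟩
        have h2 : z - u * y ∈ ext R (Ideal.span {ϖ}) := by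
          rw [← Ideal.Quotient.eq, map_mul]; exact hzy
        have := sub_mem hz.1 (hS.ext_le h2)
        rwa [sub_sub_cancel] at this
      · intro h
        exact ⟨u * y, ⟨h, by rw [Q.nm_mul, hu, one_mul]; exact hn⟩, map_mul _ _ _⟩
    refine Nat.card_congr
      { toFun := fun u => ⟨u * Q.conj v, ?_, by
          rw [Q.nm_mul, Q.nm_conj, u.2.1.2, hv, one_mul]⟩
        invFun := fun s => ⟨s * v, ⟨T.mul_mem (hST s.2.1) hvT, by
          rw [Q.nm_mul, s.2.2, hv, one_mul]⟩, (hiff _ (by rw [Q.nm_mul, s.2.2, hv, one_mul])).2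
            (by rw [mul_assoc]; exact S.mul_mem s.2.1 hvy)⟩
        left_inv := fun u => Subtype.ext (Q.mul_cancel_conj hv _)
        right_inv := fun u => Subtype.ext (Q.mul_cancel_conj' hv _) }
    refine hS.mem_of_mul_mem (fun x hx => hS.ext_le hx) hvy ?_
      (by rw [Q.nm_mul, hv, one_mul]; exact hn)
    rw [← mul_assoc, Q.mul_cancel_conj hv]
    exact (hiff _ u.2.1.2).1 u.2.2
  have := Fintype.ofFinite (unitClasses Q ϖ T)
  have hfin (c : unitClasses Q ϖ T) : Finite (F c) :=
    Set.Finite.subset h1 fun u hu => ⟨trivial, hu.1.2⟩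
  rw [← Nat.card_prod (Q.fiber T 1), ← Nat.card_congr e, Nat.card_sigma,
    Finset.sum_congr rfl fun x _ => hF x, Finset.sum_const, Finset.card_univ,
    Nat.card_eq_fintype_card, smul_eq_mul]

theorem ext_relIndex_mul_index {T : Subalgebra O R} (hT : ∀ x ∈ ext R (Ideal.span {ϖ}), x ∈ T) :
    (ext R (Ideal.span {ϖ})).toAddSubgroup.relIndex (add T) * (add T).index =
      Ideal.absNorm (Ideal.span {ϖ}) ^ 4 := by
  rw [AddSubgroup.relIndex_mul_index (show (ext R (Ideal.span {ϖ})).toAddSubgroup ≤ add T from hT)]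
  exact hS.card_quot_ext

theorem card_unitClasses_self : Nat.card (unitClasses Q ϖ S) + Ideal.absNorm (Ideal.span {ϖ}) =
    Ideal.absNorm (Ideal.span {ϖ}) ^ 2 := by
  have hN := absNorm_pos hS.span_ne_bot
  have h1 := hS.card_unitClasses S
  have h2 := hS.ext_relIndex_mul_index (T := S) fun x hx => hS.ext_le hx
  rw [hS.index, show 4 = 2 + 2 from rfl, pow_add] at h2
  rw [Nat.eq_of_mul_eq_mul_right (pow_pos hN 2) h2] at h1
  have h3 := AddSubgroup.relIndex_mul_relIndex (ext R (Ideal.span {ϖ})).toAddSubgroup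
    (add S ⊓ (Q.radical (Ideal.span {ϖ})).toAddSubgroup)
    (Q.radical (Ideal.span {ϖ})).toAddSubgroup
    (fun x hx => ⟨hS.ext_le hx, Q.ext_le_radical hx⟩) inf_le_right
  rw [AddSubgroup.inf_relIndex_right, hS.relIndex_radical, hS.ext_relIndex_radical, sq] at h3
  rwa [Nat.eq_of_mul_eq_mul_right hN h3] at h1

theorem card_unitClasses_of_radical_le {T : Subalgebra O R}
    (hT : ∀ x ∈ Q.radical (Ideal.span {ϖ}), x ∈ T) :
    Nat.card (unitClasses Q ϖ T) + Ideal.absNorm (Ideal.span {ϖ}) ^ 2 =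
      (ext R (Ideal.span {ϖ})).toAddSubgroup.relIndex (add T) := by
  have h1 := hS.card_unitClasses T
  rwa [inf_eq_right.2 (show (Q.radical (Ideal.span {ϖ})).toAddSubgroup ≤ add T from hT),
    hS.ext_relIndex_radical] at h1

/-- The unit classes number `N³ - N²` for `S + J` and `N² - N` for `S`. -/
theorem card_units_addRadical (h1 : (Q.fiber ⊤ 1).Finite) :
    Nat.card (Q.fiber (addRadical Q ϖ S) 1) =
      Ideal.absNorm (Ideal.span {ϖ}) * Nat.card (Q.fiber S 1) := by
  have hN := hS.one_lt_norm
  have h2 := hS.card_units_mul h1 (T := addRadical Q ϖ S) le_addRadical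
  have h3 := hS.card_unitClasses_self
  have h4 := hS.card_unitClasses_of_radical_le (T := addRadical Q ϖ S)
    fun x hx => radical_le_addRadical hx
  have h5 := hS.ext_relIndex_mul_index (T := addRadical Q ϖ S)
    fun x hx => radical_le_addRadical (Q.ext_le_radical hx)
  rw [hS.index_facts.2, pow_succ] at h5
  rw [Nat.eq_of_mul_eq_mul_right (by omega) h5] at h4
  set N := Ideal.absNorm (Ideal.span {ϖ})
  have h6 : Nat.card (unitClasses Q ϖ (addRadical Q ϖ S)) = N * Nat.card (unitClasses Q ϖ S) := by
    have : N * (Nat.card (unitClasses Q ϖ S) + N) = N * N ^ 2 := by rw [h3]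
    nlinarith
  have h7 : 0 < Nat.card (unitClasses Q ϖ S) := by nlinarith
  rw [h6] at h2
  exact Nat.eq_of_mul_eq_mul_right h7 (by rw [← h2]; ring)

/-- The unit classes number `N⁴ - N²` for `R`, and `N⁴ - N² = (N² + N)(N² - N)`. -/
theorem card_units_top (h1 : (Q.fiber ⊤ 1).Finite) :
    Nat.card (Q.fiber ⊤ 1) = (Ideal.absNorm (Ideal.span {ϖ}) ^ 2 + Ideal.absNorm (Ideal.span {ϖ})) *
      Nat.card (Q.fiber S 1) := by
  have hN := hS.one_lt_norm
  have h2 := hS.card_units_mul h1 (T := ⊤) le_top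
  have h3 := hS.card_unitClasses_self
  have h4 := hS.card_unitClasses_of_radical_le (T := ⊤) fun x hx => trivial
  have h5 : (ext R (Ideal.span {ϖ})).toAddSubgroup.relIndex (add (⊤ : Subalgebra O R)) =
      Ideal.absNorm (Ideal.span {ϖ}) ^ 4 := by
    rw [← hS.card_quot_ext]
    exact AddSubgroup.relIndex_top_right _
  rw [h5] at h4
  set N := Ideal.absNorm (Ideal.span {ϖ})
  have h6 : Nat.card (unitClasses Q ϖ ⊤) = (N ^ 2 + N) * Nat.card (unitClasses Q ϖ S) := by
    have h8 : (N ^ 2 + N) * (Nat.card (unitClasses Q ϖ S) + N) = (N ^ 2 + N) * N ^ 2 := by rw [h3]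
    nlinarith
  have h7 : 0 < Nat.card (unitClasses Q ϖ S) := by nlinarith
  rw [h6] at h2
  exact Nat.eq_of_mul_eq_mul_right h7 (by rw [← h2]; ring)

/-- The number of elements of norm `α` in `S`, in terms of that in `R`. -/
theorem card_fiber (h1 : (Q.fiber ⊤ 1).Finite) {α : O} (hα : (Q.fiber ⊤ α).Finite) {m : ℕ}
    (hm : Nat.card (Q.fiber ⊤ α) = Nat.card (Q.fiber ⊤ 1) * m) :
    (¬ ϖ ∣ α → Nat.card (Q.fiber S α) = Nat.card (Q.fiber S 1) * m) ∧
    (ϖ ∣ α → ¬ ϖ ^ 2 ∣ α → Nat.card (Q.fiber S α) =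
      Nat.card (Q.fiber S 1) * m * Ideal.absNorm (Ideal.span {ϖ})) ∧
    (ϖ ^ 2 ∣ α → Nat.card (Q.fiber S α) = Nat.card (Q.fiber S 1) * m *
      (Ideal.absNorm (Ideal.span {ϖ}) ^ 2 + Ideal.absNorm (Ideal.span {ϖ}))) := by
  have hpos : 0 < Nat.card (Q.fiber ⊤ 1) := by
    have := h1.to_subtype
    exact Nat.card_pos_iff.2 ⟨⟨⟨1, trivial, Q.nm_one⟩⟩, this⟩
  -- Perceptivity reduces to `x ∈ S`, where the admissible `u` are the norm-one elements of `T`: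
  -- this is `S`, `S + J` or `R` in the three cases.
  have key {k : ℕ} (T : Subalgebra O R) (hk : Nat.card (Q.fiber T 1) = k)
      (h : ∀ x ∈ S, Q.nm x = α → ∀ u, u * x ∈ S ↔ u ∈ T) :
      Nat.card (Q.fiber S α) = k * m := by
    have h2 := Q.card_fiber_mul S (k := k) h1 hα fun x hx => by
      obtain ⟨v, hv, hvx⟩ := hS.perceptive x
      rw [← Q.card_hits_mul S hv, ← hk]
      have : Q.hits S (v * x) = Q.fiber T 1 := by
        ext u
        rw [hits, Set.mem_ofPred_eq, h _ hvx (by rw [Q.nm_mul, hv, hx, one_mul]), and_comm]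
        rfl
      rw [this]
    rw [hm, mul_assoc, mul_comm m] at h2
    exact Nat.eq_of_mul_eq_mul_left hpos h2
  refine ⟨fun h => key S rfl fun x hx hxα u => ⟨fun hu => ?_, fun hu => S.mul_mem hu hx⟩,
    fun h h' => ?_, fun h => ?_⟩
  · exact hS.mem_of_mul_mem (fun x hx => hS.ext_le hx) hx hu (hxα ▸ h)
  · rw [key _ (hS.card_units_addRadical h1) fun x hx hxα u =>
      hS.mul_mem_iff hx (hxα ▸ h) (hxα ▸ h')]
    ring
  · rw [key _ (hS.card_units_top h1) fun x hx hxα u => ⟨fun _ => trivial, fun _ => hS.ext_le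
      (Ideal.mul_mem_left _ _ (hS.mem_ext_of_sq_dvd (hxα ▸ h)))⟩]
    ring

end IsPerceptiveAt
end DefiniteData
end QuatOrders

/-! ### Divisor sums and representation numbers of the maximal order -/

namespace QuatOrders
namespace DefiniteData
open QuadraticData

variable {O R : Type*} [CommRing O] [IsDedekindDomain O] [Module.Free ℤ O] [Module.Finite ℤ O]
  [Ring R] [Algebra O R]

/-- The divisors of an ideal that are divisible by no prime divisor of `D`. -/
def awayDivisors (D B : Ideal O) : Set (Ideal O) :=
  {I | I ∣ B ∧ ∀ P : Ideal O, P.IsPrime → P ∣ D → ¬ P ∣ I}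

/-- The sum of the norms of the divisors of an ideal that are prime to `D`. -/
def sigmaAway (D B : Ideal O) : ℕ := ∑ᶠ I ∈ awayDivisors D B, Ideal.absNorm I

theorem finite_awayDivisors (D : Ideal O) {B : Ideal O} (hB : B ≠ ⊥) :
    (awayDivisors D B).Finite := by
  have hfin : Finite {I // I ∣ B} :=
    @Finite.of_fintype _ (UniqueFactorizationMonoid.fintypeSubtypeDvd B hB)
  have hs : {I : Ideal O | I ∣ B}.Finite := hfin
  exact hs.subset fun I hI => hI.1

theorem sigmaAway_top (D : Ideal O) : sigmaAway D (⊤ : Ideal O) = 1 := by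
  have : awayDivisors D (⊤ : Ideal O) = {⊤} := by
    ext I
    rw [Set.mem_singleton_iff]
    constructor
    · rintro ⟨h, -⟩
      exact top_le_iff.1 (Ideal.dvd_iff_le.1 h)
    · rintro rfl
      exact ⟨dvd_rfl, fun P hP _ h => hP.ne_top (top_le_iff.1 (Ideal.dvd_iff_le.1 h))⟩
  rw [sigmaAway, this, finsum_mem_singleton, Ideal.absNorm_top]

theorem dvd_of_dvd_mul_of_not_dvd {q I B : Ideal O} [hq : q.IsMaximal] (h : I ∣ q * B)
    (hqI : ¬ q ∣ I) : I ∣ B := by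
  have hcop : IsCoprime I q := by
    rw [Ideal.isCoprime_iff_sup_eq, sup_comm]
    exact hq.1.2 _ (left_lt_sup.2 fun h => hqI (Ideal.dvd_iff_le.2 h))
  exact hcop.dvd_of_dvd_mul_left h

theorem awayDivisors_mul_of_dvd {D q : Ideal O} [hq : q.IsMaximal] (hqD : q ∣ D)
    (B : Ideal O) : awayDivisors D (q * B) = awayDivisors D B := by
  ext I
  exact ⟨fun h => ⟨dvd_of_dvd_mul_of_not_dvd h.1 (h.2 q hq.isPrime hqD), h.2⟩,
    fun h => ⟨h.1.mul_left q, h.2⟩⟩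

theorem mul_mem_awayDivisors {D q : Ideal O} (hq0 : q ≠ ⊥) [hq : q.IsMaximal] (hqD : ¬ q ∣ D)
    {I B : Ideal O} : q * I ∈ awayDivisors D (q * B) ↔ I ∈ awayDivisors D B := by
  constructor
  · exact fun h => ⟨(mul_dvd_mul_iff_left hq0).1 h.1, fun P hP hPD hPI =>
      h.2 P hP hPD (hPI.mul_left q)⟩
  · refine fun h => ⟨mul_dvd_mul_left _ h.1, fun P hP hPD hPI => ?_⟩
    by_cases hP0 : P = ⊥
    · subst hP0
      have hD : D = ⊥ := zero_dvd_iff.1 hPD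
      exact hqD (hD ▸ dvd_zero q)
    rcases (Ideal.prime_of_isPrime hP0 hP).dvd_or_dvd hPI with h1 | h1
    · have := (hq.eq_of_le hP.ne_top (Ideal.dvd_iff_le.1 h1))
      exact hqD (this ▸ hPD)
    · exact h.2 P hP hPD h1

theorem awayDivisors_mul_of_not_dvd {D q : Ideal O} (hq0 : q ≠ ⊥) [hq : q.IsMaximal]
    (hqD : ¬ q ∣ D) (B : Ideal O) :
    awayDivisors D (q * B) = awayDivisors D B ∪ (q * ·) '' awayDivisors D B := by
  ext I
  constructor
  · intro h
    by_cases hqI : q ∣ I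
    · obtain ⟨I, rfl⟩ := hqI
      exact Or.inr ⟨I, (mul_mem_awayDivisors hq0 hqD).1 h, rfl⟩
    · exact Or.inl ⟨dvd_of_dvd_mul_of_not_dvd h.1 hqI, h.2⟩
  · rintro (h | ⟨I, h, rfl⟩)
    · exact ⟨h.1.mul_left q, h.2⟩
    · exact (mul_mem_awayDivisors hq0 hqD).2 h

theorem finsum_image_mul {q : Ideal O} (hq0 : q ≠ ⊥) {s : Set (Ideal O)} (hs : s.Finite) :
    ∑ᶠ I ∈ (q * ·) '' s, Ideal.absNorm I = Ideal.absNorm q * ∑ᶠ I ∈ s, Ideal.absNorm I := by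
  rw [finsum_mem_image (mul_right_injective₀ hq0).injOn]
  simp only [map_mul]
  rw [mul_finsum_mem' _ _ hs]

theorem sigmaAway_mul_of_not_dvd {D q B : Ideal O} (hq0 : q ≠ ⊥) [hq : q.IsMaximal]
    (hqD : ¬ q ∣ D) (hB : B ≠ ⊥) (hqB : ¬ q ∣ B) :
    sigmaAway D (q * B) = (Ideal.absNorm q + 1) * sigmaAway D B := by
  have hf := finite_awayDivisors D hB
  rw [sigmaAway, awayDivisors_mul_of_not_dvd hq0 hqD, finsum_mem_union ?_ hf (hf.image _),
    finsum_image_mul hq0 hf, ← sigmaAway]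
  · ring
  · rw [Set.disjoint_right]
    rintro _ ⟨I, -, rfl⟩ h
    exact hqB ((dvd_mul_right q I).trans h.1)

/-- With `A` the divisors of `q B`, those of `q² B` are `A ∪ q A`, and `A ∩ q A` consists of the
multiples by `q` of the divisors of `B`. -/
theorem sigmaAway_mul_mul {D q B : Ideal O} (hq0 : q ≠ ⊥) [hq : q.IsMaximal]
    (hqD : ¬ q ∣ D) (hB : B ≠ ⊥) :
    sigmaAway D (q * (q * B)) + Ideal.absNorm q * sigmaAway D B =
      (Ideal.absNorm q + 1) * sigmaAway D (q * B) := by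
  have hf := finite_awayDivisors D (mul_ne_zero hq0 hB)
  have h1 : awayDivisors D (q * B) ∩ (q * ·) '' awayDivisors D (q * B) =
      (q * ·) '' awayDivisors D B := by
    ext I
    constructor
    · rintro ⟨h, I, -, rfl⟩
      exact ⟨I, (mul_mem_awayDivisors hq0 hqD).1 h, rfl⟩
    · rintro ⟨I, h, rfl⟩
      exact ⟨(mul_mem_awayDivisors hq0 hqD).2 h, I, ⟨h.1.mul_left q, h.2⟩, rfl⟩
  have h2 := finsum_mem_union_inter (f := fun I : Ideal O => Ideal.absNorm I) hf
    (hf.image (q * ·))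
  rw [← awayDivisors_mul_of_not_dvd hq0 hqD, h1, finsum_image_mul hq0 hf,
    finsum_image_mul hq0 (finite_awayDivisors D hB)] at h2
  rw [sigmaAway, sigmaAway, sigmaAway, h2]
  ring

/-- Definite quadratic data of narrow class number one, for a notion `Pos` of positivity of
scalars. -/
structure IsPrincipalData (Q : DefiniteData O R) (D : Ideal O) (Pos : O → Prop) : Prop where
  pos_nm : ∀ x, Q.nm x ≠ 0 → Pos (Q.nm x)
  pos_of_mul : ∀ x y, Pos (x * y) → Pos x → Pos y
  pos_ne_zero : ∀ x, Pos x → x ≠ 0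
  generator : ∀ I : Ideal O, I ≠ ⊥ → ∃ r, Pos r ∧ Ideal.span {r} = I
  square : ∀ u : Oˣ, Pos u → ∃ w : Oˣ, u = w ^ 2
  finite_fiber : ∀ α, (Q.fiber ⊤ α).Finite
  ramified : ∀ π, Prime π → Ideal.span {π} ∣ D → ∃ y, Ideal.span {Q.nm y} = Ideal.span {π} ∧
    ∀ x, Q.nm x ∈ Ideal.span {π} → x ∈ Ideal.span {y}
  unramified : ∀ π, Prime π → ¬ Ideal.span {π} ∣ D →
    PrincipalAt R (Ideal.span {π}) ∧ ¬ Q.DiscLE (Ideal.span {π})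

namespace IsPrincipalData

variable {Q : DefiniteData O R} {D : Ideal O} {Pos : O → Prop} (hQ : Q.IsPrincipalData D Pos)
include hQ

theorem card_fiber_unit {u : Oˣ} (hu : Pos u) :
    Nat.card (Q.fiber ⊤ (u : O)) = Nat.card (Q.fiber ⊤ 1) := by
  obtain ⟨w, rfl⟩ := hQ.square u hu
  have h (x : R) : algebraMap O R (w : O) * (algebraMap O R (w⁻¹ : Oˣ) * x) = x := by
    rw [← mul_assoc, ← map_mul, Units.mul_inv, map_one, one_mul]
  have h' (x : R) : algebraMap O R (w⁻¹ : Oˣ) * (algebraMap O R (w : O) * x) = x := by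
    rw [← mul_assoc, ← map_mul, Units.inv_mul, map_one, one_mul]
  exact Nat.card_congr
    { toFun := fun x => ⟨algebraMap O R (w⁻¹ : Oˣ) * x, trivial, by
        rw [Q.nm_smul, x.2.2]; simp [← mul_pow]⟩
      invFun := fun x => ⟨algebraMap O R (w : O) * x, trivial, by
        rw [Q.nm_smul, x.2.2]; simp⟩
      left_inv := fun x => Subtype.ext (h _)
      right_inv := fun x => Subtype.ext (h' _) }

/-- The norm of `y` and `π` differ by a totally positive unit, here a square `w²`; dividing `y` by
the central unit `w` corrects the norm. -/
theorem exists_span_eq {π : O} (hπ : Pos π) {y : R} (hy : Ideal.span {Q.nm y} = Ideal.span {π}) :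
    ∃ z, Ideal.span {z} = Ideal.span {y} ∧ Q.nm z = π := by
  obtain ⟨u, hu⟩ := Ideal.span_singleton_eq_span_singleton.1 hy.symm
  have hy0 : Q.nm y ≠ 0 := fun h0 => by
    rw [h0, Ideal.span_singleton_eq_bot.2 rfl, eq_comm, Ideal.span_singleton_eq_bot] at hy
    exact hQ.pos_ne_zero π hπ hy
  obtain ⟨w, rfl⟩ := hQ.square u (hQ.pos_of_mul π u (hu ▸ hQ.pos_nm y hy0) hπ)
  refine ⟨algebraMap O R (w⁻¹ : Oˣ) * y, le_antisymm ?_ ?_, ?_⟩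
  · rw [Ideal.span_singleton_le_iff_mem]
    exact Ideal.mul_mem_left _ _ (Ideal.mem_span_singleton_self y)
  · rw [Ideal.span_singleton_le_iff_mem, Ideal.mem_span_singleton']
    exact ⟨algebraMap O R (w : O), by
      rw [← mul_assoc, ← map_mul, Units.mul_inv, map_one, one_mul]⟩
  · rw [Q.nm_smul, ← hu, mul_left_comm, Units.val_pow_eq_pow_val, ← mul_pow, Units.inv_mul,
      one_pow, mul_one]

/-- Right multiplication by an element of norm `π`. -/
theorem card_inter_span {π β : O} (hπ : π ≠ 0) {z : R} (hz : Q.nm z = π) :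
    Nat.card {x // x ∈ Q.fiber ⊤ (π * β) ∧ x ∈ Ideal.span {z}} = Nat.card (Q.fiber ⊤ β) := by
  symm
  refine Nat.card_congr (Equiv.ofBijective (fun x => ⟨x * z, ⟨trivial, by
    rw [Q.nm_mul, x.2.2, hz, mul_comm]⟩, Ideal.mul_mem_left _ _ (Ideal.mem_span_singleton_self z)⟩)
    ⟨fun x y h => Subtype.ext (Q.mul_right_cancel_of_nm (hz ▸ hπ) (congrArg Subtype.val h)), ?_⟩)
  rintro ⟨x, ⟨-, hx⟩, hxz⟩
  obtain ⟨y, rfl⟩ := Ideal.mem_span_singleton'.1 hxz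
  rw [Q.nm_mul, hz, mul_comm] at hx
  exact ⟨⟨y, trivial, mul_left_cancel₀ hπ hx⟩, rfl⟩

theorem card_fiber_ramified {π β : O} (hπ : Prime π) (hπp : Pos π) (hπD : Ideal.span {π} ∣ D) :
    Nat.card (Q.fiber ⊤ (π * β)) = Nat.card (Q.fiber ⊤ β) := by
  obtain ⟨y, hy, hy'⟩ := hQ.ramified π hπ hπD
  obtain ⟨z, hz, hzπ⟩ := hQ.exists_span_eq hπp hy
  rw [← hQ.card_inter_span (β := β) hπ.ne_zero hzπ]
  refine Nat.card_congr (Equiv.subtypeEquivRight fun x =>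
    ⟨fun h => ⟨h, hz ▸ hy' x ?_⟩, fun h => h.1⟩)
  rw [h.2]
  exact Ideal.mem_span_singleton.2 (dvd_mul_right π β)

/-- Count the pairs of an element of norm `π β` and an intermediate left ideal containing it. Each
of the `N(π) + 1` ideals contributes the fiber over `β`; an element lies in all of them if it is in
`π R`, and otherwise in just one. -/
theorem card_fiber_unramified {π β : O} (hπ : Prime π) (hπp : Pos π)
    (hπD : ¬ Ideal.span {π} ∣ D) :
    Nat.card (Q.fiber ⊤ (π * β)) + Ideal.absNorm (Ideal.span {π}) *
      Nat.card {x // x ∈ Q.fiber ⊤ (π * β) ∧ x ∈ ext R (Ideal.span {π})} =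
      (Ideal.absNorm (Ideal.span {π}) + 1) * Nat.card (Q.fiber ⊤ β) := by
  classical
  obtain ⟨hP, hD⟩ := hQ.unramified π hπ hπD
  have hq0 : Ideal.span {π} ≠ ⊥ := by simpa using hπ.ne_zero
  have hmax : (Ideal.span {π}).IsMaximal :=
    ((Ideal.span_singleton_prime hπ.ne_zero).2 hπ).isMaximal hq0
  have hcard := Q.card_isMid hq0 hP hD
  set q := Ideal.span {π}
  have hMfin : Finite {I : Ideal R // IsMid q I} :=
    Nat.finite_of_card_ne_zero (by rw [hcard]; omega)
  have := Fintype.ofFinite {I : Ideal R // IsMid q I}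
  have := (hQ.finite_fiber (π * β)).fintype
  have hI (I : {I : Ideal R // IsMid q I}) :
      Nat.card {x : Q.fiber ⊤ (π * β) // (x : R) ∈ I.1} = Nat.card (Q.fiber ⊤ β) := by
    obtain ⟨y, hy, hy'⟩ := I.2.exists_generator Q hq0 hP
    obtain ⟨z, hz, hzπ⟩ := hQ.exists_span_eq hπp hy'
    rw [← hQ.card_inter_span hπ.ne_zero hzπ, hz, ← hy]
    exact Nat.card_congr (Equiv.subtypeSubtypeEquivSubtypeInter _ (fun x => x ∈ I.1))
  have hx (x : Q.fiber ⊤ (π * β)) : Nat.card {I : {I : Ideal R // IsMid q I} // (x : R) ∈ I.1} =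
      1 + (if (x : R) ∈ ext R q then Ideal.absNorm q else 0) := by
    split_ifs with h
    · rw [add_comm, ← hcard]
      exact Nat.card_congr (Equiv.subtypeUnivEquiv fun I => I.2.1 h)
    -- The only candidate is the ideal generated by `x` and `π`. It is proper because norms on it
    -- are divisible by `π`, and there are no inclusions among intermediate ideals.
    · have hmid : IsMid q (ext R q ⊔ Ideal.span {(x : R)}) := by
        refine ⟨le_sup_left, fun ht => ?_, fun ht => h ?_⟩
        · obtain ⟨j, hj, w, hw, h2⟩ :=
            Submodule.mem_sup.1 (ht.symm ▸ Submodule.mem_top : (1 : R) ∈ _)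
          obtain ⟨r, rfl⟩ := Ideal.mem_span_singleton'.1 hw
          have h3 : Q.nm (j + r * x) ∈ q := by
            rw [Q.nm_add, Q.nm_mul, x.2.2]
            refine add_mem (add_mem (Ideal.pow_le_self two_ne_zero (Q.nm_mem_sq_of_mem_ext hj)) ?_)
              (Q.tr_mem_of_mem_ext (Ideal.mul_mem_right _ _ hj))
            exact Ideal.mul_mem_left _ _ (Ideal.mem_span_singleton.2 (dvd_mul_right π β))
          rw [h2, Q.nm_one] at h3
          exact hmax.ne_top ((Ideal.eq_top_iff_one _).2 h3)
        · rw [← ht]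
          exact Ideal.mem_sup_right (Ideal.mem_span_singleton_self _)
      rw [add_zero, Nat.card_eq_one_iff_unique]
      refine ⟨⟨fun I J => ?_⟩, ⟨⟨⟨_, hmid⟩,
        Ideal.mem_sup_right (Ideal.mem_span_singleton_self _)⟩⟩⟩
      have key (I : {I : {I : Ideal R // IsMid q I} // (x : R) ∈ I.1}) :
          ext R q ⊔ Ideal.span {(x : R)} = I.1.1 :=
        hmid.eq_of_le Q hq0 hP I.1.2
          (sup_le I.1.2.1 ((Ideal.span_singleton_le_iff_mem _).2 I.2))
      exact Subtype.ext (Subtype.ext ((key I).symm.trans (key J)))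
  let e : (Σ I : {I : Ideal R // IsMid q I}, {x : Q.fiber ⊤ (π * β) // (x : R) ∈ I.1}) ≃
      Σ x : Q.fiber ⊤ (π * β), {I : {I : Ideal R // IsMid q I} // (x : R) ∈ I.1} :=
    { toFun := fun y => ⟨y.2.1, y.1, y.2.2⟩
      invFun := fun y => ⟨y.2.1, y.1, y.2.2⟩
      left_inv := fun y => rfl
      right_inv := fun y => rfl }
  have h1 := Nat.card_congr e
  rw [Nat.card_sigma, Nat.card_sigma, Finset.sum_congr rfl fun I _ => hI I,
    Finset.sum_congr rfl fun x _ => hx x, Finset.sum_add_distrib, Finset.sum_ite, Finset.sum_const,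
    Finset.sum_const, Finset.sum_const, Finset.sum_const_zero, add_zero, Finset.card_univ,
    Finset.card_univ, ← Nat.card_eq_fintype_card, ← Nat.card_eq_fintype_card, hcard, smul_eq_mul,
    smul_eq_mul, smul_eq_mul, mul_one] at h1
  have h2 : Nat.card {x // x ∈ Q.fiber ⊤ (π * β) ∧ x ∈ ext R q} =
      (Finset.univ.filter fun x : Q.fiber ⊤ (π * β) => (x : R) ∈ ext R q).card := by
    rw [← Fintype.card_subtype, ← Nat.card_eq_fintype_card]
    exact Nat.card_congr (Equiv.subtypeSubtypeEquivSubtypeInter _ (fun x => x ∈ ext R q)).symm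
  rw [h1, h2, mul_comm (Ideal.absNorm q)]

theorem card_inter_ext {π : O} (hπ : π ≠ 0) (β : O) :
    Nat.card {x // x ∈ Q.fiber ⊤ (π * (π * β)) ∧ x ∈ ext R (Ideal.span {π})} =
      Nat.card (Q.fiber ⊤ β) := by
  symm
  have hπ2 : π ^ 2 ≠ 0 := pow_ne_zero 2 hπ
  refine Nat.card_congr (Equiv.ofBijective (fun x => ⟨algebraMap O R π * x, ⟨trivial, by
    rw [Q.nm_smul, x.2.2]; ring⟩, mem_ext_span.2 ⟨x, rfl⟩⟩)
    ⟨fun x y h => Subtype.ext ?_, ?_⟩)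
  · exact Q.mul_left_cancel_of_nm (z := algebraMap O R π) (by rwa [Q.nm_algebraMap])
      (congrArg Subtype.val h)
  · rintro ⟨x, ⟨-, hx⟩, hxπ⟩
    obtain ⟨y, rfl⟩ := mem_ext_span.1 hxπ
    rw [Q.nm_smul, ← mul_assoc, ← sq] at hx
    exact ⟨⟨y, trivial, mul_left_cancel₀ hπ2 hx⟩, rfl⟩

theorem card_inter_ext_of_not_dvd {π β : O} (hπ : π ≠ 0) (h : ¬ π ∣ β) :
    Nat.card {x // x ∈ Q.fiber ⊤ (π * β) ∧ x ∈ ext R (Ideal.span {π})} = 0 := by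
  have : IsEmpty {x // x ∈ Q.fiber ⊤ (π * β) ∧ x ∈ ext R (Ideal.span {π})} := ⟨by
    rintro ⟨x, ⟨-, hx⟩, hxπ⟩
    obtain ⟨y, rfl⟩ := mem_ext_span.1 hxπ
    rw [Q.nm_smul, sq, mul_assoc] at hx
    exact h ⟨_, (mul_left_cancel₀ hπ hx).symm⟩⟩
  exact Nat.card_of_isEmpty

/-- The representation numbers of the norm form. -/
theorem card_fiber_eq {α : O} (hα : Pos α) :
    Nat.card (Q.fiber ⊤ α) = Nat.card (Q.fiber ⊤ 1) * sigmaAway D (Ideal.span {α}) := by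
  induction hn : Ideal.absNorm (Ideal.span {α}) using Nat.strong_induction_on generalizing α with
  | _ n ih =>
  subst hn
  have hα0 := hQ.pos_ne_zero α hα
  by_cases hu : IsUnit α
  · obtain ⟨u, rfl⟩ := hu
    rw [hQ.card_fiber_unit hα, Ideal.span_singleton_eq_top.2 u.isUnit, sigmaAway_top, mul_one]
  have hαt : Ideal.span {α} ≠ ⊤ := mt Ideal.span_singleton_eq_top.1 hu
  obtain ⟨P, hP, hαP⟩ := Ideal.exists_le_maximal _ hαt
  have hP0 : P ≠ ⊥ := fun h => hα0 (by simpa [h] using hαP)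
  obtain ⟨π, hπp, rfl⟩ := hQ.generator P hP0
  have hπ0 := hQ.pos_ne_zero π hπp
  have hπ : Prime π := (Ideal.span_singleton_prime hπ0).1 hP.isPrime
  have hN : 1 < Ideal.absNorm (Ideal.span {π}) := have := hP.isPrime; one_lt_absNorm hP0
  have hlt {β : O} (hβ : β ≠ 0) :
      Ideal.absNorm (Ideal.span {β}) < Ideal.absNorm (Ideal.span {π * β}) := by
    rw [← Ideal.span_singleton_mul_span_singleton, map_mul]
    have : 0 < Ideal.absNorm (Ideal.span {β}) := absNorm_pos (by simpa using hβ)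
    nlinarith
  obtain ⟨β, rfl⟩ := Ideal.span_singleton_le_span_singleton.1 hαP
  have hβ := hQ.pos_of_mul π β hα hπp
  have hβ0 := hQ.pos_ne_zero β hβ
  have hβ0' : Ideal.span {β} ≠ ⊥ := by simpa using hβ0
  have ihβ := ih _ (hlt hβ0) hβ rfl
  rw [← Ideal.span_singleton_mul_span_singleton]
  by_cases hπD : Ideal.span {π} ∣ D
  · rw [hQ.card_fiber_ramified hπ hπp hπD, ihβ, sigmaAway, sigmaAway,
      awayDivisors_mul_of_dvd hπD]
  -- The recursion for fibers matches that for divisor sums; whether `π` still divides `β` decides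
  -- between its two forms.
  · have h1 := hQ.card_fiber_unramified (β := β) hπ hπp hπD
    by_cases hπβ : π ∣ β
    · obtain ⟨γ, rfl⟩ := hπβ
      have hγ := hQ.pos_of_mul π γ hβ hπp
      have hγ0 := hQ.pos_ne_zero γ hγ
      have ihγ := ih _ ((hlt hγ0).trans (hlt hβ0)) hγ rfl
      rw [hQ.card_inter_ext hπ0, ihβ, ihγ] at h1
      have h2 := sigmaAway_mul_mul (B := Ideal.span {γ}) hP0 hπD (by simpa using hγ0)
      rw [← Ideal.span_singleton_mul_span_singleton] at h1
      rw [← Ideal.span_singleton_mul_span_singleton π γ]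
      nlinarith
    · rw [hQ.card_inter_ext_of_not_dvd hπ0 hπβ, mul_zero, add_zero, ihβ] at h1
      rw [h1, sigmaAway_mul_of_not_dvd hP0 hπD hβ0' fun h => hπβ ?_]
      · ring
      · rwa [Ideal.dvd_span_singleton, Ideal.mem_span_singleton] at h

end IsPrincipalData
end DefiniteData
end QuatOrders

/-! ### Uniformizers, finiteness of fibers, and passage to the suborder -/

namespace QuatOrders
namespace DefiniteData
open QuadraticData

namespace IsPerceptiveAt

variable {O R : Type*} [CommRing O] [IsDedekindDomain O] [Module.Free ℤ O] [Module.Finite ℤ O]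
  [Ring R] [Algebra O R] {Q : DefiniteData O R} {ϖ : O} {S : Subalgebra O R}
  (hS : Q.IsPerceptiveAt ϖ S)
include hS

/-- Comparing norms, `c nm(z)` is divisible by `ϖ²`, and `c` is prime to `ϖ`. -/
theorem mem_ext_of_mul_eq {x z j : R} {c : O} (hx : Q.nm x = ϖ * c) (hc : ¬ ϖ ∣ c)
    (hj : j ∈ Q.radical (Ideal.span {ϖ})) (h : x * z = algebraMap O R ϖ * j) :
    z ∈ ext R (Ideal.span {ϖ}) := by
  obtain ⟨d, hd⟩ := Ideal.mem_span_singleton.1 hj.1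
  have h1 := congrArg Q.nm h
  rw [Q.nm_mul, Q.nm_smul, hx, hd] at h1
  have h2 : c * Q.nm z = ϖ ^ 2 * d :=
    mul_left_cancel₀ hS.prime.ne_zero (by linear_combination h1)
  exact hS.mem_ext_of_sq_dvd (hS.prime.pow_dvd_of_dvd_mul_left 2 hc ⟨d, h2⟩)

/-- Conjugating `J = R x̄ + ϖ R` gives `J = x R + ϖ R`. Because `x x̄ = ϖ c` with `c` invertible
modulo `ϖ`, the second term can be shrunk to `ϖ J`. -/
theorem exists_eq_mul_add {x : R} {c : O} (hxJ : x ∈ Q.radical (Ideal.span {ϖ}))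
    (hx : Q.nm x = ϖ * c) (hc : ¬ ϖ ∣ c) {j : R} (hj : j ∈ Q.radical (Ideal.span {ϖ})) :
    ∃ h, ∃ m ∈ Q.radical (Ideal.span {ϖ}), j = x * h + algebraMap O R ϖ * m := by
  have hxI : Q.conj x ∉ ext R (Ideal.span {ϖ}) := fun h => by
    have h1 := Q.nm_mem_sq_of_mem_ext h
    rw [Q.nm_conj, hx, Ideal.span_singleton_pow, Ideal.mem_span_singleton, sq] at h1
    exact hc ((mul_dvd_mul_iff_left hS.prime.ne_zero).1 h1)
  obtain ⟨r, hr⟩ := (hS.mul_mem_ext_and_exists (Q.conj_mem_radical hxJ) hxI).2 _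
    (Q.conj_mem_radical hj)
  obtain ⟨z, hz⟩ := mem_ext_span.1 (Q.conj_mem_ext hr)
  rw [Q.conj_sub, Q.conj_conj, Q.conj_mul, Q.conj_conj] at hz
  obtain ⟨s, i, hi, hs⟩ := hS.isMaximal.exists_inv (mt Ideal.mem_span_singleton.1 hc)
  have h1 : algebraMap O R ϖ * z = x * (Q.conj x * (algebraMap O R s * z)) +
      algebraMap O R ϖ * (algebraMap O R i * z) := by
    rw [← mul_assoc x, Q.mul_conj, hx, ← mul_assoc, ← mul_assoc, ← map_mul, ← map_mul, ← add_mul,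
      ← map_add, show ϖ * c * s + ϖ * i = ϖ * (s * c + i) by ring, hs, mul_one]
  refine ⟨Q.conj r + Q.conj x * (algebraMap O R s * z), algebraMap O R i * z,
    Q.ext_le_radical (algebraMap_mul_mem_ext hi z), ?_⟩
  rw [mul_add, add_assoc, ← h1, ← hz]
  abel

theorem span_nm_eq {y : R} (hy : Q.radical (Ideal.span {ϖ}) = Ideal.span {y}) :
    Ideal.span {Q.nm y} = Ideal.span {ϖ} := by
  have hyJ : y ∈ Q.radical (Ideal.span {ϖ}) := hy ▸ Ideal.mem_span_singleton_self y
  obtain ⟨d, hd⟩ := Ideal.mem_span_singleton.1 hyJ.1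
  have hN := absNorm_pos hS.span_ne_bot
  have h1 : Nat.card (R ⧸ Ideal.span {y}) = Ideal.absNorm (Ideal.span {ϖ}) ^ 2 := by
    rw [← hy]; exact hS.index_facts.1
  have h0 : Q.nm y ≠ 0 := Q.nm_ne_zero_of_ext_le hS.span_ne_bot (hy ▸ Q.ext_le_radical)
  rw [Q.card_quot y h0, hd, ← Ideal.span_singleton_mul_span_singleton, map_mul, mul_pow] at h1
  have h2 : Ideal.absNorm (Ideal.span {d}) ^ 2 = 1 :=
    Nat.eq_of_mul_eq_mul_left (pow_pos hN 2) (by rw [h1, mul_one])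
  have h3 : Ideal.span {d} = ⊤ := Ideal.absNorm_eq_one_iff.1 (by simpa using h2)
  rw [hd, ← Ideal.span_singleton_mul_span_singleton, h3, Ideal.mul_top]

end IsPerceptiveAt
end DefiniteData

open DefiniteData QuadraticData NumberField

variable {K : Type*} [Field K] [NumberField K] [IsTotallyReal K] {a b : K}
  {G H : Subalgebra (𝓞 K) ℍ[K,a,b]}

theorem finite_of_sq_le (c : InfinitePlace K → ℝ) :
    {z : 𝓞 K | ∀ v, realEmb v (z : K) ^ 2 ≤ c v}.Finite := by
  set B : ℝ := 1 + ∑ v, |c v|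
  have hfin := (Embeddings.finite_of_norm_le K ℂ B)
  refine Set.Finite.of_finite_image (f := fun z : 𝓞 K => (z : K)) (hfin.subset ?_)
    (RingOfIntegers.coe_injective.injOn)
  rintro _ ⟨z, hz, rfl⟩
  refine ⟨RingOfIntegers.isIntegral_coe z, fun φ => ?_⟩
  have h1 : ‖φ (z : K)‖ = |realEmb (InfinitePlace.mk φ) (z : K)| := by
    rw [abs_realEmb]; exact (InfinitePlace.apply φ _).symm
  have h2 := hz (InfinitePlace.mk φ)
  have h3 : |c (InfinitePlace.mk φ)| ≤ ∑ v, |c v| :=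
    Finset.single_le_sum (f := fun v => |c v|) (fun v _ => abs_nonneg _) (Finset.mem_univ _)
  have h4 := le_abs_self (c (InfinitePlace.mk φ))
  rw [h1]
  set t := realEmb (InfinitePlace.mk φ) (z : K)
  have h5 : |t| ^ 2 = t ^ 2 := sq_abs t
  have h6 := abs_nonneg t
  have h7 := abs_nonneg (c (InfinitePlace.mk φ))
  by_contra h8
  push Not at h8
  nlinarith

theorem realEmb_nrd_nonneg (hdef : IsDefinite a b) (v : InfinitePlace K) (x : ℍ[K,a,b]) :
    0 ≤ realEmb v (nrd x) := by
  by_cases h : x = 0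
  · subst h; simp [nrd_eq]
  · exact (hdef x h _).le

/-- The traces against a finite generating set determine `x`, since the form is nondegenerate. By
Cauchy–Schwarz they are integers with bounded conjugates. -/
theorem finite_fiber (hdef : IsDefinite a b) (hH : IsOrder H) (α : 𝓞 K) :
    ((hH.data hdef).fiber ⊤ α).Finite := by
  set Q := hH.data hdef
  have hfin : Module.Finite (𝓞 K) H := Module.Finite.iff_fg.2 hH.fg
  obtain ⟨s, hs⟩ := hfin.fg_top
  let Φ : H → s → 𝓞 K := fun x e => Q.tr (x * Q.conj e)
  have hpos (v : InfinitePlace K) (x : H) : 0 ≤ realEmb v (Q.nm x : K) := by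
    rw [hH.coe_nm]; exact realEmb_nrd_nonneg hdef v _
  have hCS (v : InfinitePlace K) (x e : H) : realEmb v (Q.tr (x * Q.conj e) : K) ^ 2 ≤
      4 * realEmb v (Q.nm e : K) * realEmb v (Q.nm x : K) := by
    let f : 𝓞 K →+* ℝ := (realEmb v).comp (algebraMap (𝓞 K) K)
    have hf (r : 𝓞 K) : realEmb v (r : K) = f r := rfl
    rw [hf, hf, hf]
    by_cases he : e = 0
    · subst he
      simp [Q.conj_zero, Q.tr_zero, Q.nm_zero]
    have h1 : 0 < f (Q.nm e) := by
      rw [← hf, hH.coe_nm]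
      exact hdef _ (fun h => he (Subtype.ext h)) _
    -- Cauchy–Schwarz from the positivity of the norm of `2 nm(e) x - tr(x ē) e`, whose norm is
    -- `nm(e)` times the discriminant-like difference.
    have h2 : 0 ≤ f (Q.nm (algebraMap (𝓞 K) H (2 * Q.nm e) * x -
        algebraMap (𝓞 K) H (Q.tr (x * Q.conj e)) * e)) := hpos v _
    have h3 : Q.nm (algebraMap (𝓞 K) H (2 * Q.nm e) * x -
        algebraMap (𝓞 K) H (Q.tr (x * Q.conj e)) * e) =
        Q.nm e * (4 * Q.nm e * Q.nm x - Q.tr (x * Q.conj e) ^ 2) := by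
      have h4 (r s : 𝓞 K) : algebraMap (𝓞 K) H r * x * Q.conj (algebraMap (𝓞 K) H s * e) =
          algebraMap (𝓞 K) H s * (algebraMap (𝓞 K) H r * (x * Q.conj e)) := by
        rw [Q.conj_mul, Q.conj_algebraMap, ← mul_assoc, ← Algebra.commutes,
          mul_assoc (algebraMap (𝓞 K) H r)]
      rw [Q.nm_sub, Q.nm_smul, Q.nm_smul, h4, Q.tr_smul, Q.tr_smul]
      ring
    rw [h3, map_mul] at h2
    have h4 := nonneg_of_mul_nonneg_right h2 h1
    simp only [map_sub, map_mul, map_pow, map_ofNat] at h4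
    linarith
  have hinj : Function.Injective Φ := by
    intro x y hxy
    rw [← sub_eq_zero]
    set w := x - y
    have h1 : ∀ e ∈ s, Q.tr (w * Q.conj e) = 0 := fun e he => by
      have := congrFun hxy ⟨e, he⟩
      rw [sub_mul, Q.tr_sub, sub_eq_zero]; exact this
    have h2 (e : H) : Q.tr (w * Q.conj e) = 0 := by
      have he : e ∈ Submodule.span (𝓞 K) (s : Set H) := hs ▸ Submodule.mem_top
      refine Submodule.span_induction (p := fun e _ => Q.tr (w * Q.conj e) = 0) h1
        (by rw [Q.conj_zero, mul_zero, Q.tr_zero])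
        (fun e e' _ _ h h' => by rw [Q.conj_add, mul_add, Q.tr_add, h, h', add_zero])
        (fun r e _ h => ?_) he
      rw [Algebra.smul_def, Q.conj_mul, Q.conj_algebraMap, ← Algebra.commutes, ← mul_assoc,
        ← Algebra.commutes, mul_assoc, Q.tr_smul, h, mul_zero]
    have h3 := h2 w
    rw [Q.mul_conj, Q.tr_algebraMap] at h3
    exact Q.eq_zero_of_nm w ((mul_eq_zero.1 h3).resolve_left two_ne_zero)
  refine Set.Finite.of_finite_image (f := Φ) ?_ hinj.injOn
  refine (Set.Finite.pi' fun e : s => finite_of_sq_le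
    fun v => 4 * realEmb v (Q.nm e : K) * realEmb v (α : K)).subset ?_
  rintro _ ⟨x, hx, rfl⟩ e v
  have := hCS v x e
  rwa [hx.2] at this

/-- The restriction of a suborder to the ambient order. -/
abbrev suborder (G H : Subalgebra (𝓞 K) ℍ[K,a,b]) : Subalgebra (𝓞 K) H := G.comap H.val

/-- An ideal of an order as a submodule of the algebra. -/
def idealSubmodule (J : Ideal H) : Submodule (𝓞 K) ℍ[K,a,b] where
  carrier := {x | ∃ y ∈ J, (y : ℍ[K,a,b]) = x}
  zero_mem' := ⟨0, zero_mem _, rfl⟩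
  add_mem' := by
    rintro _ _ ⟨x, hx, rfl⟩ ⟨y, hy, rfl⟩
    exact ⟨x + y, add_mem hx hy, rfl⟩
  smul_mem' := by
    rintro r _ ⟨x, hx, rfl⟩
    refine ⟨algebraMap (𝓞 K) H r * x, Ideal.mul_mem_left _ _ hx, ?_⟩
    rw [smul_eq_mul_left]
    rfl

theorem idealSubmodule_le (J : Ideal H) : idealSubmodule J ≤ Subalgebra.toSubmodule H := by
  rintro _ ⟨x, -, rfl⟩
  exact x.2

/-- A maximal order contains all elements that stabilize a nonzero two-sided ideal. -/
theorem IsMaximalOrder.mem_of_mul_mem (hH : IsMaximalOrder H) {J : Ideal H} [J.IsTwoSided]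
    {r : 𝓞 K} (hr : r ≠ 0) (hrJ : algebraMap (𝓞 K) H r ∈ J) {x : ℍ[K,a,b]}
    (hx : ∀ y ∈ J, ∃ w ∈ J, (w : ℍ[K,a,b]) = y * x) : x ∈ H := by
  refine hH.mem_of_mem_rightOrder (I := idealSubmodule J)
    (fg_of_le hH.1.fg (idealSubmodule_le J)) hr ⟨_, hrJ, rfl⟩ ?_ ?_
  · rintro _ ⟨y, hy, rfl⟩ z hz
    exact ⟨y * ⟨z, hz⟩, Ideal.mul_mem_right _ _ hy, rfl⟩
  · rintro _ ⟨y, hy, rfl⟩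
    exact hx y hy

theorem isPerceptiveAt (hdef : IsDefinite a b) (hH : IsMaximalOrder H) (hG : IsOrder G)
    (hGH : G ≤ H) [IsPrincipalIdealRing (𝓞 K)] (hperc : IsPerceptive G H) {ϖ : 𝓞 K}
    (hϖ : Prime ϖ) (hD : discrd H ≤ Ideal.span {ϖ}) (hI : HasIndex H G (Ideal.span {ϖ} ^ 2)) :
    (hH.1.data hdef).IsPerceptiveAt ϖ (suborder G H) := by
  obtain ⟨hcond, hindex⟩ := hI.conductor_and_index hG hH.1 hGH
  set Q := hH.1.data hdef
  refine ⟨hϖ, (hH.1.discLE_iff hdef).2 hD, fun x => ?_, fun x => ?_, ?_, fun x hx => ?_⟩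
  · obtain ⟨u, ⟨hu, hu'⟩, hux⟩ := hperc x x.2
    refine ⟨⟨u, hu⟩, RingOfIntegers.coe_injective ?_, hux⟩
    exact (IsOrder.coe_nm hdef hH.1 ⟨u, hu⟩).trans (hu'.trans (map_one _).symm)
  · exact hcond (ϖ ^ 2) (Ideal.pow_mem_pow (Ideal.mem_span_singleton_self ϖ) 2) x x.2
  · rw [← map_pow, ← hindex]
    rfl
  · have hϖ' : (ϖ : K) ≠ 0 := by simpa using hϖ.ne_zero
    have hinv : algebraMap K ℍ[K,a,b] (ϖ : K) * algebraMap K ℍ[K,a,b] (ϖ : K)⁻¹ = 1 := by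
      rw [← map_mul, mul_inv_cancel₀ hϖ', map_one]
    have hinv' : algebraMap K ℍ[K,a,b] (ϖ : K)⁻¹ * algebraMap K ℍ[K,a,b] (ϖ : K) = 1 := by
      rw [← map_mul, inv_mul_cancel₀ hϖ', map_one]
    -- The quotient `x / ϖ` stabilizes the two-sided radical from the right, so maximality of `H`
    -- applies.
    have hxH : algebraMap K ℍ[K,a,b] (ϖ : K)⁻¹ * x ∈ H := by
      refine hH.mem_of_mul_mem (J := Q.radical (Ideal.span {ϖ})) hϖ.ne_zero
        (Q.algebraMap_mem_radical (Ideal.mem_span_singleton_self ϖ)) fun y hy => ?_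
      obtain ⟨w, hw, h⟩ := hx y hy
      refine ⟨w, hw, ?_⟩
      have h1 : (y : ℍ[K,a,b]) * x = algebraMap K ℍ[K,a,b] (ϖ : K) * w := congrArg Subtype.val h
      rw [← mul_assoc, ← Algebra.commutes, mul_assoc, h1, ← mul_assoc, hinv', one_mul]
    refine ⟨⟨_, hxH⟩, Subtype.ext ?_⟩
    change (x : ℍ[K,a,b]) = algebraMap K ℍ[K,a,b] (ϖ : K) *
      (algebraMap K ℍ[K,a,b] (ϖ : K)⁻¹ * x)
    rw [← mul_assoc, hinv, one_mul]

end QuatOrders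

/-! ### Principality at the distinguished prime -/

namespace QuatOrders
open DefiniteData QuadraticData NumberField

variable {K : Type*} [Field K] [NumberField K] [IsTotallyReal K] {a b : K}
  {G H : Subalgebra (𝓞 K) ℍ[K,a,b]}

/-- The submodule `x G + r J`. -/
def mixedLattice (G : Subalgebra (𝓞 K) ℍ[K,a,b]) (x : H) (r : 𝓞 K) (J : Ideal H) :
    Submodule (𝓞 K) ℍ[K,a,b] where
  carrier := {z | ∃ g ∈ G, ∃ m ∈ J, (x : ℍ[K,a,b]) * g + (algebraMap (𝓞 K) H r * m : H) = z}
  zero_mem' := ⟨0, zero_mem G, 0, zero_mem J, by simp⟩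
  add_mem' := by
    rintro _ _ ⟨g, hg, m, hm, rfl⟩ ⟨g', hg', m', hm', rfl⟩
    refine ⟨g + g', add_mem hg hg', m + m', add_mem hm hm', ?_⟩
    rw [mul_add, mul_add]
    push_cast
    abel
  smul_mem' := by
    rintro s _ ⟨g, hg, m, hm, rfl⟩
    refine ⟨algebraMap (𝓞 K) ℍ[K,a,b] s * g, G.mul_mem (G.algebraMap_mem s) hg,
      algebraMap (𝓞 K) H s * m, Ideal.mul_mem_left _ _ hm, ?_⟩
    have h1 : algebraMap (𝓞 K) H r * (algebraMap (𝓞 K) H s * m) =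
        algebraMap (𝓞 K) H s * (algebraMap (𝓞 K) H r * m) := by
      rw [← mul_assoc, ← mul_assoc, ← map_mul, ← map_mul, mul_comm]
    have h2 : (x : ℍ[K,a,b]) * (algebraMap (𝓞 K) ℍ[K,a,b] s * g) =
        algebraMap (𝓞 K) ℍ[K,a,b] s * (x * g) := by
      rw [← mul_assoc, ← mul_assoc, Algebra.commutes]
    rw [smul_eq_mul_left, h1, h2, mul_add]
    rfl

/-- Take `π ∈ J` with norm of valuation 1. The lattice `L = π G + ϖ J` has right order `G`, so `L =
x G`; and `L H = π H + ϖ J = J` makes `J` principal. -/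
theorem exists_radical_eq_span (hdef : IsDefinite a b) (hH : IsMaximalOrder H) (hG : IsOrder G)
    (hGH : G ≤ H) (hcls : classNumber G = 1) {ϖ : 𝓞 K}
    (hS : (hH.1.data hdef).IsPerceptiveAt ϖ (suborder G H)) :
    ∃ y, (hH.1.data hdef).radical (Ideal.span {ϖ}) = Ideal.span {y} := by
  set Q := hH.1.data hdef
  set J := Q.radical (Ideal.span {ϖ})
  obtain ⟨π, hπJ, c, hπ, hc⟩ := hS.exists_uniformizer
  have hϖJ (z : H) : algebraMap (𝓞 K) H ϖ * z ∈ J :=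
    Ideal.mul_mem_right _ _ (Q.algebraMap_mem_radical (Ideal.mem_span_singleton_self ϖ))
  set L := mixedLattice G π ϖ J
  have hLJ {z : ℍ[K,a,b]} (hz : z ∈ L) : ∃ j ∈ J, (j : ℍ[K,a,b]) = z := by
    obtain ⟨g, hg, m, hm, rfl⟩ := hz
    exact ⟨π * ⟨g, hGH hg⟩ + algebraMap (𝓞 K) H ϖ * m,
      add_mem (Ideal.mul_mem_right _ _ hπJ) (Ideal.mul_mem_left _ _ hm), rfl⟩
  have hLlat : Submodule.IsLattice K L := by
    refine isLattice_of_smul_mem (M := Subalgebra.toSubmodule H) hH.1 hH.1.fg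
      (fun z hz => ?_) (pow_ne_zero 2 hS.prime.ne_zero) fun z hz => ?_
    · obtain ⟨j, -, rfl⟩ := hLJ hz
      exact j.2
    · refine ⟨0, zero_mem G, _, hϖJ ⟨z, hz⟩, ?_⟩
      rw [mul_zero, zero_add, ← mul_assoc, ← map_mul, ← sq, smul_eq_mul_left]
      rfl
  have hπL : (π : ℍ[K,a,b]) ∈ L := ⟨1, one_mem G, 0, zero_mem J, by simp⟩
  have hmL {m : H} (hm : m ∈ J) : ((algebraMap (𝓞 K) H ϖ * m : H) : ℍ[K,a,b]) ∈ L :=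
    ⟨0, zero_mem G, m, hm, by simp⟩
  have hLG : rightOrder L = G := by
    refine le_antisymm (fun y hy => ?_) ?_
    -- First `ϖ y` stabilizes `J`, so lies in `H`; then `π (ϖ y) ∈ ϖ J` forces `ϖ y ∈ ϖ H`, that is
    -- `y ∈ H`. Finally `π y = π g + ϖ m` gives `y - g ∈ ϖ H ⊆ G`.
    · have hy1 : algebraMap (𝓞 K) ℍ[K,a,b] ϖ * y ∈ H := by
        refine hH.mem_of_mul_mem (J := J) hS.prime.ne_zero
          (Q.algebraMap_mem_radical (Ideal.mem_span_singleton_self ϖ)) fun m hm => ?_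
        obtain ⟨j, hj, h⟩ := hLJ (hy _ (hmL hm))
        refine ⟨j, hj, h.trans ?_⟩
        rw [← mul_assoc, ← Algebra.commutes]
        rfl
      obtain ⟨j, hj, h⟩ := hLJ (hy _ hπL)
      have hy2 : π * ⟨_, hy1⟩ = algebraMap (𝓞 K) H ϖ * j := Subtype.ext <| by
        change (π : ℍ[K,a,b]) * (algebraMap (𝓞 K) ℍ[K,a,b] ϖ * y) =
          algebraMap (𝓞 K) ℍ[K,a,b] ϖ * j
        rw [h, ← mul_assoc, ← mul_assoc, Algebra.commutes]
      obtain ⟨y', hy'⟩ := mem_ext_span.1 (hS.mem_ext_of_mul_eq hπ hc hj hy2)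
      have hyy : y = y' := by
        have h1 : algebraMap K ℍ[K,a,b] (ϖ : K) * y = algebraMap K ℍ[K,a,b] (ϖ : K) * y' :=
          congrArg Subtype.val hy'
        have h2 : (ϖ : K) ≠ 0 := by simpa using hS.prime.ne_zero
        rw [← Algebra.smul_def, ← Algebra.smul_def] at h1
        exact smul_right_injective _ h2 h1
      obtain ⟨g, hg, m, hm, h3⟩ := hy _ hπL
      have h4 : π * (y' - ⟨g, hGH hg⟩) = algebraMap (𝓞 K) H ϖ * m := by
        rw [mul_sub, sub_eq_iff_eq_add, add_comm]
        refine Subtype.ext ?_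
        rw [hyy] at h3
        exact h3.symm
      have h5 : y' - ⟨g, hGH hg⟩ ∈ suborder G H :=
        hS.ext_le (hS.mem_ext_of_mul_eq hπ hc hm h4)
      have h6 : (y' : ℍ[K,a,b]) - g ∈ G := h5
      have := add_mem h6 hg
      rwa [sub_add_cancel, ← hyy] at this
    · rintro y hy _ ⟨g, hg, m, hm, rfl⟩
      refine ⟨g * y, G.mul_mem hg hy, m * ⟨y, hGH hy⟩, Ideal.mul_mem_right _ _ hm, ?_⟩
      rw [add_mul, mul_assoc, ← mul_assoc (algebraMap (𝓞 K) H ϖ)]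
      rfl
  obtain ⟨x, hx⟩ := exists_eq_mul_of_classNumber hG hcls hLlat hLG
  have hmem (z : ℍ[K,a,b]) : z ∈ L ↔ ∃ g ∈ G, (x : ℍ[K,a,b]) * g = z := by
    rw [← SetLike.mem_coe, hx]; rfl
  obtain ⟨x', hx'J, hx'⟩ := hLJ ((hmem x).2 ⟨1, one_mem G, mul_one _⟩)
  refine ⟨Q.conj x', le_antisymm (fun j hj => ?_)
    ((Ideal.span_singleton_le_iff_mem _).2 (Q.conj_mem_radical hx'J))⟩
  -- Since `J = π H + ϖ J` and both `π` and `ϖ m` lie in `x G`, the element `x` generates `J` as a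
  -- right ideal; conjugation yields a left generator.
  obtain ⟨h, m, hm, hjm⟩ := hS.exists_eq_mul_add hπJ hπ hc (Q.conj_mem_radical hj)
  obtain ⟨g₁, hg₁, h1⟩ := (hmem _).1 hπL
  obtain ⟨g₂, hg₂, h2⟩ := (hmem _).1 (hmL hm)
  have h3 : Q.conj j = x' * (⟨g₁, hGH hg₁⟩ * h + ⟨g₂, hGH hg₂⟩) := by
    rw [hjm]
    refine Subtype.ext ?_
    change (π : ℍ[K,a,b]) * h + ((algebraMap (𝓞 K) H ϖ * m : H) : ℍ[K,a,b]) =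
      (x' : ℍ[K,a,b]) * (g₁ * h + g₂)
    rw [hx', mul_add, ← mul_assoc, h1, h2]
  rw [← Q.conj_conj j, h3, Q.conj_mul]
  exact Ideal.mul_mem_left _ _ (Ideal.mem_span_singleton_self _)

/-- A prime other than `ϖ` is coprime to the annihilator `ϖ²` of `H / G`, so ideals there are
principal. The ramified prime `ϖ` is served by the generator of the radical. -/
theorem isPrincipalData (hdef : IsDefinite a b) (hH : IsMaximalOrder H) (hG : IsOrder G)
    (hGH : G ≤ H) (hcls : classNumber G = 1) {ϖ : 𝓞 K}
    (hpos : ∀ I : Ideal (𝓞 K), I ≠ ⊥ → HasPosGenerator I)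
    (hcond : ∀ r ∈ Ideal.span {ϖ} ^ 2, ∀ x ∈ H, algebraMap (𝓞 K) ℍ[K,a,b] r * x ∈ G)
    (hD : discrd H ≤ Ideal.span {ϖ})
    (hS : (hH.1.data hdef).IsPerceptiveAt ϖ (suborder G H)) :
    (hH.1.data hdef).IsPrincipalData (discrd H) fun r => TotallyPositive (r : K) := by
  have hP {π : 𝓞 K} (hπ : Prime π) (hne : Ideal.span {π} ≠ Ideal.span {ϖ}) :
      Ideal.span {π} ≠ ⊥ ∧ (Ideal.span {π}).IsMaximal ∧ PrincipalAt H (Ideal.span {π}) := by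
    have h0 : Ideal.span {π} ≠ ⊥ := by simpa using hπ.ne_zero
    have hmax := ((Ideal.span_singleton_prime hπ.ne_zero).2 hπ).isMaximal h0
    refine ⟨h0, hmax, principalAt_of_classNumber hH hG hGH hcls hcond h0 ?_⟩
    refine IsCoprime.pow_right (Ideal.isCoprime_iff_sup_eq.2 ?_)
    exact Ideal.IsMaximal.coprime_of_ne hmax hS.isMaximal hne
  refine ⟨fun x hx => ?_, fun x y hxy hx => ?_, fun x hx => ?_, hpos,
    exists_sq_of_totallyPositive hpos, finite_fiber hdef hH.1, fun π hπ hπD => ?_,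
    fun π hπ hπD => ?_⟩
  · rw [IsOrder.coe_nm]
    refine hdef _ fun h => hx ?_
    have : x = 0 := Subtype.ext h
    rw [this]
    exact (hH.1.data hdef).nm_zero
  · refine TotallyPositive.of_mul_left (x := (x : K)) ?_ hx
    have h1 : ((x * y : 𝓞 K) : K) = (x : K) * (y : K) := map_mul _ _ _
    rwa [← h1]
  · rintro rfl
    exact hx.ne_zero (map_zero _)
  · by_cases hne : Ideal.span {π} = Ideal.span {ϖ}
    · obtain ⟨y, hy⟩ := exists_radical_eq_span hdef hH hG hGH hcls hS
      rw [hne]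
      exact ⟨y, hS.span_nm_eq hy, fun x hx => hy ▸ hS.mem_radical_of_nm hx⟩
    · obtain ⟨h0, hmax, hpr⟩ := hP hπ hne
      obtain ⟨y, hy, hy'⟩ := (hH.1.data hdef).exists_generator_of_discLE h0 hpr
        ((hH.1.discLE_iff hdef).2 (Ideal.dvd_iff_le.1 hπD))
      exact ⟨y, hy, fun x => (hy' x).1⟩
  · have hne : Ideal.span {π} ≠ Ideal.span {ϖ} := fun h => hπD (by
      rw [h]; exact Ideal.dvd_iff_le.2 hD)
    refine ⟨(hP hπ hne).2.2, fun h => hπD (Ideal.dvd_iff_le.2 ?_)⟩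
    exact (hH.1.discLE_iff hdef).1 h

theorem sigmaCoprime_eq [IsPrincipalIdealRing (𝓞 K)] (D : Ideal (𝓞 K)) (α : 𝓞 K) :
    sigmaCoprime D α = sigmaAway D (Ideal.span {α}) := by
  have : coprimeDivisors D α = awayDivisors D (Ideal.span {α}) := by
    ext I
    refine ⟨fun h => h.2, fun h => ⟨?_, h⟩⟩
    obtain ⟨δ, hδ⟩ := (IsPrincipalIdealRing.principal I).principal
    exact ⟨δ, hδ⟩
  rw [sigmaCoprime, sigmaAway, this]

/-- Norm fibers of an order inside `H`, computed in `H`. -/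
theorem normFiber_eq_image (hdef : IsDefinite a b) (hH : IsOrder H) (hGH : G ≤ H) (α : 𝓞 K) :
    normFiber G α = Subtype.val '' (hH.data hdef).fiber (suborder G H) α := by
  ext x
  constructor
  · rintro ⟨hx, h⟩
    refine ⟨⟨x, hGH hx⟩, ⟨hx, RingOfIntegers.coe_injective ?_⟩, rfl⟩
    exact (IsOrder.coe_nm hdef hH _).trans h
  · rintro ⟨x, ⟨hx, h⟩, rfl⟩
    refine ⟨hx, ?_⟩
    rw [← IsOrder.coe_nm hdef hH, h]

theorem normOne_eq_normFiber : normOne G = normFiber G 1 := by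
  ext x
  simp [normOne, normFiber]

end QuatOrders

end

/-! ### The main theorem -/

theorem mainTheorem7 {K : Type*} [Field K] [NumberField K] [NumberField.IsTotallyReal K]
    (a b : K) (hdef : QuatOrders.IsDefinite a b)
    (G M H : Subalgebra (𝓞 K) ℍ[K,a,b])
    (hG : QuatOrders.IsOrder G) (hM : QuatOrders.IsOrder M) (hH : QuatOrders.IsMaximalOrder H)
    (hperc : QuatOrders.IsPerceptive G H)
    (hcls : QuatOrders.classNumber G = 1)
    (hlin : QuatOrders.HasLinearPosetOfOrders G H) (hGM : G < M) (hMH : M < H)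
    (p : Ideal (𝓞 K)) (hp : p.IsPrime) (hp0 : p ≠ ⊥) (hpD : p ∣ QuatOrders.discrd H)
    (hkind : QuatOrders.HasIndex H G (p ^ 2))
    (α : 𝓞 K) (hα : QuatOrders.TotallyPositive (α : K))
    (e : ℕ) (he : α ∈ p ^ e) (he' : α ∉ p ^ (e + 1)) :
    (QuatOrders.normOne G).Finite ∧ (QuatOrders.normFiber G α).Finite ∧
      (QuatOrders.normFiber G α).ncard =
        (QuatOrders.normOne G).ncard * QuatOrders.sigmaCoprime (QuatOrders.discrd H) α *
          (if e = 0 then 1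
            else if e = 1 then Ideal.absNorm p
            else Ideal.absNorm p ^ 2 + Ideal.absNorm p) := by
  open QuatOrders DefiniteData in
  have hGH : G ≤ H := hGM.le.trans hMH.le
  have hpos : ∀ I : Ideal (𝓞 K), I ≠ ⊥ → HasPosGenerator I :=
    fun I hI => hasPosGenerator_of_classNumber hdef hH hG hGH hcls hI
  have := isPrincipalIdealRing_of_hasPosGenerator hpos
  obtain ⟨ϖ, -, rfl⟩ := hpos p hp0
  have hϖ : Prime ϖ := (Ideal.span_singleton_prime (by simpa using hp0)).1 hp
  have hD := Ideal.dvd_iff_le.1 hpD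
  have hS := isPerceptiveAt hdef hH hG hGH hperc hϖ hD hkind
  have hQ := isPrincipalData hdef hH hG hGH hcls hpos
    (hkind.conductor_and_index hG hH.1 hGH).1 hD hS
  have hfin (β : 𝓞 K) : ((hH.1.data hdef).fiber (suborder G H) β).Finite :=
    (hQ.finite_fiber β).subset fun x hx => ⟨trivial, hx.2⟩
  rw [normOne_eq_normFiber, normFiber_eq_image hdef hH.1 hGH, normFiber_eq_image hdef hH.1 hGH]
  refine ⟨(hfin 1).image _, (hfin α).image _, ?_⟩
  rw [Set.ncard_image_of_injective _ Subtype.val_injective,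
    Set.ncard_image_of_injective _ Subtype.val_injective, ← Nat.card_coe_set_eq,
    ← Nat.card_coe_set_eq, sigmaCoprime_eq]
  obtain ⟨h0, h1, h2⟩ := hS.card_fiber (hQ.finite_fiber 1) (hQ.finite_fiber α)
    (hQ.card_fiber_eq hα)
  rw [Ideal.span_singleton_pow, Ideal.mem_span_singleton] at he he'
  split_ifs with he0 he1
  · subst he0
    rw [h0 (by simpa using he'), mul_one]
  · subst he1
    exact h1 (by simpa using he) he'
  · exact h2 ((pow_dvd_pow ϖ (by omega)).trans he)
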